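/- **The model.** Fix constants $R,T_0,\mathrm{Pr}>0$, put $\delta=2$, and let $\mu,Z_{rot},Z_{vib}$ (functions of a temperature $T>0$) and $\tau_{\mathcal C}$ (a function of a density $\rho>0$ and a temperature $T>0$) be positive and $C^1$; set $\tau(\rho,T)=\mu(T)/(\rho RT\,\mathrm{Pr})$. For $\phi(v,\varepsilon,i)$ with $v\in\mathbb R^3$, $\varepsilon\ge 0$, $i\in\mathbb N$, write $\langle\phi\rangle=\sum_{i\ge0}\int_{\mathbb R^3}\int_0^\infty\phi\,d\varepsilon\,dv$. Let $$e_{tr}(T)=\tfrac32RT,\quad e_{rot}(T)=\tfrac\delta2RT,\quad e_{vib}(T)=\frac{RT_0}{e^{T_0/T}-1},\quad e=e_{tr}+e_{rot}+e_{vib},$$ $c_v^{\alpha}=de_\alpha/dT$, $c_v=de/dT$, $\gamma=(c_v+R)/c_v$ and $\delta_v(T)=\frac{2T_0/T}{e^{T_0/T}-1}$. For a distribution $f\ge0$ let $\rho=\langle f\rangle$, $\rho u=\langle vf\rangle$, $\rho\Theta=\langle (v-u)\otimes(v-u)f\rangle$, $\rho E_{tr}=\langle\frac12|v-u|^2f\rangle$,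 $\rho E_{rot}=\langle\varepsilon f\rangle$, $\rho E_{vib}=\langle iRT_0f\rangle$, $T_\alpha=e_\alpha^{-1}(E_\alpha)$ for $\alpha\in\{tr,rot,vib\}$, and $T_{eq}=e^{-1}(E_{tr}+E_{rot}+E_{vib})$. Put $\theta_\alpha=\tau/(Z_\alpha\tau_{\mathcal C})$ for $\alpha\in\{rot,vib\}$, with $\tau,\tau_{\mathcal C},Z_\alpha$ taken at $(\rho,T_{tr})$, and define $T^{rel}_\alpha$, $\Pi$ by $$e_\alpha(T_\alpha^{rel})=e_\alpha(T_\alpha)+\theta_\alpha\big(e_\alpha(T_{tr})-e_\alpha(T_\alpha)\big)\quad(\alpha=rot,vib),$$ $$e_{tr}(T_{tr}^{rel})=e_{tr}(T_{tr})-\sum_{\alpha=rot,vib}\theta_\alpha\big(e_\alpha(T_{tr})-e_\alpha(T_\alpha)\big),\qquad \Pi=RT_{tr}^{rel}I+\tfrac{\mathrm{Pr}-1}{\mathrm{Pr}}(\Theta-RT_{tr}I).$$ With $\Lambda=1/\Gamma(\delta/2)$, let $$\mathcal G[f]=\frac{\rho}{\sqrt{\det(2\pi\Pi)}}e^{-\frac12(v-u)^T\Pi^{-1}(v-u)}\cdot\frac{\Lambda\,\varepsilon^{\frac{\delta-2}2}}{(RT_{rot}^{rel})^{\delta/2}}e^{-\varepsilon/(RT_{rot}^{rel})}\cdot(1-e^{-T_0/T_{vib}^{rel}})e^{-iT_0/T_{vib}^{rel}},$$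 and let $\mathcal M[f]$ be the same expression with $\Pi$ replaced by $RT_{eq}I$ and $T_{rot}^{rel},T_{vib}^{rel}$ replaced by $T_{eq}$. The non-dimensional ES-BGK equation is $$\partial_tf+v\cdot\nabla_xf=\frac1{\mathrm{Kn}\,\tau}(\mathcal G[f]-f).$$ **Assumptions.** Let $U\subset\mathbb R\times\mathbb R^3$ be open, $\mathrm{Kn}_0>0$, and for $0<\mathrm{Kn}<\mathrm{Kn}_0$ let $f=f^{\mathrm{Kn}}(t,x,v,\varepsilon,i)\ge0$ be a classical solution for $(t,x)\in U$ on which the model is well defined (positive density, positive rotational and vibrational relaxation energies, $\Pi$ positive definite). Assume that the family is regular uniformly in $\mathrm{Kn}$: $f$ is $C^2$ in $(t,x)$ on $U$; there is a function $g(v,\varepsilon,i)$ with $\langle(1+|v|^2)(1+|v|^2+\varepsilon+i)\,g\rangle<\infty$ that bounds $f$ and all its derivatives in $(t,x)$ of order at most $2$, for all $\mathrm{Kn}$ and all $(t,x)\in U$; and $\rho$ and $T_{tr}$ are bounded below by a positive constant, uniformly in $\mathrm{Kn}$ and $(t,x)\in U$. **Proposition (Chapman–Enskog distribution).** For $0<\mathrm{Kn}<\mathrm{Kn}_0$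 and $(t,x)\in U$, $T_{eq}>0$ exists and $u,T_{eq}$ are differentiable in $x$, and the first-order expansion of $f$ as $\mathrm{Kn}\to0$ is $$f=\mathcal M[f]-\tau\,\mathrm{Kn}\,\mathcal M[f]\left(A(V,J,K)\cdot\frac{\nabla(RT_{eq})}{\sqrt{RT_{eq}}}+B(V,J,K):\nabla u\right)+O(\mathrm{Kn}^2),$$ where $V=\frac{v-u}{\sqrt{RT_{eq}}}$, $J=\frac{\varepsilon}{RT_{eq}}$, $K=\frac{iT_0}{T_{eq}}$, $$A=\Big(\tfrac{|V|^2}2-\tfrac52\Big)V+\Big(J-\tfrac\delta2\Big)V+\Big(K-\tfrac{\delta_v(T_{eq})}2\Big)V,\qquad B=B_{tr}+B_{rot}+B_{vib},$$ $$B_{tr}=\mathrm{Pr}\Big(V\otimes V-\Big(\big(\tfrac{|V|^2}2-\tfrac32\big)\big(\tfrac23-\tfrac\zeta\mu\big)+1\Big)I\Big),$$ $$B_{rot}=-\Big(\tfrac{\tau_{\mathcal C}}{\tau}Z_{rot}(\gamma-1)-\tfrac\zeta\mu\mathrm{Pr}\Big)\Big(J-\tfrac\delta2\Big)I,\qquad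 B_{vib}=-\Big(\tfrac{\tau_{\mathcal C}}{\tau}Z_{vib}(\gamma-1)-\tfrac\zeta\mu\mathrm{Pr}\Big)\Big(K-\tfrac{\delta_v(T_{eq})}2\Big)I,$$ $$\zeta=\rho RT_{eq}\,R\left(Z_{rot}\tau_{\mathcal C}\frac{c_v^{rot}}{c_v(T_{eq})^2}+Z_{vib}\tau_{\mathcal C}\frac{c_v^{vib}(T_{eq})}{c_v(T_{eq})^2}\right),$$ and $\mu,\tau,\tau_{\mathcal C},Z_{rot},Z_{vib},\gamma$ are taken at $(\rho,T_{eq})$; the quantities $\rho,u,T_{eq}$ are those of $f=f^{\mathrm{Kn}}$ itself. Here $O(\mathrm{Kn}^2)$ means: there is a function $h(v,\varepsilon,i)$ with $\langle(1+|v|^2+\varepsilon+i)\,|h|\rangle<\infty$ such that, for all sufficiently small $\mathrm{Kn}>0$, the remainder is at most $h(v,\varepsilon,i)\,\mathrm{Kn}^2$ in absolute value for all $(t,x)\in U$, $v\in\mathbb R^3$, $\varepsilon\ge0$ and $i\in\mathbb N$. -/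

import Mathlib

open scoped Topology

namespace ESBGK

noncomputable section

/-- Position / velocity space. -/
abbrev E3 : Type := EuclideanSpace ℝ (Fin 3)

/-- Microscopic states `(v, ε, i)`: velocity, rotational energy (only `ε ≥ 0` is physical) and
vibrational level. -/
abbrev Phase : Type := E3 × ℝ × ℕ

/-- The measure `∑ᵢ ∫_{ℝ³} ∫_{ε ≥ 0} dε dv`. -/
def phaseMeasure : MeasureTheory.Measure Phase :=
  (MeasureTheory.volume : MeasureTheory.Measure E3).prod
    (((MeasureTheory.volume : MeasureTheory.Measure ℝ).restrict (Set.Ici 0)).prod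
      (MeasureTheory.Measure.count : MeasureTheory.Measure ℕ))

/-- The bracket `⟨φ⟩_{v,ε,i}`. -/
def bracket (φ : Phase → ℝ) : ℝ := ∫ z, φ z ∂phaseMeasure

/-- Number `δ` of rotational degrees of freedom. -/
def rotDof : ℝ := 2

/-- Parameters of the model: gas constant, characteristic vibrational temperature, Prandtl number,
viscosity and collision numbers as functions of a temperature, and collision time as a function of
a density and a temperature. -/
structure GasParams where
  R : ℝ
  T₀ : ℝ
  Pr : ℝ
  visc : ℝ → ℝ
  Zrot : ℝ → ℝ
  Zvib : ℝ → ℝ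
  tauC : ℝ → ℝ → ℝ
  R_pos : 0 < R
  T₀_pos : 0 < T₀
  Pr_pos : 0 < Pr
  visc_pos : ∀ T, 0 < T → 0 < visc T
  Zrot_pos : ∀ T, 0 < T → 0 < Zrot T
  Zvib_pos : ∀ T, 0 < T → 0 < Zvib T
  tauC_pos : ∀ r T, 0 < r → 0 < T → 0 < tauC r T
  visc_smooth : ContDiffOn ℝ 1 visc (Set.Ioi 0)
  Zrot_smooth : ContDiffOn ℝ 1 Zrot (Set.Ioi 0)
  Zvib_smooth : ContDiffOn ℝ 1 Zvib (Set.Ioi 0)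
  tauC_smooth : ContDiffOn ℝ 1 (fun q : ℝ × ℝ => tauC q.1 q.2) (Set.Ioi 0 ×ˢ Set.Ioi 0)

variable (P : GasParams)

/-! Equilibrium energies, their inverses and specific heats. -/

def eTr (T : ℝ) : ℝ := 3 / 2 * P.R * T

def eRot (T : ℝ) : ℝ := rotDof / 2 * P.R * T

def eVib (T : ℝ) : ℝ := P.R * P.T₀ / (Real.exp (P.T₀ / T) - 1)

def eTot (T : ℝ) : ℝ := eTr P T + eRot P T + eVib P T

def eTrInv (E : ℝ) : ℝ := 2 / (3 * P.R) * E

def eRotInv (E : ℝ) : ℝ := 2 / (rotDof * P.R) * E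

def eVibInv (E : ℝ) : ℝ := P.T₀ / Real.log (1 + P.R * P.T₀ / E)

/-- The positive temperature at which the total energy is `E`. -/
def eTotInv (E : ℝ) : ℝ := Function.invFunOn (eTot P) (Set.Ioi 0) E

def cTr : ℝ := 3 / 2 * P.R

def cRot : ℝ := rotDof / 2 * P.R

def cVib (T : ℝ) : ℝ :=
  P.R * (P.T₀ ^ 2 / T ^ 2) * (Real.exp (P.T₀ / T) / (Real.exp (P.T₀ / T) - 1) ^ 2)

def cv (T : ℝ) : ℝ := cTr P + cRot P + cVib P T

def cp (T : ℝ) : ℝ := cv P T + P.R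

def gam (T : ℝ) : ℝ := cp P T / cv P T

/-- Temperature-dependent number `δ_v` of vibrational degrees of freedom. -/
def vibDof (T : ℝ) : ℝ := 2 * P.T₀ / T / (Real.exp (P.T₀ / T) - 1)

/-- Relaxation time `τ` at density `r` and temperature `T`. -/
def tau (r T : ℝ) : ℝ := P.visc T / (r * P.R * T * P.Pr)

/-! Macroscopic quantities of a distribution `φ` on the phase space. -/

def density (φ : Phase → ℝ) : ℝ := bracket φ

def velocity (φ : Phase → ℝ) : E3 :=
  WithLp.toLp 2 (fun j => bracket (fun z => z.1 j * φ z) / density φ)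

def energyTr (φ : Phase → ℝ) : ℝ :=
  bracket (fun z => 1 / 2 * ‖z.1 - velocity φ‖ ^ 2 * φ z) / density φ

def energyRot (φ : Phase → ℝ) : ℝ := bracket (fun z => z.2.1 * φ z) / density φ

def energyVib (φ : Phase → ℝ) : ℝ :=
  bracket (fun z => (z.2.2 : ℝ) * P.R * P.T₀ * φ z) / density φ

def energy (φ : Phase → ℝ) : ℝ :=
  bracket (fun z => (1 / 2 * ‖z.1 - velocity φ‖ ^ 2 + z.2.1 + (z.2.2 : ℝ) * P.R * P.T₀) * φ z)
    / density φ

/-- The tensor `Θ`, i.e. the pressure tensor divided by the density. -/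
def Theta (φ : Phase → ℝ) : Matrix (Fin 3) (Fin 3) ℝ :=
  Matrix.of fun i j =>
    bracket (fun z => (z.1 - velocity φ) i * (z.1 - velocity φ) j * φ z) / density φ

def tempTr (φ : Phase → ℝ) : ℝ := eTrInv P (energyTr φ)

def tempRot (φ : Phase → ℝ) : ℝ := eRotInv P (energyRot φ)

def tempVib (φ : Phase → ℝ) : ℝ := eVibInv P (energyVib P φ)

def tempEq (φ : Phase → ℝ) : ℝ := eTotInv P (energy P φ)

/-! Relaxation energies, temperatures and tensor; `τ`, `τ_C`, `Z_rot`, `Z_vib` are taken at the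
translational temperature. -/

def tauOf (φ : Phase → ℝ) : ℝ := tau P (density φ) (tempTr P φ)

/-- `τ / (Z_rot τ_C)` -/
def thetaRot (φ : Phase → ℝ) : ℝ :=
  tauOf P φ / (P.Zrot (tempTr P φ) * P.tauC (density φ) (tempTr P φ))

/-- `τ / (Z_vib τ_C)` -/
def thetaVib (φ : Phase → ℝ) : ℝ :=
  tauOf P φ / (P.Zvib (tempTr P φ) * P.tauC (density φ) (tempTr P φ))

def relEnergyRot (φ : Phase → ℝ) : ℝ :=
  eRot P (tempRot P φ) + thetaRot P φ * (eRot P (tempTr P φ) - eRot P (tempRot P φ))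

def relEnergyVib (φ : Phase → ℝ) : ℝ :=
  eVib P (tempVib P φ) + thetaVib P φ * (eVib P (tempTr P φ) - eVib P (tempVib P φ))

def relEnergyTr (φ : Phase → ℝ) : ℝ :=
  eTr P (tempTr P φ) - thetaRot P φ * (eRot P (tempTr P φ) - eRot P (tempRot P φ))
    - thetaVib P φ * (eVib P (tempTr P φ) - eVib P (tempVib P φ))

def relTempTr (φ : Phase → ℝ) : ℝ := eTrInv P (relEnergyTr P φ)

def relTempRot (φ : Phase → ℝ) : ℝ := eRotInv P (relEnergyRot P φ)

def relTempVib (φ : Phase → ℝ) : ℝ := eVibInv P (relEnergyVib P φ)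

/-- The relaxation tensor `Π`. -/
def relTensor (φ : Phase → ℝ) : Matrix (Fin 3) (Fin 3) ℝ :=
  (P.R * relTempTr P φ) • (1 : Matrix (Fin 3) (Fin 3) ℝ)
    + ((P.Pr - 1) / P.Pr) • (Theta φ - (P.R * tempTr P φ) • (1 : Matrix (Fin 3) (Fin 3) ℝ))

/-! The generalized Gaussian `G[φ]` and the Maxwellian `M[φ]`. -/

/-- Rotational equilibrium density at temperature `T`. -/
def rotDensity (T ε : ℝ) : ℝ :=
  (1 / Real.Gamma (rotDof / 2)) * ε ^ ((rotDof - 2) / 2) / (P.R * T) ^ (rotDof / 2)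
    * Real.exp (-ε / (P.R * T))

/-- Vibrational equilibrium weight at temperature `T`. -/
def vibDensity (T : ℝ) (i : ℕ) : ℝ :=
  (1 - Real.exp (-P.T₀ / T)) * Real.exp (-(i : ℝ) * (P.T₀ / T))

def gaussTr (φ : Phase → ℝ) (v : E3) : ℝ :=
  density φ / Real.sqrt (((2 * Real.pi) • relTensor P φ).det)
    * Real.exp (-(1 / 2) *
        ∑ i, ∑ j, (v - velocity φ) i * (relTensor P φ)⁻¹ i j * (v - velocity φ) j)

def gaussian (φ : Phase → ℝ) (z : Phase) : ℝ :=
  gaussTr P φ z.1 * rotDensity P (relTempRot P φ) z.2.1 * vibDensity P (relTempVib P φ) z.2.2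

def maxwellTr (φ : Phase → ℝ) (v : E3) : ℝ :=
  density φ / (2 * Real.pi * P.R * tempEq P φ) ^ (3 / 2 : ℝ)
    * Real.exp (-‖v - velocity φ‖ ^ 2 / (2 * P.R * tempEq P φ))

def maxwellian (φ : Phase → ℝ) (z : Phase) : ℝ :=
  maxwellTr P φ z.1 * rotDensity P (tempEq P φ) z.2.1 * vibDensity P (tempEq P φ) z.2.2

/-! The scaled kinetic equation. -/

/-- The partial derivative in the `j`-th space variable. -/
def partialX (j : Fin 3) (F : E3 → ℝ) (x : E3) : ℝ :=
  fderiv ℝ F x (EuclideanSpace.single j 1)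

/-- `f` is a classical solution on the open set `U` of space-time of
`∂ₜ f + v · ∇ₓ f = (G[f] - f) / (Kn τ)`. The model has to be well defined on `f`: positive density
and relaxation energies, positive definite relaxation tensor. -/
structure IsSolution (Kn : ℝ) (U : Set (ℝ × E3)) (f : ℝ → E3 → Phase → ℝ) : Prop where
  measurable : ∀ t x, (t, x) ∈ U → MeasureTheory.AEStronglyMeasurable (f t x) phaseMeasure
  nonneg : ∀ t x, (t, x) ∈ U → ∀ z : Phase, 0 ≤ z.2.1 → 0 ≤ f t x z
  smooth : ∀ z : Phase, 0 ≤ z.2.1 → ContDiffOn ℝ 1 (fun p : ℝ × E3 => f p.1 p.2 z) U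
  density_pos : ∀ t x, (t, x) ∈ U → 0 < density (f t x)
  relEnergyRot_pos : ∀ t x, (t, x) ∈ U → 0 < relEnergyRot P (f t x)
  relEnergyVib_pos : ∀ t x, (t, x) ∈ U → 0 < relEnergyVib P (f t x)
  relTensor_posDef : ∀ t x, (t, x) ∈ U → (relTensor P (f t x)).PosDef
  equation : ∀ t x, (t, x) ∈ U → ∀ z : Phase, 0 ≤ z.2.1 →
    deriv (fun s => f s x z) t + ∑ j, z.1 j * partialX j (fun y => f t y z) x
      = 1 / (Kn * tauOf P (f t x)) * (gaussian P (f t x) z - f t x z)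

/-- Regularity of a family `f Kn`, `0 < Kn < Kn₀`, uniform in `Kn`: the space-time derivatives up to
order two are bounded, uniformly in `Kn` and in `(t, x) ∈ U`, by one function of `(v, ε, i)` with
finite moments; density and translational temperature stay away from zero. -/
structure UniformlyRegular (Kn₀ : ℝ) (U : Set (ℝ × E3)) (f : ℝ → ℝ → E3 → Phase → ℝ) : Prop where
  smooth : ∀ Kn ∈ Set.Ioo 0 Kn₀, ∀ z : Phase, 0 ≤ z.2.1 →
    ContDiffOn ℝ 2 (fun p : ℝ × E3 => f Kn p.1 p.2 z) U
  dominated : ∃ g : Phase → ℝ,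
    MeasureTheory.Integrable
      (fun z => (1 + ‖z.1‖ ^ 2) * (1 + ‖z.1‖ ^ 2 + z.2.1 + (z.2.2 : ℝ)) * g z) phaseMeasure ∧
    ∀ Kn ∈ Set.Ioo 0 Kn₀, ∀ t x, (t, x) ∈ U → ∀ z : Phase, 0 ≤ z.2.1 → ∀ k : ℕ, k ≤ 2 →
      ‖iteratedFDeriv ℝ k (fun p : ℝ × E3 => f Kn p.1 p.2 z) (t, x)‖ ≤ g z
  bounded_below : ∃ m : ℝ, 0 < m ∧ ∀ Kn ∈ Set.Ioo 0 Kn₀, ∀ t x, (t, x) ∈ U →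
    m ≤ density (f Kn t x) ∧ m ≤ tempTr P (f Kn t x)

/-! The Chapman–Enskog correction. -/

/-- Volume viscosity `ζ` at density `r` and temperature `T`. -/
def volVisc (r T : ℝ) : ℝ :=
  r * P.R * T * P.R * (P.Zrot T * P.tauC r T * (cRot P / cv P T ^ 2)
    + P.Zvib T * P.tauC r T * (cVib P T / cv P T ^ 2))

def redV (φ : Phase → ℝ) (v : E3) : E3 :=
  (1 / Real.sqrt (P.R * tempEq P φ)) • (v - velocity φ)

def redJ (φ : Phase → ℝ) (ε : ℝ) : ℝ := ε / (P.R * tempEq P φ)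

def redK (φ : Phase → ℝ) (i : ℕ) : ℝ := (i : ℝ) * P.T₀ / tempEq P φ

def ATr (V : E3) : E3 := (‖V‖ ^ 2 / 2 - 5 / 2) • V

def ARot (V : E3) (J : ℝ) : E3 := (J - rotDof / 2) • V

def AVib (T : ℝ) (V : E3) (K : ℝ) : E3 := (K - vibDof P T / 2) • V

def ACoef (T : ℝ) (V : E3) (J K : ℝ) : E3 := ATr V + ARot V J + AVib P T V K

def BTr (r T : ℝ) (V : E3) : Matrix (Fin 3) (Fin 3) ℝ :=
  P.Pr • (Matrix.of (fun i j => V i * V j)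
    - ((‖V‖ ^ 2 / 2 - 3 / 2) * (2 / 3 - volVisc P r T / P.visc T) + 1) •
        (1 : Matrix (Fin 3) (Fin 3) ℝ))

def BRot (r T J : ℝ) : Matrix (Fin 3) (Fin 3) ℝ :=
  (-(P.tauC r T / tau P r T * P.Zrot T * (gam P T - 1) - volVisc P r T / P.visc T * P.Pr)
    * (J - rotDof / 2)) • (1 : Matrix (Fin 3) (Fin 3) ℝ)

def BVib (r T K : ℝ) : Matrix (Fin 3) (Fin 3) ℝ :=
  (-(P.tauC r T / tau P r T * P.Zvib T * (gam P T - 1) - volVisc P r T / P.visc T * P.Pr)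
    * (K - vibDof P T / 2)) • (1 : Matrix (Fin 3) (Fin 3) ℝ)

def BCoef (r T : ℝ) (V : E3) (J K : ℝ) : Matrix (Fin 3) (Fin 3) ℝ :=
  BTr P r T V + BRot P r T J + BVib P r T K

/-- `A(V,J,K) · ∇(R T_eq) / √(R T_eq) + B(V,J,K) : ∇u` at `(t, x)`, where `F = f(t, ·)`. -/
def correction (F : E3 → Phase → ℝ) (x : E3) (z : Phase) : ℝ :=
  let φ := F x
  let T := tempEq P φ
  let V := redV P φ z.1
  let J := redJ P φ z.2.1
  let K := redK P φ z.2.2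
  (∑ j, ACoef P T V J K j *
      (partialX j (fun y => P.R * tempEq P (F y)) x / Real.sqrt (P.R * T)))
    + ∑ i, ∑ j, BCoef P (density φ) T V J K i j * partialX j (fun y => velocity (F y) i) x

/-- The first-order distribution `M[f] - τ Kn M[f] (A · ∇(R T_eq) / √(R T_eq) + B : ∇u)`, with `τ`
taken at `T_eq`. -/
def firstOrder (Kn : ℝ) (F : E3 → Phase → ℝ) (x : E3) (z : Phase) : ℝ :=
  maxwellian P (F x) z
    - tau P (density (F x)) (tempEq P (F x)) * Kn * maxwellian P (F x) z * correction P F x z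

end

end ESBGK

/-! Write κ for Kn and D for the transport derivative ∂ₜ + v·∇ₓ. The kinetic equation reads G[f] = f
+ κ τ Df (`SolFamily.gaussian_eq`). As f and its derivatives up to order two are dominated by one
function g with enough moments, the moments of Df that occur are bounded, with their first
derivatives, uniformly in κ. The equation is used twice: integrated against test functions it
controls the parameters of G[f]; pointwise it yields f.

Parameters. G[f] has the mass, momentum and energy of f, so the corresponding moments of Df vanish
exactly. Its second moments and internal energies differ from those of f by κ τ times moments of Df.
By the definition of the relaxation these differences are proportional to the distances to
equilibrium, so T_tr - T_eq, Θ - R T_eq I, Π - R T_eq I and their analogues for the internal modes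
are O(κ) together with their derivatives (`SmallC1`). The control of derivatives is essential: a
moment of Df is a space-time divergence of moments of f, those of highest order being moments of
G[f] up to O(κ) (`mom_three`). Replacing them by equilibrium values gives Euler's equations up to
O(κ) (`momentum_approx`, `conv_eq_approx`) and the leading values of the other moments of Df. These
values come back multiplied by κ, which expands Π and the relaxation energies up to O(κ²)
(`pi_expansion`, `relRot_expansion`, `relVib_expansion`).

Distribution. Consequently log(G/M) = κ X + O(κ²) with quadratic growth in the microscopic variables
(`logRatio_expansion`), and Euler's equations give D log M = F + O(κ) with an explicit F
(`flow_logMax_expansion`). Applying D to f = G - κ τ Df shows Df = G (D log M + D log(G/M)) - κ D(τ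
Df), hence Df = M F + O(κ) and f = M (1 + κ X - κ τ F) + O(κ²). The algebraic identity X = τ (F -
(A·∇(RT_eq)/√(RT_eq) + B:∇u)) (`leadRatio_eq`) produces the stated correction.

Remainder. Uniformly, log M ≤ C - c (1 + |v|² + ε + i), whereas |log(G/M)| is at most O(κ) times the
same weight. For small κ the errors containing G or M are therefore below a decaying exponential
(`exp_le_envelope`), and those containing derivatives of f are below a multiple of (1 + |v|²) g
(`remainder_le`). -/

namespace ESBGK

open MeasureTheory Filter Asymptotics Set

/-! ### Uniform first-order smallness -/

/-- Space-time. -/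
abbrev ST : Type := ℝ × E3

/-- The family `a κ` is differentiable on `U`, and `a κ` and its derivative are `O(κ ^ k)` uniformly
on `U` along the filter `l`. -/
structure SmallC1 (l : Filter ℝ) (U : Set ST) (k : ℕ) (a : ℝ → ST → ℝ) : Prop where
  diff : ∀ᶠ q in l ×ˢ 𝓟 U, DifferentiableAt ℝ (a q.1) q.2
  val : (fun q : ℝ × ST => a q.1 q.2) =O[l ×ˢ 𝓟 U] fun q => q.1 ^ k
  der : (fun q : ℝ × ST => fderiv ℝ (a q.1) q.2) =O[l ×ˢ 𝓟 U] fun q => q.1 ^ k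

/-- The family `a κ` is bounded below on `U` by a positive constant along `l`. -/
def UnifPos (l : Filter ℝ) (U : Set ST) (a : ℝ → ST → ℝ) : Prop :=
  ∃ m, 0 < m ∧ ∀ᶠ q in l ×ˢ 𝓟 U, m ≤ a q.1 q.2

variable {l : Filter ℝ} {U : Set ST} {j k : ℕ} {a b c : ℝ → ST → ℝ}

theorem SmallC1.const (r : ℝ) : SmallC1 l U 0 (fun _ _ => r) where
  diff := Eventually.of_forall fun q => differentiableAt_const _
  val := by simpa using isBigO_const_const r (one_ne_zero (α := ℝ)) (l ×ˢ 𝓟 U)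
  der := by
    simp only [fderiv_fun_const, Pi.zero_apply]
    exact isBigO_zero _ _

theorem SmallC1.param : SmallC1 l U 1 (fun κ _ => κ) where
  diff := Eventually.of_forall fun q => differentiableAt_const _
  val := by simpa using isBigO_refl _ _
  der := by simpa using isBigO_zero _ _

theorem SmallC1.add (ha : SmallC1 l U k a) (hb : SmallC1 l U k b) :
    SmallC1 l U k (fun κ p => a κ p + b κ p) where
  diff := by filter_upwards [ha.diff, hb.diff] with q h1 h2 using h1.add h2
  val := ha.val.add hb.val
  der := by
    refine (ha.der.add hb.der).congr' ?_ EventuallyEq.rfl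
    filter_upwards [ha.diff, hb.diff] with q h1 h2
    exact (fderiv_fun_add h1 h2).symm

theorem SmallC1.mul (ha : SmallC1 l U j a) (hb : SmallC1 l U k b) :
    SmallC1 l U (j + k) (fun κ p => a κ p * b κ p) where
  diff := by filter_upwards [ha.diff, hb.diff] with q h1 h2 using h1.mul h2
  val := by simpa [pow_add] using ha.val.mul hb.val
  der := by
    have h : (fun q : ℝ × ST => a q.1 q.2 • fderiv ℝ (b q.1) q.2 + b q.1 q.2 • fderiv ℝ (a q.1) q.2)
        =O[l ×ˢ 𝓟 U] fun q => q.1 ^ (j + k) := by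
      refine IsBigO.add ?_ ?_
      · simpa [pow_add] using ha.val.smul hb.der
      · simpa [pow_add, mul_comm] using hb.val.smul ha.der
    refine h.congr' ?_ EventuallyEq.rfl
    filter_upwards [ha.diff, hb.diff] with q h1 h2
    exact (fderiv_fun_mul h1 h2).symm

theorem SmallC1.const_mul (r : ℝ) (ha : SmallC1 l U k a) :
    SmallC1 l U k (fun κ p => r * a κ p) := by
  simpa using (SmallC1.const r).mul ha

theorem SmallC1.neg (ha : SmallC1 l U k a) : SmallC1 l U k (fun κ p => - a κ p) := by
  simpa using ha.const_mul (-1)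

theorem SmallC1.sub (ha : SmallC1 l U k a) (hb : SmallC1 l U k b) :
    SmallC1 l U k (fun κ p => a κ p - b κ p) := by
  simpa [sub_eq_add_neg] using ha.add hb.neg

theorem SmallC1.sum {ι : Type*} (s : Finset ι) {A : ι → ℝ → ST → ℝ}
    (h : ∀ i ∈ s, SmallC1 l U k (A i)) : SmallC1 l U k (fun κ p => ∑ i ∈ s, A i κ p) := by
  classical
  induction s using Finset.induction_on with
  | empty =>
    refine ⟨Eventually.of_forall fun q => by simp, ?_, ?_⟩
    · simpa using isBigO_zero _ _
    · simpa using isBigO_zero _ _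
  | insert i s hi ih =>
    simp only [Finset.sum_insert hi]
    exact (h i (by simp)).add (ih fun i' hi' => h i' (by simp [hi']))

/-- Openness of `U` turns equality on `U` into equality of germs, which is what carries the
derivative bound over. -/
theorem SmallC1.congr (hU : IsOpen U) (ha : SmallC1 l U k a)
    (h : ∀ᶠ κ in l, ∀ p ∈ U, a κ p = b κ p) : SmallC1 l U k b := by
  have h' : ∀ᶠ q : ℝ × ST in l ×ˢ 𝓟 U, a q.1 =ᶠ[𝓝 q.2] b q.1 := by
    rw [eventually_prod_principal_iff]
    filter_upwards [h] with κ hκ p hp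
    filter_upwards [hU.mem_nhds hp] with p' hp' using hκ p' hp'
  refine ⟨?_, ha.val.congr' ?_ EventuallyEq.rfl, ha.der.congr' ?_ EventuallyEq.rfl⟩
  · filter_upwards [h', ha.diff] with q h1 h2 using h1.differentiableAt_iff.mp h2
  · filter_upwards [h'] with q h1 using h1.eq_of_nhds
  · filter_upwards [h'] with q h1 using h1.fderiv_eq

/-- Since κ is positive and at most `r` along the filter, the surplus factor κ ^ (k - j) is bounded
by r ^ (k - j). -/
theorem SmallC1.mono {r : ℝ} (hl : ∀ᶠ κ in l, 0 < κ ∧ κ ≤ r) (hjk : j ≤ k)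
    (ha : SmallC1 l U k a) : SmallC1 l U j a := by
  have hκ : (fun q : ℝ × ST => q.1 ^ k) =O[l ×ˢ 𝓟 U] fun q => q.1 ^ j := by
    refine IsBigO.of_bound (r ^ (k - j)) ?_
    filter_upwards [hl.prod_inl (𝓟 U)] with q hq
    rw [Real.norm_of_nonneg (by have := hq.1; positivity),
      Real.norm_of_nonneg (by have := hq.1; positivity)]
    calc q.1 ^ k = q.1 ^ (k - j) * q.1 ^ j := by rw [← pow_add]; congr 1; omega
      _ ≤ _ := mul_le_mul_of_nonneg_right (pow_le_pow_left₀ hq.1.le hq.2 _)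
        (by have := hq.1; positivity)
  exact ⟨ha.diff, ha.val.trans hκ, ha.der.trans hκ⟩

/-- Bounds for a `C¹` function and its derivative on a compact box of the open quadrant. -/
theorem exists_bound_box {Φ : ℝ × ℝ → ℝ} (hΦ : ContDiffOn ℝ 1 Φ (Ioi 0 ×ˢ Ioi 0)) {m : ℝ}
    (hm : 0 < m) (M : ℝ) : ∃ C, ∀ q ∈ Icc m M ×ˢ Icc m M,
      DifferentiableAt ℝ Φ q ∧ |Φ q| ≤ C ∧ ‖fderiv ℝ Φ q‖ ≤ C := by
  have hO : IsOpen (Ioi (0 : ℝ) ×ˢ Ioi (0 : ℝ)) := isOpen_Ioi.prod isOpen_Ioi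
  have hsub : Icc m M ×ˢ Icc m M ⊆ Ioi (0 : ℝ) ×ˢ Ioi (0 : ℝ) := fun q hq =>
    ⟨lt_of_lt_of_le hm hq.1.1, lt_of_lt_of_le hm hq.2.1⟩
  have hK : IsCompact (Icc m M ×ˢ Icc m M) := isCompact_Icc.prod isCompact_Icc
  obtain ⟨C1, h1⟩ := hK.exists_bound_of_continuousOn (hΦ.continuousOn.mono hsub)
  obtain ⟨C2, h2⟩ := hK.exists_bound_of_continuousOn
    ((hΦ.continuousOn_fderiv_of_isOpen hO le_rfl).mono hsub)
  refine ⟨max C1 C2, fun q hq => ⟨?_, (h1 q hq).trans (le_max_left _ _),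
    (h2 q hq).trans (le_max_right _ _)⟩⟩
  exact (hΦ.differentiableOn one_ne_zero).differentiableAt (hO.mem_nhds (hsub hq))

theorem exists_upper_bound (ha : SmallC1 l U 0 a) :
    ∃ M, ∀ᶠ q in l ×ˢ 𝓟 U, |a q.1 q.2| ≤ M := by
  obtain ⟨M, hM⟩ := ha.val.bound
  exact ⟨M, by simpa using hM⟩

theorem exists_common_box (ha : SmallC1 l U 0 a) (hb : SmallC1 l U 0 b) (ha0 : UnifPos l U a)
    (hb0 : UnifPos l U b) : ∃ m M, 0 < m ∧ ∀ᶠ q in l ×ˢ 𝓟 U,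
      (a q.1 q.2, b q.1 q.2) ∈ Icc m M ×ˢ Icc m M := by
  obtain ⟨m, hm, h1⟩ := ha0
  obtain ⟨m', hm', h2⟩ := hb0
  obtain ⟨M, h3⟩ := exists_upper_bound ha
  obtain ⟨M', h4⟩ := exists_upper_bound hb
  refine ⟨min m m', max M M', lt_min hm hm', ?_⟩
  filter_upwards [h1, h2, h3, h4] with q h1 h2 h3 h4
  exact ⟨⟨(min_le_left _ _).trans h1, (le_abs_self _).trans (h3.trans (le_max_left _ _))⟩,
    (min_le_right _ _).trans h2, (le_abs_self _).trans (h4.trans (le_max_right _ _))⟩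

/-- Upper bounds and positive lower bounds confine the arguments to one compact box of the open
quadrant, where Φ and its derivative are bounded; the chain rule does the rest. -/
theorem SmallC1.comp_pair {Φ : ℝ × ℝ → ℝ} (hΦ : ContDiffOn ℝ 1 Φ (Ioi 0 ×ˢ Ioi 0))
    (ha : SmallC1 l U 0 a) (hb : SmallC1 l U 0 b) (ha0 : UnifPos l U a) (hb0 : UnifPos l U b) :
    SmallC1 l U 0 (fun κ p => Φ (a κ p, b κ p)) := by
  obtain ⟨m, M, hm, hbox⟩ := exists_common_box ha hb ha0 hb0
  obtain ⟨C, hC⟩ := exists_bound_box hΦ hm M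
  have key : ∀ᶠ q : ℝ × ST in l ×ˢ 𝓟 U, HasFDerivAt (fun p => Φ (a q.1 p, b q.1 p))
      ((fderiv ℝ Φ (a q.1 q.2, b q.1 q.2)).comp
        ((fderiv ℝ (a q.1) q.2).prod (fderiv ℝ (b q.1) q.2))) q.2 := by
    filter_upwards [hbox, ha.diff, hb.diff] with q h1 h2 h3
    exact (hC _ h1).1.hasFDerivAt.comp q.2 (h2.hasFDerivAt.prodMk h3.hasFDerivAt)
  refine ⟨key.mono fun q h => h.differentiableAt, ?_, ?_⟩
  · refine IsBigO.of_bound C ?_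
    filter_upwards [hbox] with q h1
    simpa using (hC _ h1).2.1
  · obtain ⟨A, hA⟩ := ha.der.bound
    obtain ⟨B, hB⟩ := hb.der.bound
    refine IsBigO.of_bound (C * max A B) ?_
    filter_upwards [hbox, key, hA, hB] with q h1 h2 h3 h4
    rw [h2.fderiv]
    simp only [pow_zero, norm_one, mul_one] at h3 h4 ⊢
    refine (ContinuousLinearMap.opNorm_comp_le _ _).trans ?_
    refine mul_le_mul (hC _ h1).2.2 ?_ (norm_nonneg _) ((norm_nonneg _).trans (hC _ h1).2.2)
    rw [ContinuousLinearMap.opNorm_prod]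
    exact max_le_max h3 h4

/-- Mean value inequality on a convex box that contains both pairs of arguments. -/
theorem IsBigO.comp_pair_sub {Φ : ℝ × ℝ → ℝ} (hΦ : ContDiffOn ℝ 1 Φ (Ioi 0 ×ˢ Ioi 0))
    (ha : SmallC1 l U 0 a) (hb : SmallC1 l U 0 b) (hc : SmallC1 l U 0 c) (ha0 : UnifPos l U a)
    (hb0 : UnifPos l U b) (hc0 : UnifPos l U c) :
    (fun q : ℝ × ST => Φ (a q.1 q.2, b q.1 q.2) - Φ (a q.1 q.2, c q.1 q.2))
      =O[l ×ˢ 𝓟 U] fun q => b q.1 q.2 - c q.1 q.2 := by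
  obtain ⟨m, M, hm, hbox⟩ := exists_common_box ha hb ha0 hb0
  obtain ⟨m', M', hm', hbox'⟩ := exists_common_box ha hc ha0 hc0
  obtain ⟨C, hC⟩ := exists_bound_box hΦ (lt_min hm hm') (max M M')
  refine IsBigO.of_bound C ?_
  filter_upwards [hbox, hbox'] with q h1 h2
  have e1 : Icc m M ⊆ Icc (min m m') (max M M') :=
    Icc_subset_Icc (min_le_left _ _) (le_max_left _ _)
  have e2 : Icc m' M' ⊆ Icc (min m m') (max M M') :=
    Icc_subset_Icc (min_le_right _ _) (le_max_right _ _)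
  have hconv : Convex ℝ (Icc (min m m') (max M M') ×ˢ Icc (min m m') (max M M')) :=
    (convex_Icc _ _).prod (convex_Icc _ _)
  have := hconv.norm_image_sub_le_of_norm_fderiv_le (𝕜 := ℝ) (fun x hx => (hC x hx).1)
    (fun x hx => (hC x hx).2.2) (x := (a q.1 q.2, c q.1 q.2)) (y := (a q.1 q.2, b q.1 q.2))
    ⟨e2 h2.1, e2 h2.2⟩ ⟨e1 h1.1, e1 h1.2⟩
  simpa [Prod.norm_def] using this

/-- Functions of one variable are treated as functions of two that ignore a coordinate; the dummy
slot is filled with `a` again. -/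
theorem SmallC1.comp {Φ : ℝ → ℝ} (hΦ : ContDiffOn ℝ 1 Φ (Ioi 0))
    (ha : SmallC1 l U 0 a) (ha0 : UnifPos l U a) :
    SmallC1 l U 0 (fun κ p => Φ (a κ p)) :=
  SmallC1.comp_pair (Φ := fun q => Φ q.1)
    (hΦ.comp contDiff_fst.contDiffOn fun _ hq => hq.1) ha ha ha0 ha0

theorem IsBigO.comp_sub {Φ : ℝ → ℝ} (hΦ : ContDiffOn ℝ 1 Φ (Ioi 0))
    (ha : SmallC1 l U 0 a) (hb : SmallC1 l U 0 b) (ha0 : UnifPos l U a) (hb0 : UnifPos l U b) :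
    (fun q : ℝ × ST => Φ (a q.1 q.2) - Φ (b q.1 q.2))
      =O[l ×ˢ 𝓟 U] fun q => a q.1 q.2 - b q.1 q.2 :=
  IsBigO.comp_pair_sub (Φ := fun q => Φ q.2)
    (hΦ.comp contDiff_snd.contDiffOn fun _ hq => hq.2) ha ha hb ha0 ha0 hb0

theorem SmallC1.inv (ha : SmallC1 l U 0 a) (ha0 : UnifPos l U a) :
    SmallC1 l U 0 (fun κ p => (a κ p)⁻¹) :=
  ha.comp (Φ := fun x => x⁻¹) (contDiffOn_inv ℝ |>.mono fun _ hx => ne_of_gt hx) ha0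

theorem SmallC1.div (ha : SmallC1 l U k a) (hb : SmallC1 l U 0 b) (hb0 : UnifPos l U b) :
    SmallC1 l U k (fun κ p => a κ p / b κ p) := by
  simpa [div_eq_mul_inv] using ha.mul (hb.inv hb0)

theorem contDiffOn_deriv_Ioi {Φ : ℝ → ℝ} (hΦ : ContDiffOn ℝ 2 Φ (Ioi 0)) :
    ContDiffOn ℝ 1 (deriv Φ) (Ioi 0) := by
  rw [← one_add_one_eq_two] at hΦ
  exact ((contDiffOn_succ_iff_deriv_of_isOpen isOpen_Ioi).1 hΦ).2.2

/-- The derivative of Φ(a) - Φ(b) is Φ'(a) D(a - b) + (Φ'(a) - Φ'(b)) Db. The second term is small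
because Φ' is locally Lipschitz, and this is where Φ has to be C². -/
theorem SmallC1.comp_sub {Φ : ℝ → ℝ} (hΦ : ContDiffOn ℝ 2 Φ (Ioi 0))
    (ha : SmallC1 l U 0 a) (hb : SmallC1 l U 0 b) (ha0 : UnifPos l U a) (hb0 : UnifPos l U b)
    (hab : SmallC1 l U k (fun κ p => a κ p - b κ p)) :
    SmallC1 l U k (fun κ p => Φ (a κ p) - Φ (b κ p)) := by
  have h1 : ContDiffOn ℝ 1 Φ (Ioi 0) := hΦ.of_le (by norm_num)
  have hd : ContDiffOn ℝ 1 (deriv Φ) (Ioi 0) :=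
    contDiffOn_deriv_Ioi hΦ
  have hA := ha.comp h1 ha0
  have hB := hb.comp h1 hb0
  refine ⟨?_, (IsBigO.comp_sub h1 ha hb ha0 hb0).trans hab.val, ?_⟩
  · filter_upwards [hA.diff, hB.diff] with q h1 h2 using h1.sub h2
  have e : ∀ᶠ q : ℝ × ST in l ×ˢ 𝓟 U,
      deriv Φ (a q.1 q.2) • (fderiv ℝ (fun p => a q.1 p - b q.1 p) q.2)
        + (deriv Φ (a q.1 q.2) - deriv Φ (b q.1 q.2)) • fderiv ℝ (b q.1) q.2
      = fderiv ℝ (fun p => Φ (a q.1 p) - Φ (b q.1 p)) q.2 := by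
    obtain ⟨m, hm, hma⟩ := ha0
    obtain ⟨m', hm', hmb⟩ := hb0
    filter_upwards [ha.diff, hb.diff, hma, hmb] with q h2 h3 h4 h5
    have d1 : HasDerivAt Φ (deriv Φ (a q.1 q.2)) (a q.1 q.2) :=
      ((h1.differentiableOn one_ne_zero).differentiableAt
        (Ioi_mem_nhds (hm.trans_le h4))).hasDerivAt
    have d2 : HasDerivAt Φ (deriv Φ (b q.1 q.2)) (b q.1 q.2) :=
      ((h1.differentiableOn one_ne_zero).differentiableAt
        (Ioi_mem_nhds (hm'.trans_le h5))).hasDerivAt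
    have := ((d1.comp_hasFDerivAt q.2 h2.hasFDerivAt).sub
      (d2.comp_hasFDerivAt q.2 h3.hasFDerivAt)).fderiv
    simp only [Function.comp_def] at this
    rw [fderiv_fun_sub h2 h3]
    refine Eq.trans ?_ this.symm
    module
  refine IsBigO.congr' (IsBigO.add ?_ ?_) e EventuallyEq.rfl
  · simpa using (ha.comp hd ha0).val.smul hab.der
  · simpa using ((IsBigO.comp_sub hd ha hb ha0 hb0).trans hab.val).smul hb.der

/-- Taylor's formula of first order: on the segment between x and y the function Φ(s) - Φ'(y) s has
derivative at most C |x - y|, by the Lipschitz bound for Φ', so the mean value inequality gives a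
quadratic error. -/
theorem IsBigO.comp_sub_taylor {Φ : ℝ → ℝ} (hΦ : ContDiffOn ℝ 2 Φ (Ioi 0))
    (ha : SmallC1 l U 0 a) (hb : SmallC1 l U 0 b) (ha0 : UnifPos l U a) (hb0 : UnifPos l U b) :
    (fun q : ℝ × ST => Φ (a q.1 q.2) - Φ (b q.1 q.2)
        - deriv Φ (b q.1 q.2) * (a q.1 q.2 - b q.1 q.2))
      =O[l ×ˢ 𝓟 U] fun q => (a q.1 q.2 - b q.1 q.2) ^ 2 := by
  have h1 : ContDiffOn ℝ 1 Φ (Ioi 0) := hΦ.of_le (by norm_num)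
  have hd : ContDiffOn ℝ 1 (deriv Φ) (Ioi 0) :=
    contDiffOn_deriv_Ioi hΦ
  obtain ⟨m, M, hm, hbox⟩ := exists_common_box ha hb ha0 hb0
  obtain ⟨C, hC⟩ := exists_bound_box (Φ := fun q => deriv Φ q.1)
    (hd.comp contDiff_fst.contDiffOn fun _ hq => hq.1) hm M
  have hlip : ∀ x ∈ Icc m M, ∀ y ∈ Icc m M, |deriv Φ x - deriv Φ y| ≤ C * |x - y| := by
    intro x hx y hy
    have := ((convex_Icc m M).prod (convex_Icc m M)).norm_image_sub_le_of_norm_fderiv_le (𝕜 := ℝ)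
      (fun x hx => (hC x hx).1) (fun x hx => (hC x hx).2.2) (x := (y, y)) (y := (x, y))
      ⟨hy, hy⟩ ⟨hx, hy⟩
    simpa [Prod.norm_def] using this
  refine IsBigO.of_bound C ?_
  filter_upwards [hbox] with q h
  generalize a q.1 q.2 = x at *
  generalize b q.1 q.2 = y at *
  have hx := h.1
  have hy := h.2
  simp only at hx hy
  have hseg : uIcc x y ⊆ Icc m M := by
    rw [uIcc]; exact Icc_subset_Icc (le_inf hx.1 hy.1) (sup_le hx.2 hy.2)
  have hdiff : ∀ s ∈ uIcc x y, HasDerivWithinAt (fun s => Φ s - deriv Φ y * s)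
      (deriv Φ s - deriv Φ y) (uIcc x y) s := fun s hs => by
    simpa using (((h1.differentiableOn one_ne_zero).differentiableAt
        (Ioi_mem_nhds (hm.trans_le (hseg hs).1))).hasDerivAt.fun_sub
        ((hasDerivAt_id' s).const_mul (deriv Φ y))).hasDerivWithinAt (s := uIcc x y)
  have := (convex_uIcc x y).norm_image_sub_le_of_norm_hasDerivWithin_le (C := C * |x - y|)
    hdiff (fun s hs => (hlip s (hseg hs) y hy).trans ?_)
    (right_mem_uIcc (a := x) (b := y)) (left_mem_uIcc (a := x) (b := y))
  · have e : Φ x - deriv Φ y * x - (Φ y - deriv Φ y * y) = Φ x - Φ y - deriv Φ y * (x - y) := by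
      ring
    rw [e, ← Real.norm_eq_abs (x - y), mul_assoc, ← sq, ← norm_pow] at this
    exact this
  · refine mul_le_mul_of_nonneg_left ?_ ?_
    · rw [abs_sub_comm s, abs_sub_comm x]
      exact abs_sub_right_of_mem_uIcc hs
    · have := (hC _ h).2.2; exact (norm_nonneg _).trans this

variable (P : GasParams)

/-! ### Energies and their inverses -/

theorem eTr_eTrInv (E : ℝ) : eTr P (eTrInv P E) = E := by
  have := P.R_pos.ne'
  simp only [eTr, eTrInv]; field_simp

theorem eRot_eq (T : ℝ) : eRot P T = P.R * T := by simp [eRot, rotDof]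

theorem eRot_eRotInv (E : ℝ) : eRot P (eRotInv P E) = E := by
  have := P.R_pos.ne'
  simp only [eRot, eRotInv, rotDof]; field_simp

theorem cRot_eq : cRot P = P.R := by simp [cRot, rotDof]

theorem exp_sub_one_pos {T : ℝ} (hT : 0 < T) : 0 < Real.exp (P.T₀ / T) - 1 := by
  have := Real.add_one_lt_exp (div_pos P.T₀_pos hT).ne'
  have := div_pos P.T₀_pos hT
  linarith

theorem eVib_pos {T : ℝ} (hT : 0 < T) : 0 < eVib P T :=
  div_pos (mul_pos P.R_pos P.T₀_pos) (exp_sub_one_pos P hT)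

theorem exp_div_eVibInv {E : ℝ} (hE : 0 < E) :
    Real.exp (P.T₀ / eVibInv P E) = 1 + P.R * P.T₀ / E := by
  have h : 0 < P.R * P.T₀ / E := div_pos (mul_pos P.R_pos P.T₀_pos) hE
  rw [eVibInv, div_div_cancel₀ P.T₀_pos.ne', Real.exp_log (by linarith)]

theorem eVibInv_pos {E : ℝ} (hE : 0 < E) : 0 < eVibInv P E := by
  have h : 0 < P.R * P.T₀ / E := div_pos (mul_pos P.R_pos P.T₀_pos) hE
  exact div_pos P.T₀_pos (Real.log_pos (by linarith))

theorem eVib_eVibInv {E : ℝ} (hE : 0 ≤ E) : eVib P (eVibInv P E) = E := by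
  -- At zero energy the identity survives through the convention x / 0 = 0: the inverse returns
  -- temperature 0, and the energy there is a division by exp 0 - 1 = 0. A distribution without
  -- vibrational excitation is thus covered.
  rcases hE.eq_or_lt with rfl | hE
  · simp [eVib, eVibInv]
  · have := (mul_pos P.R_pos P.T₀_pos).ne'
    rw [eVib, exp_div_eVibInv P hE, add_sub_cancel_left, div_div_cancel₀ this]

/-- The inequality exp x ≥ 1 + x at x = T₀ / T: vibrational energy never exceeds its classical
value. -/
theorem eVib_le {T : ℝ} (hT : 0 < T) : eVib P T ≤ P.R * T := by
  have h := Real.add_one_le_exp (P.T₀ / T)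
  rw [eVib, div_le_iff₀ (exp_sub_one_pos P hT)]
  have hR := P.R_pos
  calc P.R * P.T₀ = P.R * T * (P.T₀ / T) := by field_simp
    _ ≤ _ := by gcongr; linarith

theorem contDiffOn_eVib : ContDiffOn ℝ 2 (eVib P) (Ioi 0) := by
  refine contDiffOn_const.div (ContDiffOn.sub (Real.contDiff_exp.comp_contDiffOn
    (contDiffOn_const.div contDiffOn_id fun x hx => ne_of_gt hx)) contDiffOn_const)
    fun x hx => (exp_sub_one_pos P hx).ne'

theorem hasDerivAt_eVib {T : ℝ} (hT : 0 < T) : HasDerivAt (eVib P) (cVib P T) T := by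
  have h0 := exp_sub_one_pos P hT
  have h1 : HasDerivAt (fun T => P.T₀ / T) (-(P.T₀ / T ^ 2)) T := by
    simpa [div_eq_mul_inv] using (hasDerivAt_inv hT.ne').const_mul P.T₀
  have := (h1.exp.sub_const 1).inv h0.ne' |>.const_mul (P.R * P.T₀)
  refine (this.congr_deriv ?_)
  simp only [cVib]
  field_simp

theorem cVib_pos {T : ℝ} (hT : 0 < T) : 0 < cVib P T := by
  have := P.R_pos; have := P.T₀_pos; have := exp_sub_one_pos P hT
  unfold cVib; positivity

/-- The exponential is eliminated in favour of the energy itself, so that later identities between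
vibrational quantities become rational. -/
theorem cVib_eq {T : ℝ} (hT : 0 < T) :
    cVib P T = eVib P T * (eVib P T + P.R * P.T₀) / (P.R * T ^ 2) := by
  have := P.R_pos.ne'; have := (exp_sub_one_pos P hT).ne'
  unfold cVib eVib
  field_simp
  ring

theorem vibDof_eq {T : ℝ} (hT : 0 < T) : vibDof P T / 2 = eVib P T / (P.R * T) := by
  have := P.R_pos.ne'; have := (exp_sub_one_pos P hT).ne'
  unfold vibDof eVib
  field_simp

theorem le_cv {T : ℝ} (hT : 0 < T) : 5 / 2 * P.R ≤ cv P T := by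
  have := cVib_pos P hT
  rw [cv, cTr, cRot_eq]; linarith

theorem cv_pos {T : ℝ} (hT : 0 < T) : 0 < cv P T :=
  lt_of_lt_of_le (by have := P.R_pos; positivity) (le_cv P hT)

theorem eTot_eq (T : ℝ) : eTot P T = 5 / 2 * P.R * T + eVib P T := by
  rw [eTot, eTr, eRot_eq]; ring

theorem hasDerivAt_eTot {T : ℝ} (hT : 0 < T) : HasDerivAt (eTot P) (cv P T) T := by
  have := ((hasDerivAt_id' T).const_mul (5 / 2 * P.R)).add (hasDerivAt_eVib P hT)
  rw [funext (eTot_eq P)]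
  refine this.congr_deriv ?_
  rw [cv, cTr, cRot_eq]; ring

theorem contDiffOn_eTot : ContDiffOn ℝ 2 (eTot P) (Ioi 0) := by
  rw [funext (eTot_eq P)]
  exact (contDiffOn_const.mul contDiffOn_id).add (contDiffOn_eVib P)

theorem contDiffOn_cv : ContDiffOn ℝ 1 (cv P) (Ioi 0) :=
  (contDiffOn_deriv_Ioi (contDiffOn_eTot P)).congr fun _ hT => (hasDerivAt_eTot P hT).deriv.symm

theorem contDiffOn_cVib : ContDiffOn ℝ 1 (cVib P) (Ioi 0) :=
  (contDiffOn_deriv_Ioi (contDiffOn_eVib P)).congr fun _ hT => (hasDerivAt_eVib P hT).deriv.symm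

theorem strictMonoOn_eTot : StrictMonoOn (eTot P) (Ioi 0) := by
  refine strictMonoOn_of_deriv_pos (convex_Ioi 0) (contDiffOn_eTot P).continuousOn fun x hx => ?_
  rw [interior_Ioi] at hx
  rw [(hasDerivAt_eTot P hx).deriv]
  exact cv_pos P hx

/-- As the vibrational energy lies between 0 and R T, the total energy lies between 5/2 R T and 7/2
R T. This supplies the two endpoints for the intermediate value theorem. -/
theorem exists_eTot_eq {E : ℝ} (hE : 0 < E) : ∃ T ∈ Ioi (0 : ℝ), eTot P T = E := by
  have hR := P.R_pos
  have h1 : 0 < 2 * E / (7 * P.R) := by positivity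
  have h2 : 0 < 2 * E / (5 * P.R) := by positivity
  have hle : 2 * E / (7 * P.R) ≤ 2 * E / (5 * P.R) := by gcongr; norm_num
  have hc : ContinuousOn (eTot P) (Icc (2 * E / (7 * P.R)) (2 * E / (5 * P.R))) :=
    (contDiffOn_eTot P).continuousOn.mono fun x hx => h1.trans_le hx.1
  have l1 : eTot P (2 * E / (7 * P.R)) ≤ E := by
    have := eVib_le P h1
    rw [eTot_eq]
    calc _ ≤ 5 / 2 * P.R * (2 * E / (7 * P.R)) + P.R * (2 * E / (7 * P.R)) := by gcongr
      _ = E := by field_simp; norm_num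
  have l2 : E ≤ eTot P (2 * E / (5 * P.R)) := by
    have := eVib_pos P h2
    rw [eTot_eq]
    calc E = 5 / 2 * P.R * (2 * E / (5 * P.R)) := by field_simp
      _ ≤ _ := by linarith
  obtain ⟨T, hT, h⟩ := intermediate_value_Icc hle hc ⟨l1, l2⟩
  exact ⟨T, h1.trans_le hT.1, h⟩

theorem eTotInv_pos {E : ℝ} (hE : 0 < E) : 0 < eTotInv P E :=
  Function.invFunOn_mem (exists_eTot_eq P hE)

theorem eTot_eTotInv {E : ℝ} (hE : 0 < E) : eTot P (eTotInv P E) = E :=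
  Function.invFunOn_eq (exists_eTot_eq P hE)

theorem eTot_pos {T : ℝ} (hT : 0 < T) : 0 < eTot P T := by
  rw [eTot_eq]
  have := eVib_pos P hT; have := P.R_pos
  positivity

theorem eTotInv_eTot {T : ℝ} (hT : 0 < T) : eTotInv P (eTot P T) = T :=
  (strictMonoOn_eTot P).injOn (eTotInv_pos P (eTot_pos P hT)) hT
    (eTot_eTotInv P (eTot_pos P hT))

/-- The bound 7/2 R T on the total energy, read backwards; it makes T_eq uniformly positive once the
energy is. -/
theorem le_eTotInv {E : ℝ} (hE : 0 < E) : 2 * E / (7 * P.R) ≤ eTotInv P E := by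
  have hR := P.R_pos
  have h := eVib_le P (eTotInv_pos P hE)
  have h2 := eTot_eTotInv P hE
  rw [eTot_eq] at h2
  rw [div_le_iff₀ (by positivity)]
  nlinarith

/-- The slope of the total energy is at least 5/2 R, so its inverse is Lipschitz with constant 2 /
(5 R). Continuity is needed before the inverse can be differentiated. -/
theorem continuousOn_eTotInv : ContinuousOn (eTotInv P) (Ioi 0) := by
  have hR := P.R_pos
  refine (LipschitzOnWith.of_dist_le_mul (K := (2 / (5 * P.R)).toNNReal) ?_).continuousOn
  intro x hx y hy
  rw [Real.coe_toNNReal _ (by positivity)]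
  have key : ∀ x ∈ Ioi (0 : ℝ), ∀ y ∈ Ioi (0 : ℝ), x ≤ y →
      |eTotInv P x - eTotInv P y| ≤ 2 / (5 * P.R) * |x - y| := by
    intro x hx y hy hxy
    have hle : eTotInv P x ≤ eTotInv P y :=
      (strictMonoOn_eTot P).le_iff_le (eTotInv_pos P hx) (eTotInv_pos P hy) |>.1
        (by rwa [eTot_eTotInv P hx, eTot_eTotInv P hy])
    have h := (convex_Ioi (0 : ℝ)).mul_sub_le_image_sub_of_le_deriv (f := eTot P)
      (C := 5 / 2 * P.R) (contDiffOn_eTot P).continuousOn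
      (by rw [interior_Ioi]; exact (contDiffOn_eTot P).differentiableOn two_ne_zero)
      (fun T hT => by
        rw [interior_Ioi] at hT
        rw [(hasDerivAt_eTot P hT).deriv]; exact le_cv P hT)
      _ (eTotInv_pos P hx) _ (eTotInv_pos P hy) hle
    rw [eTot_eTotInv P hx, eTot_eTotInv P hy] at h
    rw [abs_sub_comm, abs_of_nonneg (sub_nonneg.2 hle), abs_sub_comm, abs_of_nonneg
      (sub_nonneg.2 hxy), div_mul_eq_mul_div, le_div_iff₀ (by positivity)]
    linarith
  rcases le_total x y with h | h
  · exact key x hx y hy h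
  · rw [dist_comm, dist_comm x]; exact key y hy x hx h

theorem hasDerivAt_eTotInv {E : ℝ} (hE : 0 < E) :
    HasDerivAt (eTotInv P) (cv P (eTotInv P E))⁻¹ E := by
  refine HasDerivAt.of_local_left_inverse
    ((continuousOn_eTotInv P).continuousAt (Ioi_mem_nhds hE))
    (hasDerivAt_eTot P (eTotInv_pos P hE)) (cv_pos P (eTotInv_pos P hE)).ne' ?_
  filter_upwards [Ioi_mem_nhds hE] with E' hE'
  exact eTot_eTotInv P hE'

/-- Bootstrap: the derivative of the inverse is 1 / c_v composed with the inverse, hence as regular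
as the inverse itself up to order one. Two rounds lead from C⁰ to C². -/
theorem contDiffOn_eTotInv : ContDiffOn ℝ 2 (eTotInv P) (Ioi 0) := by
  have hd : DifferentiableOn ℝ (eTotInv P) (Ioi 0) := fun E hE =>
    (hasDerivAt_eTotInv P hE).differentiableAt.differentiableWithinAt
  have hmaps : MapsTo (eTotInv P) (Ioi 0) (Ioi 0) := fun E hE => eTotInv_pos P hE
  have step : ∀ n : WithTop ℕ∞, n ≤ 1 → ContDiffOn ℝ n (eTotInv P) (Ioi 0) →
      ContDiffOn ℝ n (deriv (eTotInv P)) (Ioi 0) := fun n hn h => by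
    have : ContDiffOn ℝ n (fun E => (cv P (eTotInv P E))⁻¹) (Ioi 0) :=
      (((contDiffOn_cv P).of_le hn).comp h hmaps).inv fun E hE => (cv_pos P (hmaps hE)).ne'
    exact this.congr fun E hE => (hasDerivAt_eTotInv P hE).deriv
  have h1 : ContDiffOn ℝ 1 (eTotInv P) (Ioi 0) := by
    rw [← zero_add 1]
    exact (contDiffOn_succ_iff_deriv_of_isOpen isOpen_Ioi).2 ⟨hd, by simp,
      step 0 (by simp) (contDiffOn_zero.2 hd.continuousOn)⟩
  rw [← one_add_one_eq_two]
  exact (contDiffOn_succ_iff_deriv_of_isOpen isOpen_Ioi).2 ⟨hd, by simp, step 1 le_rfl h1⟩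

/-! ### Moments of Gaussians -/

/-- Half of the decay absorbs the power: (c x / 2)^k ≤ k! exp(c x / 2), whence the constant k! (2 /
c)^k. -/
theorem exists_pow_mul_exp_le (k : ℕ) {c : ℝ} (hc : 0 < c) :
    ∃ C, 0 ≤ C ∧ ∀ x, 0 ≤ x → x ^ k * Real.exp (-(c * x)) ≤ C * Real.exp (-(c / 2 * x)) := by
  refine ⟨k.factorial * (2 / c) ^ k, by positivity, fun x hx => ?_⟩
  have h := Real.pow_div_factorial_le_exp (x := c / 2 * x) (by positivity) k
  rw [div_le_iff₀ (by positivity)] at h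
  have e : Real.exp (-(c * x)) = Real.exp (-(c / 2 * x)) * Real.exp (-(c / 2 * x)) := by
    rw [← Real.exp_add]; ring_nf
  have e2 : Real.exp (-(c / 2 * x)) * Real.exp (c / 2 * x) = 1 := by
    rw [← Real.exp_add]; simp
  calc x ^ k * Real.exp (-(c * x))
      = (2 / c) ^ k * (c / 2 * x) ^ k * Real.exp (-(c / 2 * x)) * Real.exp (-(c / 2 * x)) := by
        rw [e, ← mul_assoc, ← mul_pow]; congr 3; field_simp
    _ ≤ (2 / c) ^ k * (Real.exp (c / 2 * x) * k.factorial) * Real.exp (-(c / 2 * x))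
          * Real.exp (-(c / 2 * x)) := by gcongr
    _ = k.factorial * (2 / c) ^ k * Real.exp (-(c / 2 * x))
          * (Real.exp (-(c / 2 * x)) * Real.exp (c / 2 * x)) := by ring
    _ = _ := by rw [e2, mul_one]

/-- The unnormalized standard Gaussian weight on velocity space. -/
noncomputable def stdWeight (y : E3) : ℝ := Real.exp (-‖y‖ ^ 2 / 2)

theorem stdWeight_eq_prod (y : E3) : stdWeight y = ∏ i, Real.exp (-(1 / 2) * y i ^ 2) := by
  rw [stdWeight, ← Real.exp_sum, EuclideanSpace.norm_sq_eq]
  congr 1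
  simp only [Real.norm_eq_abs, sq_abs, neg_div, Finset.sum_div, neg_mul,
    Finset.sum_neg_distrib]
  congr 1
  exact Finset.sum_congr rfl fun i _ => by ring

theorem integral_E3_prod (g : Fin 3 → ℝ → ℝ) :
    ∫ y : E3, ∏ i, g i (y i) = ∏ i, ∫ x, g i x := by
  rw [← integral_fintype_prod_volume_eq_prod]
  exact (PiLp.volume_preserving_ofLp (Fin 3)).integral_comp
    (MeasurableEquiv.toLp 2 (Fin 3 → ℝ)).symm.measurableEmbedding
    (fun x : Fin 3 → ℝ => ∏ i, g i (x i))

theorem integrable_exp_neg_norm_sq {b : ℝ} (hb : 0 < b) :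
    Integrable (fun y : E3 => Real.exp (-b * ‖y‖ ^ 2)) := by
  have h : Integrable (fun x : Fin 3 → ℝ => ∏ i, Real.exp (-b * x i ^ 2)) :=
    Integrable.fintype_prod (f := fun _ x => Real.exp (-b * x ^ 2))
      fun i => integrable_exp_neg_mul_sq hb
  have h2 := (PiLp.volume_preserving_ofLp (Fin 3)).integrable_comp_emb
    (MeasurableEquiv.toLp 2 (Fin 3 → ℝ)).symm.measurableEmbedding |>.2 h
  refine h2.congr (Eventually.of_forall fun y => ?_)
  simp only [Function.comp, ← Real.exp_sum, EuclideanSpace.norm_sq_eq, Real.norm_eq_abs, sq_abs,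
    Finset.mul_sum]

theorem integrable_mul_stdWeight {q : E3 → ℝ} (hq : Continuous q) {C : ℝ} {k : ℕ}
    (h : ∀ y, |q y| ≤ C * (1 + ‖y‖ ^ 2) ^ k) : Integrable (fun y => q y * stdWeight y) := by
  obtain ⟨D, hD0, hD⟩ := exists_pow_mul_exp_le k (c := 1 / 2) (by norm_num)
  have hC : 0 ≤ C := by
    have := (abs_nonneg _).trans (h 0)
    simpa using this
  refine ((integrable_exp_neg_norm_sq (b := 1 / 4) (by norm_num)).const_mul
    (C * Real.exp (1 / 2) * D)).mono' (by unfold stdWeight; fun_prop)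
    (Eventually.of_forall fun y => ?_)
  have := hD (1 + ‖y‖ ^ 2) (by positivity)
  rw [norm_mul, Real.norm_eq_abs, Real.norm_eq_abs, stdWeight, abs_of_pos (Real.exp_pos _)]
  calc |q y| * Real.exp (-‖y‖ ^ 2 / 2) ≤ C * (1 + ‖y‖ ^ 2) ^ k * Real.exp (-‖y‖ ^ 2 / 2) := by
        gcongr; exact h y
    _ = C * Real.exp (1 / 2) * ((1 + ‖y‖ ^ 2) ^ k * Real.exp (-(1 / 2 * (1 + ‖y‖ ^ 2)))) := by
        have : Real.exp (-‖y‖ ^ 2 / 2)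
            = Real.exp (1 / 2) * Real.exp (-(1 / 2 * (1 + ‖y‖ ^ 2))) := by
          rw [← Real.exp_add]; ring_nf
        rw [this]; ring
    _ ≤ C * Real.exp (1 / 2) * (D * Real.exp (-(1 / 2 / 2 * (1 + ‖y‖ ^ 2)))) := by gcongr
    _ ≤ _ := by
        rw [← mul_assoc]
        gcongr
        linarith

theorem integral_odd {q : E3 → ℝ} (h : ∀ y, q (-y) = - q y) : ∫ y, q y = 0 := by
  have := integral_neg_eq_self q volume
  simp only [h, integral_neg] at this
  linarith

theorem stdWeight_neg (y : E3) : stdWeight (-y) = stdWeight y := by simp [stdWeight]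

theorem integral_gauss_one_dim : ∫ x : ℝ, Real.exp (-(1 / 2) * x ^ 2) = √(2 * Real.pi) := by
  rw [integral_gaussian]; congr 1; ring

theorem integral_stdWeight : ∫ y, stdWeight y = √(2 * Real.pi) ^ 3 := by
  simp only [stdWeight_eq_prod]
  rw [integral_E3_prod (fun _ x => Real.exp (-(1 / 2) * x ^ 2)), integral_gauss_one_dim]
  simp

theorem integral_sq_gauss_one_dim :
    ∫ x : ℝ, x ^ 2 * Real.exp (-(1 / 2) * x ^ 2) = √(2 * Real.pi) := by
  have hi : ∀ n : ℕ, Integrable fun x : ℝ => x ^ n * Real.exp (-(1 / 2) * x ^ 2) := fun n => by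
    simpa using integrable_rpow_mul_exp_neg_mul_sq (b := 1 / 2) (by norm_num) (s := n)
      (by have : (0 : ℝ) ≤ n := n.cast_nonneg
          linarith)
  -- Integration by parts: the integral of the derivative of x exp(-x² / 2) vanishes, so the second
  -- moment equals the mass.
  have hd : ∀ x : ℝ, HasDerivAt (fun x : ℝ => x * Real.exp (-(1 / 2) * x ^ 2))
      (x ^ 0 * Real.exp (-(1 / 2) * x ^ 2) - x ^ 2 * Real.exp (-(1 / 2) * x ^ 2)) x := fun x => by
    have := (hasDerivAt_id' x).mul (((hasDerivAt_id' x).pow 2).const_mul (-(1 / 2) : ℝ)).exp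
    refine this.congr_deriv ?_
    simp; ring
  have h := integral_eq_zero_of_hasDerivAt_of_integrable hd ((hi 0).sub (hi 2)) (by simpa using hi 1)
  rw [integral_sub (hi 0) (hi 2), sub_eq_zero] at h
  rw [← h, ← integral_gauss_one_dim]
  simp

theorem integral_id_gauss_one_dim : ∫ x : ℝ, x * Real.exp (-(1 / 2) * x ^ 2) = 0 := by
  have := integral_neg_eq_self (fun x : ℝ => x * Real.exp (-(1 / 2) * x ^ 2)) volume
  simp only [neg_mul, even_two.neg_pow, integral_neg] at this
  simp only [neg_mul]
  linarith

theorem integral_mul_stdWeight (k l : Fin 3) : ∫ y : E3, y k * y l * stdWeight y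
    = if k = l then √(2 * Real.pi) ^ 3 else 0 := by
  -- The conditional factors spread y_k y_l over the coordinates, so that Fubini applies; for k ≠ l
  -- the k-th factor is an odd integral.
  have h : ∀ y : E3, y k * y l * stdWeight y
      = ∏ i, ((if i = k then y i else 1) * (if i = l then y i else 1)
        * Real.exp (-(1 / 2) * y i ^ 2)) := fun y => by
    simp only [Finset.prod_mul_distrib, stdWeight_eq_prod, Finset.prod_ite_eq', Finset.mem_univ,
      if_true]
  simp only [h]
  rw [integral_E3_prod (fun i x => (if i = k then x else 1) * (if i = l then x else 1)
        * Real.exp (-(1 / 2) * x ^ 2))]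
  split_ifs with hkl
  · subst hkl
    have : ∀ i : Fin 3, ∫ x : ℝ, (if i = k then x else 1) * (if i = k then x else 1)
        * Real.exp (-(1 / 2) * x ^ 2) = √(2 * Real.pi) := fun i => by
      by_cases hi : i = k
      · simp only [hi, if_true, ← sq]; exact integral_sq_gauss_one_dim
      · simp only [hi, if_false, one_mul]; exact integral_gauss_one_dim
    rw [Finset.prod_congr rfl fun i _ => this i]
    simp only [Finset.prod_const, Finset.card_univ, Fintype.card_fin]
  · refine Finset.prod_eq_zero (Finset.mem_univ k) ?_
    simp only [if_true, hkl, if_false, mul_one]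
    exact integral_id_gauss_one_dim

/-- The linear image `A y` of a vector, as an element of velocity space. -/
noncomputable def matVec (A : Matrix (Fin 3) (Fin 3) ℝ) (y : E3) : E3 := Matrix.toLpLin 2 2 A y

theorem matVec_apply (A : Matrix (Fin 3) (Fin 3) ℝ) (y : E3) (i : Fin 3) :
    matVec A y i = ∑ j, A i j * y j := by
  simp [matVec, Matrix.toLpLin_apply, Matrix.mulVec, dotProduct]

theorem matVec_neg (A : Matrix (Fin 3) (Fin 3) ℝ) (y : E3) : matVec A (-y) = - matVec A y := by
  simp [matVec]

theorem continuous_matVec (A : Matrix (Fin 3) (Fin 3) ℝ) : Continuous (matVec A) :=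
  LinearMap.continuous_of_finiteDimensional _

theorem abs_coord_le (y : E3) (i : Fin 3) : |y i| ≤ ‖y‖ := by
  simpa using PiLp.norm_apply_le y i

theorem exists_abs_matVec_le (A : Matrix (Fin 3) (Fin 3) ℝ) :
    ∃ C, 0 ≤ C ∧ ∀ y i, |matVec A y i| ≤ C * ‖y‖ := by
  let L : E3 →L[ℝ] E3 := LinearMap.toContinuousLinearMap (Matrix.toLpLin 2 2 A)
  exact ⟨‖L‖, norm_nonneg _, fun y i => (abs_coord_le _ i).trans (L.le_opNorm y)⟩

/-! ### Moments of the standard Gaussian under affine maps -/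

section StdMoments

variable (A : Matrix (Fin 3) (Fin 3) ℝ)

theorem integrable_matVec (i : Fin 3) : Integrable fun y => matVec A y i * stdWeight y := by
  obtain ⟨C, hC0, hC⟩ := exists_abs_matVec_le A
  refine integrable_mul_stdWeight (C := C) (k := 1)
    ((PiLp.continuous_apply 2 _ i).comp (continuous_matVec A)) fun y => (hC y i).trans ?_
  gcongr
  nlinarith [sq_nonneg (‖y‖ - 1)]

theorem integrable_matVec_two (i j : Fin 3) :
    Integrable fun y => matVec A y i * matVec A y j * stdWeight y := by
  obtain ⟨C, hC0, hC⟩ := exists_abs_matVec_le A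
  have hc := fun i => (PiLp.continuous_apply 2 (fun _ : Fin 3 => ℝ) i).comp (continuous_matVec A)
  refine integrable_mul_stdWeight (C := C ^ 2) (k := 1) ((hc i).mul (hc j)) fun y => ?_
  rw [abs_mul]
  calc _ ≤ (C * ‖y‖) * (C * ‖y‖) := by gcongr <;> exact hC y _
    _ = C ^ 2 * ‖y‖ ^ 2 := by ring
    _ ≤ _ := by gcongr; simp

theorem integrable_matVec_three (i j k : Fin 3) :
    Integrable fun y => matVec A y i * matVec A y j * matVec A y k * stdWeight y := by
  obtain ⟨C, hC0, hC⟩ := exists_abs_matVec_le A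
  have hc := fun i => (PiLp.continuous_apply 2 (fun _ : Fin 3 => ℝ) i).comp (continuous_matVec A)
  refine integrable_mul_stdWeight (C := C ^ 3) (k := 2) (((hc i).mul (hc j)).mul (hc k))
    fun y => ?_
  rw [abs_mul, abs_mul]
  calc _ ≤ (C * ‖y‖) * (C * ‖y‖) * (C * ‖y‖) := by gcongr <;> exact hC y _
    _ = C ^ 3 * ‖y‖ ^ 3 := by ring
    _ ≤ _ := by
      gcongr
      nlinarith [sq_nonneg (‖y‖ - 1), sq_nonneg ‖y‖, sq_nonneg (‖y‖ ^ 2), norm_nonneg y,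
        mul_nonneg (norm_nonneg y) (sq_nonneg (‖y‖ - 1)),
        mul_nonneg (sq_nonneg ‖y‖) (sq_nonneg (‖y‖ - 1))]

theorem integral_matVec (i : Fin 3) : ∫ y, matVec A y i * stdWeight y = 0 :=
  integral_odd fun y => by simp [matVec_neg, stdWeight_neg]

theorem integral_matVec_three (i j k : Fin 3) :
    ∫ y, matVec A y i * matVec A y j * matVec A y k * stdWeight y = 0 :=
  integral_odd fun y => by simp [matVec_neg, stdWeight_neg]

theorem integrable_coord_mul (k l : Fin 3) : Integrable fun y : E3 => y k * y l * stdWeight y := by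
  simpa [matVec] using integrable_matVec_two 1 k l

theorem integral_matVec_two (i j : Fin 3) : ∫ y, matVec A y i * matVec A y j * stdWeight y
    = √(2 * Real.pi) ^ 3 * (A * A.transpose) i j := by
  have h : ∀ y : E3, matVec A y i * matVec A y j * stdWeight y
      = ∑ k, ∑ l, A i k * A j l * (y k * y l * stdWeight y) := fun y => by
    rw [matVec_apply, matVec_apply, Finset.sum_mul_sum, Finset.sum_mul]
    refine Finset.sum_congr rfl fun k _ => ?_
    rw [Finset.sum_mul]
    exact Finset.sum_congr rfl fun l _ => by ring
  simp only [h]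
  rw [integral_finsetSum _ fun k _ => integrable_finsetSum _ fun l _ =>
    (integrable_coord_mul k l).const_mul _]
  rw [Matrix.mul_apply, Finset.mul_sum]
  refine Finset.sum_congr rfl fun k _ => ?_
  rw [integral_finsetSum _ fun l _ => (integrable_coord_mul k l).const_mul _]
  simp only [integral_const_mul, integral_mul_stdWeight, mul_ite, mul_zero, Finset.sum_ite_eq,
    Finset.mem_univ, if_true, Matrix.transpose_apply]
  ring

variable (u : E3)

theorem integrable_affine_zero : Integrable stdWeight := by
  simpa using integrable_mul_stdWeight (q := fun _ => 1) continuous_const (C := 1) (k := 0)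
    (by simp)

theorem integral_affine_one (i : Fin 3) :
    ∫ y, (u + matVec A y) i * stdWeight y = √(2 * Real.pi) ^ 3 * u i := by
  have h : ∀ y, (u + matVec A y) i * stdWeight y
      = u i * stdWeight y + matVec A y i * stdWeight y := fun y => by simp; ring
  simp only [h]
  rw [integral_add (integrable_affine_zero.const_mul _) (integrable_matVec A i),
    integral_const_mul, integral_matVec, integral_stdWeight]
  ring

theorem integral_affine_two (i j : Fin 3) :
    ∫ y, (u + matVec A y) i * (u + matVec A y) j * stdWeight y
      = √(2 * Real.pi) ^ 3 * (u i * u j + (A * A.transpose) i j) := by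
  have h : ∀ y, (u + matVec A y) i * (u + matVec A y) j * stdWeight y
      = u i * u j * stdWeight y + u i * (matVec A y j * stdWeight y)
        + u j * (matVec A y i * stdWeight y) + matVec A y i * matVec A y j * stdWeight y :=
    fun y => by simp; ring
  have i0 := integrable_affine_zero.const_mul (u i * u j)
  have i1 := (integrable_matVec A j).const_mul (u i)
  have i2 := (integrable_matVec A i).const_mul (u j)
  have i3 := integrable_matVec_two A i j
  simp only [h]
  rw [integral_add ((i0.fun_add i1).fun_add i2) i3, integral_add (i0.fun_add i1) i2, integral_add i0 i1]
  simp only [integral_const_mul, integral_matVec, integral_matVec_two, integral_stdWeight]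
  ring

theorem integral_affine_three (i j k : Fin 3) :
    ∫ y, (u + matVec A y) i * (u + matVec A y) j * (u + matVec A y) k * stdWeight y
      = √(2 * Real.pi) ^ 3 * (u i * u j * u k + u i * (A * A.transpose) j k
        + u j * (A * A.transpose) i k + u k * (A * A.transpose) i j) := by
  have h : ∀ y, (u + matVec A y) i * (u + matVec A y) j * (u + matVec A y) k * stdWeight y
      = u i * u j * u k * stdWeight y + u i * u j * (matVec A y k * stdWeight y)
        + u i * u k * (matVec A y j * stdWeight y) + u j * u k * (matVec A y i * stdWeight y)
        + u i * (matVec A y j * matVec A y k * stdWeight y)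
        + u j * (matVec A y i * matVec A y k * stdWeight y)
        + u k * (matVec A y i * matVec A y j * stdWeight y)
        + matVec A y i * matVec A y j * matVec A y k * stdWeight y :=
    fun y => by simp; ring
  have i0 := integrable_affine_zero.const_mul (u i * u j * u k)
  have i1 := (integrable_matVec A k).const_mul (u i * u j)
  have i2 := (integrable_matVec A j).const_mul (u i * u k)
  have i3 := (integrable_matVec A i).const_mul (u j * u k)
  have i4 := (integrable_matVec_two A j k).const_mul (u i)
  have i5 := (integrable_matVec_two A i k).const_mul (u j)
  have i6 := (integrable_matVec_two A i j).const_mul (u k)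
  have i7 := integrable_matVec_three A i j k
  have j1 := i0.fun_add i1
  have j2 := j1.fun_add i2
  have j3 := j2.fun_add i3
  have j4 := j3.fun_add i4
  have j5 := j4.fun_add i5
  have j6 := j5.fun_add i6
  simp only [h]
  rw [integral_add j6 i7, integral_add j5 i6, integral_add j4 i5, integral_add j3 i4,
    integral_add j2 i3, integral_add j1 i2, integral_add i0 i1]
  simp only [integral_const_mul, integral_matVec, integral_matVec_two, integral_matVec_three,
    integral_stdWeight]
  ring

end StdMoments

open scoped MatrixOrder in
-- A factorization S = A Aᵀ exhibits the Gaussian with covariance S as the image of the standard one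
-- under y ↦ u + A y.
theorem exists_eq_mul_transpose {S : Matrix (Fin 3) (Fin 3) ℝ} (hS : S.PosDef) :
    ∃ A : Matrix (Fin 3) (Fin 3) ℝ, S = A * A.transpose ∧ A.det ≠ 0 := by
  obtain ⟨B, hB⟩ := CStarAlgebra.nonneg_iff_eq_star_mul_self.mp hS.posSemidef.nonneg
  refine ⟨B.transpose, by simpa [Matrix.star_eq_conjTranspose] using hB, fun h => ?_⟩
  have := hS.det_pos
  rw [hB, Matrix.det_mul, ← Matrix.det_transpose B, h] at this
  simp at this

theorem integral_comp_affine {A : Matrix (Fin 3) (Fin 3) ℝ} (hA : A.det ≠ 0) (u : E3)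
    (g : E3 → ℝ) : ∫ v, g v = |A.det| * ∫ y, g (u + matVec A y) := by
  have hdet : LinearMap.det (Matrix.toLpLin 2 2 A) ≠ 0 := by rwa [LinearMap.det_toLpLin]
  have hmap := Measure.map_linearMap_addHaar_eq_smul_addHaar (volume : Measure E3) hdet
  let e : E3 ≃L[ℝ] E3 := ((Matrix.toLpLin 2 2 A).equivOfDetNeZero hdet).toContinuousLinearEquiv
  have he : ∀ y, e y = matVec A y := fun y => rfl
  have h1 : ∫ y, g (u + matVec A y) = ∫ x, g (u + x) ∂(Measure.map (matVec A) volume) :=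
    (e.toHomeomorph.measurableEmbedding.integral_map fun x => g (u + x)).symm
  have h2 : Measure.map (matVec A) volume
      = ENNReal.ofReal |(LinearMap.det (Matrix.toLpLin 2 2 A))⁻¹| • volume := hmap
  rw [h1, h2, integral_smul_measure, LinearMap.det_toLpLin, integral_add_left_eq_self,
    ENNReal.toReal_ofReal (abs_nonneg _), smul_eq_mul, ← mul_assoc, abs_inv,
    mul_inv_cancel₀ (abs_ne_zero.2 hA), one_mul]

/-! ### Rotational and vibrational factors, and moments of the generalized Gaussian -/

variable (P : GasParams)

theorem rotDensity_eq (T ε : ℝ) :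
    rotDensity P T ε = (P.R * T)⁻¹ * Real.exp (-(1 / (P.R * T) * ε)) := by
  simp [rotDensity, rotDof, div_eq_mul_inv, mul_comm]

theorem integral_rotDensity {T : ℝ} (hT : 0 < T) :
    ∫ ε in Ici (0 : ℝ), rotDensity P T ε = 1 := by
  have h : 0 < P.R * T := mul_pos P.R_pos hT
  have := Real.integral_rpow_mul_exp_neg_mul_Ioi (a := 1) (r := 1 / (P.R * T)) one_pos
    (by positivity)
  simp only [sub_self, Real.rpow_zero, one_mul, Real.Gamma_one, Real.rpow_one, one_div_one_div,
    mul_one] at this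
  simp only [rotDensity_eq, integral_const_mul, integral_Ici_eq_integral_Ioi]
  rw [this, inv_mul_cancel₀ h.ne']

theorem integral_mul_rotDensity {T : ℝ} (hT : 0 < T) :
    ∫ ε in Ici (0 : ℝ), ε * rotDensity P T ε = P.R * T := by
  have h : 0 < P.R * T := mul_pos P.R_pos hT
  have := Real.integral_rpow_mul_exp_neg_mul_Ioi (a := 2) (r := 1 / (P.R * T)) two_pos
    (by positivity)
  norm_num at this
  simp only [rotDensity_eq, integral_Ici_eq_integral_Ioi]
  simp only [mul_left_comm _ (P.R * T)⁻¹, integral_const_mul]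
  norm_num
  rw [this]
  field_simp

theorem integral_count (r : ℕ → ℝ) (hr : Summable r) : ∫ i, r i ∂Measure.count = ∑' i, r i := by
  rw [integral_countable (integrable_count_iff.2 hr.norm)]
  simp [measureReal_def]

theorem vibDensity_eq (T : ℝ) (i : ℕ) : vibDensity P T i
    = (1 - Real.exp (-P.T₀ / T)) * Real.exp (-P.T₀ / T) ^ i := by
  rw [vibDensity, ← Real.exp_nat_mul]; congr 2; ring

theorem exp_neg_div_lt_one {T : ℝ} (hT : 0 < T) : Real.exp (-P.T₀ / T) < 1 := by
  rw [Real.exp_lt_one_iff, neg_div, neg_lt_zero]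
  exact div_pos P.T₀_pos hT

theorem integral_vibDensity {T : ℝ} (hT : 0 < T) :
    ∫ i, vibDensity P T i ∂Measure.count = 1 := by
  have h1 := exp_neg_div_lt_one P hT
  have h0 := (Real.exp_pos (-P.T₀ / T)).le
  simp only [vibDensity_eq, integral_const_mul]
  rw [integral_count _ (summable_geometric_of_lt_one h0 h1), tsum_geometric_of_lt_one h0 h1,
    mul_inv_cancel₀ (by linarith)]

/-- The differentiated geometric series ∑ i qⁱ = q / (1 - q)² with q = exp(-T₀ / T). -/
theorem integral_mul_vibDensity {T : ℝ} (hT : 0 < T) :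
    ∫ i : ℕ, (i : ℝ) * vibDensity P T i ∂Measure.count = eVib P T / (P.R * P.T₀) := by
  have h1 := exp_neg_div_lt_one P hT
  have h0 := (Real.exp_pos (-P.T₀ / T))
  have hn : ‖Real.exp (-P.T₀ / T)‖ < 1 := by rwa [Real.norm_of_nonneg h0.le]
  have hs := hasSum_coe_mul_geometric_of_norm_lt_one hn
  simp only [vibDensity_eq, mul_left_comm _ (1 - Real.exp (-P.T₀ / T)), integral_const_mul]
  rw [integral_count _ hs.summable, hs.tsum_eq, eVib, div_right_comm, div_self
    (mul_pos P.R_pos P.T₀_pos).ne']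
  have e : Real.exp (P.T₀ / T) = (Real.exp (-P.T₀ / T))⁻¹ := by
    rw [← Real.exp_neg, neg_div, neg_neg]
  rw [e]
  have h2 : 1 - Real.exp (-P.T₀ / T) ≠ 0 := by linarith
  field_simp

variable {P}

/-- The substitution v = u + A y with Π = A Aᵀ turns the quadratic form of Π⁻¹ into |y|², and
√det(2πΠ) = √(2π)³ |det A| absorbs the Jacobian. All moments are thereby reduced to standard ones.
-/
theorem integral_mul_gaussTr {φ : Phase → ℝ} {A : Matrix (Fin 3) (Fin 3) ℝ}
    (hA : relTensor P φ = A * A.transpose) (hdet : A.det ≠ 0) (q : E3 → ℝ) :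
    ∫ v, q v * gaussTr P φ v = density φ / √(2 * Real.pi) ^ 3
      * ∫ y, q (velocity φ + matVec A y) * stdWeight y := by
  rw [integral_comp_affine hdet (velocity φ), ← integral_const_mul, ← integral_const_mul]
  congr 1
  ext y
  have hinv : ∑ i, ∑ j, (velocity φ + matVec A y - velocity φ) i * (relTensor P φ)⁻¹ i j
      * (velocity φ + matVec A y - velocity φ) j = ‖y‖ ^ 2 := by
    rw [add_sub_cancel_left]
    have e1 : ∑ i, ∑ j, matVec A y i * (relTensor P φ)⁻¹ i j * matVec A y j
        = (A.mulVec y.ofLp) ⬝ᵥ ((relTensor P φ)⁻¹.mulVec (A.mulVec y.ofLp)) := by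
      simp only [dotProduct, Matrix.mulVec, matVec_apply, Finset.mul_sum, mul_assoc]
    have hu : IsUnit A.det := isUnit_iff_ne_zero.2 hdet
    have hut : IsUnit A.transpose.det := by rwa [Matrix.det_transpose]
    rw [e1, hA, Matrix.mul_inv_rev, Matrix.mulVec_mulVec, Matrix.mul_assoc,
      Matrix.nonsing_inv_mul _ hu, mul_one, ← Matrix.vecMul_transpose, ← Matrix.dotProduct_mulVec,
      Matrix.mulVec_mulVec, Matrix.mul_nonsing_inv _ hut, Matrix.one_mulVec,
      EuclideanSpace.norm_sq_eq]
    simp [dotProduct, sq]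
  have hd : Real.sqrt (((2 * Real.pi) • relTensor P φ).det) = √(2 * Real.pi) ^ 3 * |A.det| := by
    rw [Matrix.det_smul, hA, Matrix.det_mul, Matrix.det_transpose, Fintype.card_fin,
      Real.sqrt_mul (by positivity), Real.sqrt_mul_self_eq_abs]
    congr 1
    rw [Real.sqrt_eq_iff_mul_self_eq (by positivity) (by positivity), ← mul_pow,
      Real.mul_self_sqrt (by positivity)]
  simp only [gaussTr]
  rw [hinv, hd, stdWeight]
  have h1 := abs_ne_zero.2 hdet
  have h2 : √(2 * Real.pi) ≠ 0 := by positivity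
  have h3 : -(1 / 2) * ‖y‖ ^ 2 = -‖y‖ ^ 2 / 2 := by ring
  rw [h3]
  field_simp

theorem bracket_prod (p : E3 → ℝ) (q : ℝ → ℝ) (r : ℕ → ℝ) :
    bracket (fun z => p z.1 * (q z.2.1 * r z.2.2))
      = (∫ v, p v) * ((∫ ε in Ici (0 : ℝ), q ε) * ∫ i, r i ∂Measure.count) := by
  rw [bracket, phaseMeasure, integral_prod_mul p (fun w : ℝ × ℕ => q w.1 * r w.2),
    integral_prod_mul]

section GaussianMoments

variable {φ : Phase → ℝ}

theorem bracket_mul_gaussian (p : E3 → ℝ) (q : ℝ → ℝ) (r : ℕ → ℝ) :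
    bracket (fun z => p z.1 * q z.2.1 * r z.2.2 * gaussian P φ z)
      = (∫ v, p v * gaussTr P φ v) * ((∫ ε in Ici (0 : ℝ), q ε * rotDensity P (relTempRot P φ) ε)
          * ∫ i, r i * vibDensity P (relTempVib P φ) i ∂Measure.count) := by
  rw [← bracket_prod]
  congr 1
  ext z
  simp only [gaussian]
  ring

theorem relTempRot_pos (h : 0 < relEnergyRot P φ) : 0 < relTempRot P φ := by
  have := P.R_pos
  simp only [relTempRot, eRotInv, rotDof]; positivity

theorem mul_relTempRot : P.R * relTempRot P φ = relEnergyRot P φ := by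
  rw [← eRot_eq, relTempRot, eRot_eRotInv]

theorem relTempVib_pos (h : 0 < relEnergyVib P φ) : 0 < relTempVib P φ := eVibInv_pos P h

theorem eVib_relTempVib (h : 0 < relEnergyVib P φ) : eVib P (relTempVib P φ) = relEnergyVib P φ :=
  eVib_eVibInv P h.le

theorem integral_gaussTr (h : (relTensor P φ).PosDef) : ∫ v, gaussTr P φ v = density φ := by
  obtain ⟨A, hA, hdet⟩ := exists_eq_mul_transpose h
  have := integral_mul_gaussTr hA hdet (fun _ => 1)
  simp only [one_mul, integral_stdWeight] at this
  rw [this]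
  have h2 : √(2 * Real.pi) ≠ 0 := by positivity
  field_simp

theorem integral_one_gaussTr (h : (relTensor P φ).PosDef) (i : Fin 3) :
    ∫ v : E3, v i * gaussTr P φ v = density φ * velocity φ i := by
  obtain ⟨A, hA, hdet⟩ := exists_eq_mul_transpose h
  rw [integral_mul_gaussTr hA hdet (fun v : E3 => v i), integral_affine_one]
  have h2 : √(2 * Real.pi) ≠ 0 := by positivity
  field_simp

theorem integral_two_gaussTr (h : (relTensor P φ).PosDef) (i j : Fin 3) :
    ∫ v : E3, v i * v j * gaussTr P φ v
      = density φ * (velocity φ i * velocity φ j + relTensor P φ i j) := by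
  obtain ⟨A, hA, hdet⟩ := exists_eq_mul_transpose h
  rw [integral_mul_gaussTr hA hdet (fun v : E3 => v i * v j), integral_affine_two, ← hA]
  have h2 : √(2 * Real.pi) ≠ 0 := by positivity
  field_simp

theorem integral_three_gaussTr (h : (relTensor P φ).PosDef) (i j k : Fin 3) :
    ∫ v : E3, v i * v j * v k * gaussTr P φ v
      = density φ * (velocity φ i * velocity φ j * velocity φ k
        + velocity φ i * relTensor P φ j k + velocity φ j * relTensor P φ i k
        + velocity φ k * relTensor P φ i j) := by
  obtain ⟨A, hA, hdet⟩ := exists_eq_mul_transpose h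
  rw [integral_mul_gaussTr hA hdet (fun v : E3 => v i * v j * v k), integral_affine_three, ← hA]
  have h2 : √(2 * Real.pi) ≠ 0 := by positivity
  field_simp

theorem bracket_tr_gaussian (hr : 0 < relEnergyRot P φ) (hv : 0 < relEnergyVib P φ)
    (p : E3 → ℝ) : bracket (fun z => p z.1 * gaussian P φ z) = ∫ v, p v * gaussTr P φ v := by
  have := bracket_mul_gaussian (P := P) (φ := φ) p (fun _ => 1) (fun _ => 1)
  simp only [mul_one, one_mul, integral_rotDensity P (relTempRot_pos hr),
    integral_vibDensity P (relTempVib_pos hv)] at this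
  exact this

theorem bracket_rot_gaussian (hr : 0 < relEnergyRot P φ) (hv : 0 < relEnergyVib P φ)
    (p : E3 → ℝ) : bracket (fun z => p z.1 * z.2.1 * gaussian P φ z)
      = (∫ v, p v * gaussTr P φ v) * relEnergyRot P φ := by
  have := bracket_mul_gaussian (P := P) (φ := φ) p (fun ε => ε) (fun _ => 1)
  simp only [mul_one, one_mul, integral_mul_rotDensity P (relTempRot_pos hr),
    integral_vibDensity P (relTempVib_pos hv), mul_relTempRot] at this
  exact this

theorem bracket_vib_gaussian (hr : 0 < relEnergyRot P φ) (hv : 0 < relEnergyVib P φ)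
    (p : E3 → ℝ) : bracket (fun z => p z.1 * (z.2.2 : ℝ) * gaussian P φ z)
      = (∫ v, p v * gaussTr P φ v) * (relEnergyVib P φ / (P.R * P.T₀)) := by
  have := bracket_mul_gaussian (P := P) (φ := φ) p (fun _ => 1) (fun i => (i : ℝ))
  simp only [mul_one, one_mul, integral_rotDensity P (relTempRot_pos hr),
    integral_mul_vibDensity P (relTempVib_pos hv), eVib_relTempVib hv] at this
  exact this

end GaussianMoments

/-! ### Moments of dominated families -/

/-- The measure only charges ε ≥ 0, so hypotheses on physical states suffice under the bracket. -/
theorem ae_nonneg_energy : ∀ᵐ z : Phase ∂phaseMeasure, 0 ≤ z.2.1 := by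
  have h1 : ∀ᵐ ε ∂(volume : Measure ℝ).restrict (Ici 0), 0 ≤ ε :=
    ae_restrict_mem measurableSet_Ici
  have h2 : ∀ᵐ w : ℝ × ℕ ∂((volume : Measure ℝ).restrict (Ici 0)).prod Measure.count,
      0 ≤ w.1 := Measure.quasiMeasurePreserving_fst.ae h1
  exact Measure.quasiMeasurePreserving_snd.ae h2

theorem aestronglyMeasurable_clm {α : Type*} [MeasurableSpace α] {μ : Measure α}
    {L : α → ST →L[ℝ] ℝ} (h : ∀ w, AEStronglyMeasurable (fun z => L z w) μ) :
    AEStronglyMeasurable L μ := by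
  let b := Module.finBasis ℝ ST
  have e : L = fun z => ∑ i, L z (b i) • LinearMap.toContinuousLinearMap (b.coord i) := by
    ext1 z
    refine ContinuousLinearMap.ext fun w => ?_
    have : L z w = ∑ i, b.repr w i * L z (b i) := by
      conv_lhs => rw [← b.sum_repr w, map_sum]
      simp only [map_smul, smul_eq_mul]
    simpa [mul_comm] using this
  rw [e]
  exact Finset.aestronglyMeasurable_fun_sum _ fun i _ => (h (b i)).smul_const _

/-- Directional derivatives are limits of difference quotients, which are measurable as long as the
shifted base points stay in `U`. -/
theorem aestronglyMeasurable_fderiv {α : Type*} [MeasurableSpace α] {μ : Measure α} {U : Set ST}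
    (hU : IsOpen U) {H : ST → α → ℝ} (hm : ∀ p ∈ U, AEStronglyMeasurable (H p) μ) {p : ST}
    (hp : p ∈ U) (hd : ∀ᵐ z ∂μ, DifferentiableAt ℝ (fun p => H p z) p) :
    AEStronglyMeasurable (fun z => fderiv ℝ (fun p => H p z) p) μ := by
  refine aestronglyMeasurable_clm fun w => ?_
  have h0 : Tendsto (fun n : ℕ => p + ((n : ℝ))⁻¹ • w) atTop (𝓝 p) := by
    simpa using (tendsto_inv_atTop_nhds_zero_nat (𝕜 := ℝ)).smul_const w |>.const_add p
  -- The increments w / n are only used from n = N on, when p + w / n lies in `U`.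
  obtain ⟨N, hN⟩ := eventually_atTop.1 (h0.eventually (hU.mem_nhds hp))
  refine aestronglyMeasurable_of_tendsto_ae atTop
    (f := fun (n : ℕ) z => ((n + N : ℕ) : ℝ) • (H (p + (((n + N : ℕ) : ℝ))⁻¹ • w) z - H p z))
    (fun n => ((hm _ (hN (n + N) (Nat.le_add_left _ _))).sub (hm p hp)).const_smul ((n + N : ℕ) : ℝ)) ?_
  filter_upwards [hd] with z hz
  refine hz.hasFDerivAt.lim w ?_
  exact tendsto_norm_atTop_atTop.comp (tendsto_natCast_atTop_atTop.comp (tendsto_add_atTop_nat N))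

theorem hasFDerivAt_bracket {U : Set ST} (hU : IsOpen U) {H : ST → Phase → ℝ} {g : Phase → ℝ}
    (hg : Integrable g phaseMeasure) (hm : ∀ p ∈ U, AEStronglyMeasurable (H p) phaseMeasure)
    (hd : ∀ p ∈ U, ∀ z : Phase, 0 ≤ z.2.1 → DifferentiableAt ℝ (fun p => H p z) p)
    (hb : ∀ p ∈ U, ∀ z : Phase, 0 ≤ z.2.1 → |H p z| ≤ g z)
    (hb' : ∀ p ∈ U, ∀ z : Phase, 0 ≤ z.2.1 → ‖fderiv ℝ (fun p => H p z) p‖ ≤ g z)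
    {p : ST} (hp : p ∈ U) : HasFDerivAt (fun p => bracket (H p))
      (∫ z, fderiv ℝ (fun p => H p z) p ∂phaseMeasure) p := by
  refine hasFDerivAt_integral_of_dominated_of_fderiv_le (F := H)
    (F' := fun p z => fderiv ℝ (fun p => H p z) p) (bound := g) (hU.mem_nhds hp) ?_ ?_ ?_ ?_ hg ?_
  · filter_upwards [hU.mem_nhds hp] with q hq using hm q hq
  · exact hg.mono' (hm p hp) (ae_nonneg_energy.mono fun z hz => hb p hp z hz)
  · exact aestronglyMeasurable_fderiv hU hm hp (ae_nonneg_energy.mono fun z hz => hd p hp z hz)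
  · exact ae_nonneg_energy.mono fun z hz q hq => hb' q hq z hz
  · exact ae_nonneg_energy.mono fun z hz q hq => (hd q hq z hz).hasFDerivAt

theorem smallC1_bracket {l : Filter ℝ} {Kn₀ : ℝ} (hl : ∀ᶠ κ in l, κ ∈ Ioo 0 Kn₀) {U : Set ST}
    (hU : IsOpen U) {H : ℝ → ST → Phase → ℝ} {g : Phase → ℝ} (hg : Integrable g phaseMeasure)
    (hm : ∀ κ ∈ Ioo 0 Kn₀, ∀ p ∈ U, AEStronglyMeasurable (H κ p) phaseMeasure)
    (hd : ∀ κ ∈ Ioo 0 Kn₀, ∀ p ∈ U, ∀ z : Phase, 0 ≤ z.2.1 →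
      DifferentiableAt ℝ (fun p => H κ p z) p)
    (hb : ∀ κ ∈ Ioo 0 Kn₀, ∀ p ∈ U, ∀ z : Phase, 0 ≤ z.2.1 → |H κ p z| ≤ g z)
    (hb' : ∀ κ ∈ Ioo 0 Kn₀, ∀ p ∈ U, ∀ z : Phase, 0 ≤ z.2.1 →
      ‖fderiv ℝ (fun p => H κ p z) p‖ ≤ g z) :
    SmallC1 l U 0 (fun κ p => bracket (H κ p)) := by
  have key : ∀ᶠ q : ℝ × ST in l ×ˢ 𝓟 U, q.1 ∈ Ioo 0 Kn₀ ∧ q.2 ∈ U := by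
    rw [eventually_prod_principal_iff]
    exact hl.mono fun κ hκ p hp => ⟨hκ, hp⟩
  refine ⟨?_, IsBigO.of_bound (∫ z, g z ∂phaseMeasure) ?_,
    IsBigO.of_bound (∫ z, g z ∂phaseMeasure) ?_⟩
  · filter_upwards [key] with q hq
    exact (hasFDerivAt_bracket hU hg (hm _ hq.1) (hd _ hq.1) (hb _ hq.1) (hb' _ hq.1)
      hq.2).differentiableAt
  · filter_upwards [key] with q hq
    simp only [pow_zero, norm_one, mul_one]
    exact norm_integral_le_of_norm_le hg
      (ae_nonneg_energy.mono fun z hz => hb _ hq.1 _ hq.2 z hz)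
  · filter_upwards [key] with q hq
    simp only [pow_zero, norm_one, mul_one]
    rw [(hasFDerivAt_bracket hU hg (hm _ hq.1) (hd _ hq.1) (hb _ hq.1) (hb' _ hq.1) hq.2).fderiv]
    exact norm_integral_le_of_norm_le hg
      (ae_nonneg_energy.mono fun z hz => hb' _ hq.1 _ hq.2 z hz)

/-! ### Test functions controlled by the weight, and their moments -/

/-- The weight `(1 + |v|²) (1 + |v|² + ε + i)`. -/
noncomputable def weight (z : Phase) : ℝ := (1 + ‖z.1‖ ^ 2) * (1 + ‖z.1‖ ^ 2 + z.2.1 + (z.2.2 : ℝ))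

/-- Measurable functions `ψ` such that `(1 + |v|) ^ r ψ` is dominated by the weight. -/
structure Admissible (r : ℕ) (ψ : Phase → ℝ) : Prop where
  meas : Measurable ψ
  bound : ∃ C, ∀ z : Phase, 0 ≤ z.2.1 → (1 + ‖z.1‖) ^ r * |ψ z| ≤ C * weight z

theorem Admissible.mono {r s : ℕ} (hrs : r ≤ s) {ψ : Phase → ℝ} (h : Admissible s ψ) :
    Admissible r ψ := by
  obtain ⟨C, hC⟩ := h.bound
  refine ⟨h.meas, C, fun z hz => le_trans ?_ (hC z hz)⟩
  gcongr
  have := norm_nonneg z.1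
  linarith

/-- The index counts the spare powers of 1 + |v|; a velocity factor uses up one. -/
theorem Admissible.mul_coord {r : ℕ} {ψ : Phase → ℝ} (h : Admissible (r + 1) ψ) (j : Fin 3) :
    Admissible r (fun z => ψ z * z.1 j) := by
  obtain ⟨C, hC⟩ := h.bound
  refine ⟨h.meas.mul (by fun_prop), C, fun z hz => le_trans ?_ (hC z hz)⟩
  rw [abs_mul, pow_succ]
  have h1 := abs_coord_le z.1 j
  calc (1 + ‖z.1‖) ^ r * (|ψ z| * |z.1 j|) ≤ (1 + ‖z.1‖) ^ r * (|ψ z| * (1 + ‖z.1‖)) := by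
        gcongr; linarith
    _ = _ := by ring

theorem one_add_norm_sq_le (v : E3) : (1 + ‖v‖) ^ 2 ≤ 2 * (1 + ‖v‖ ^ 2) := by
  nlinarith [sq_nonneg (1 - ‖v‖)]

/-- The weight dominates (1 + |v|)⁴. Beside ε or i only (1 + |v|)² is left, which accounts for the
index 2 in `admissible_rot` and `admissible_vib`. -/
theorem admissible_one : Admissible 4 (fun _ => 1) := by
  refine ⟨measurable_const, 4, fun z hz => ?_⟩
  have h0 : (0 : ℝ) ≤ z.2.2 := z.2.2.cast_nonneg
  calc (1 + ‖z.1‖) ^ 4 * |(1 : ℝ)| = (1 + ‖z.1‖) ^ 2 * (1 + ‖z.1‖) ^ 2 := by simp; ring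
    _ ≤ (2 * (1 + ‖z.1‖ ^ 2)) * (2 * (1 + ‖z.1‖ ^ 2 + z.2.1 + z.2.2)) := by
        gcongr
        · exact one_add_norm_sq_le _
        · have := one_add_norm_sq_le z.1; linarith
    _ = _ := by rw [weight]; ring

theorem admissible_rot : Admissible 2 (fun z => z.2.1) := by
  refine ⟨by fun_prop, 2, fun z hz => ?_⟩
  have h0 : (0 : ℝ) ≤ z.2.2 := z.2.2.cast_nonneg
  rw [abs_of_nonneg hz, weight, ← mul_assoc]
  gcongr
  · exact one_add_norm_sq_le _
  · have := sq_nonneg ‖z.1‖; linarith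

theorem admissible_vib : Admissible 2 (fun z => (z.2.2 : ℝ)) := by
  refine ⟨by fun_prop, 2, fun z hz => ?_⟩
  have h0 : (0 : ℝ) ≤ z.2.2 := z.2.2.cast_nonneg
  rw [abs_of_nonneg h0, weight, ← mul_assoc]
  gcongr
  · exact one_add_norm_sq_le _
  · have := sq_nonneg ‖z.1‖; linarith

/-- Regularity of a family of distributions, with the dominating function `g` exposed. -/
structure RegFamily (Kn₀ : ℝ) (U : Set ST) (g : Phase → ℝ) (f : ℝ → ℝ → E3 → Phase → ℝ) :
    Prop where
  g_int : Integrable (fun z => weight z * g z) phaseMeasure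
  meas : ∀ κ ∈ Ioo 0 Kn₀, ∀ p ∈ U, AEStronglyMeasurable (f κ p.1 p.2) phaseMeasure
  diff : ∀ κ ∈ Ioo 0 Kn₀, ∀ p ∈ U, ∀ z : Phase, 0 ≤ z.2.1 →
    DifferentiableAt ℝ (fun p : ST => f κ p.1 p.2 z) p
  diff_two : ∀ κ ∈ Ioo 0 Kn₀, ∀ p ∈ U, ∀ z : Phase, 0 ≤ z.2.1 →
    DifferentiableAt ℝ (fderiv ℝ (fun p : ST => f κ p.1 p.2 z)) p
  bound_zero : ∀ κ ∈ Ioo 0 Kn₀, ∀ p ∈ U, ∀ z : Phase, 0 ≤ z.2.1 → |f κ p.1 p.2 z| ≤ g z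
  bound_one : ∀ κ ∈ Ioo 0 Kn₀, ∀ p ∈ U, ∀ z : Phase, 0 ≤ z.2.1 →
    ‖fderiv ℝ (fun p : ST => f κ p.1 p.2 z) p‖ ≤ g z
  bound_two : ∀ κ ∈ Ioo 0 Kn₀, ∀ p ∈ U, ∀ z : Phase, 0 ≤ z.2.1 →
    ‖fderiv ℝ (fderiv ℝ (fun p : ST => f κ p.1 p.2 z)) p‖ ≤ g z

/-- The free transport derivative `∂ₜ f + v · ∇ₓ f`. -/
noncomputable def flow (f : ℝ → ℝ → E3 → Phase → ℝ) (κ : ℝ) (p : ST) (z : Phase) : ℝ :=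
  fderiv ℝ (fun p : ST => f κ p.1 p.2 z) p (1, z.1)

/-- Moments of `f`. -/
noncomputable def mom (f : ℝ → ℝ → E3 → Phase → ℝ) (ψ : Phase → ℝ) (κ : ℝ) (p : ST) : ℝ :=
  bracket (fun z => ψ z * f κ p.1 p.2 z)

/-- Moments of the free transport derivative of `f`. -/
noncomputable def flowMom (f : ℝ → ℝ → E3 → Phase → ℝ) (ψ : Phase → ℝ) (κ : ℝ) (p : ST) : ℝ :=
  bracket (fun z => ψ z * flow f κ p z)

namespace RegFamily

variable {Kn₀ : ℝ} {U : Set ST} {g : Phase → ℝ} {f : ℝ → ℝ → E3 → Phase → ℝ}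
  (h : RegFamily Kn₀ U g f)

theorem _root_.ESBGK.norm_dir_le (v : E3) : ‖((1 : ℝ), v)‖ ≤ 1 + ‖v‖ := by
  rw [Prod.norm_def]
  simp

theorem _root_.ESBGK.Admissible.weighted_bound {r : ℕ} {ψ : Phase → ℝ} {C : ℝ}
    (hC : ∀ z : Phase, 0 ≤ z.2.1 → (1 + ‖z.1‖) ^ r * |ψ z| ≤ C * weight z) {z : Phase}
    (hz : 0 ≤ z.2.1) {x y : ℝ} (hx : x ≤ (1 + ‖z.1‖) ^ r * y) (hy : 0 ≤ y) :
    |ψ z| * x ≤ C * (weight z * y) := by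
  calc |ψ z| * x ≤ |ψ z| * ((1 + ‖z.1‖) ^ r * y) := by gcongr
    _ = ((1 + ‖z.1‖) ^ r * |ψ z|) * y := by ring
    _ ≤ C * weight z * y := mul_le_mul_of_nonneg_right (hC z hz) hy
    _ = _ := by ring

include h

theorem g_nonneg {κ : ℝ} (hκ : κ ∈ Ioo 0 Kn₀) {p : ST} (hp : p ∈ U) {z : Phase}
    (hz : 0 ≤ z.2.1) : 0 ≤ g z := (abs_nonneg _).trans (h.bound_zero κ hκ p hp z hz)

theorem hasFDerivAt_flow {κ : ℝ} (hκ : κ ∈ Ioo 0 Kn₀) {p : ST} (hp : p ∈ U) {z : Phase}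
    (hz : 0 ≤ z.2.1) : HasFDerivAt (fun p => flow f κ p z)
      ((ContinuousLinearMap.apply ℝ ℝ ((1 : ℝ), z.1)).comp
        (fderiv ℝ (fderiv ℝ (fun p : ST => f κ p.1 p.2 z)) p)) p :=
  (ContinuousLinearMap.apply ℝ ℝ ((1 : ℝ), z.1)).hasFDerivAt.comp p
    (h.diff_two κ hκ p hp z hz).hasFDerivAt

theorem abs_flow_le {κ : ℝ} (hκ : κ ∈ Ioo 0 Kn₀) {p : ST} (hp : p ∈ U) {z : Phase}
    (hz : 0 ≤ z.2.1) : |flow f κ p z| ≤ (1 + ‖z.1‖) * g z := by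
  refine ((fderiv ℝ (fun p : ST => f κ p.1 p.2 z) p).le_opNorm _).trans ?_
  rw [mul_comm]
  gcongr
  · exact norm_dir_le _
  · exact h.bound_one κ hκ p hp z hz

theorem norm_fderiv_flow_le {κ : ℝ} (hκ : κ ∈ Ioo 0 Kn₀) {p : ST} (hp : p ∈ U) {z : Phase}
    (hz : 0 ≤ z.2.1) : ‖fderiv ℝ (fun p => flow f κ p z) p‖ ≤ (1 + ‖z.1‖) * g z := by
  rw [(h.hasFDerivAt_flow hκ hp hz).fderiv]
  have hg := h.g_nonneg hκ hp hz
  refine ContinuousLinearMap.opNorm_le_bound _ (by positivity) fun w => ?_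
  have h2 := h.bound_two κ hκ p hp z hz
  calc ‖fderiv ℝ (fderiv ℝ (fun p : ST => f κ p.1 p.2 z)) p w ((1 : ℝ), z.1)‖
      ≤ ‖fderiv ℝ (fderiv ℝ (fun p : ST => f κ p.1 p.2 z)) p w‖ * ‖((1 : ℝ), z.1)‖ :=
        ContinuousLinearMap.le_opNorm _ _
    _ ≤ (g z * ‖w‖) * (1 + ‖z.1‖) := by
        gcongr
        · exact (ContinuousLinearMap.le_opNorm _ _).trans (by gcongr)
        · exact norm_dir_le _
    _ = _ := by ring

theorem aestronglyMeasurable_fderiv (hU : IsOpen U) {κ : ℝ} (hκ : κ ∈ Ioo 0 Kn₀) {p : ST}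
    (hp : p ∈ U) : AEStronglyMeasurable
      (fun z => fderiv ℝ (fun p : ST => f κ p.1 p.2 z) p) phaseMeasure :=
  ESBGK.aestronglyMeasurable_fderiv hU (H := fun p => f κ p.1 p.2) (h.meas κ hκ) hp
    (ae_nonneg_energy.mono fun z hz => h.diff κ hκ p hp z hz)

theorem aestronglyMeasurable_flow (hU : IsOpen U) {κ : ℝ} (hκ : κ ∈ Ioo 0 Kn₀) {p : ST}
    (hp : p ∈ U) : AEStronglyMeasurable (flow f κ p) phaseMeasure := by
  have h1 := h.aestronglyMeasurable_fderiv hU hκ hp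
  have h2 : Measurable (fun z : Phase => ((1 : ℝ), z.1)) := by fun_prop
  exact (isBoundedBilinearMap_apply (𝕜 := ℝ) (E := ST) (F := ℝ)).continuous
    |>.comp_aestronglyMeasurable (h1.prodMk h2.aestronglyMeasurable)

theorem smallC1_mom {l : Filter ℝ} (hl : ∀ᶠ κ in l, κ ∈ Ioo 0 Kn₀) (hU : IsOpen U)
    {ψ : Phase → ℝ} (hψ : Admissible 0 ψ) : SmallC1 l U 0 (mom f ψ) := by
  obtain ⟨C, hC⟩ := hψ.bound
  refine smallC1_bracket hl hU (H := fun κ p z => ψ z * f κ p.1 p.2 z) (h.g_int.const_mul C)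
    (fun κ hκ p hp => hψ.meas.aestronglyMeasurable.mul (h.meas κ hκ p hp))
    (fun κ hκ p hp z hz => (h.diff κ hκ p hp z hz).const_mul _)
    (fun κ hκ p hp z hz => ?_) (fun κ hκ p hp z hz => ?_)
  · rw [abs_mul]
    exact Admissible.weighted_bound hC hz (by simpa using h.bound_zero κ hκ p hp z hz)
      (h.g_nonneg hκ hp hz)
  · rw [fderiv_const_mul (h.diff κ hκ p hp z hz), norm_smul]
    exact Admissible.weighted_bound hC hz (by simpa using h.bound_one κ hκ p hp z hz)
      (h.g_nonneg hκ hp hz)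

/-- The transport derivative contains one velocity factor, hence the one spare power, and one
derivative; its own derivative therefore relies on the bound for second derivatives of f. -/
theorem smallC1_flowMom {l : Filter ℝ} (hl : ∀ᶠ κ in l, κ ∈ Ioo 0 Kn₀) (hU : IsOpen U)
    {ψ : Phase → ℝ} (hψ : Admissible 1 ψ) : SmallC1 l U 0 (flowMom f ψ) := by
  obtain ⟨C, hC⟩ := hψ.bound
  refine smallC1_bracket hl hU (H := fun κ p z => ψ z * flow f κ p z) (h.g_int.const_mul C)
    (fun κ hκ p hp => hψ.meas.aestronglyMeasurable.mul (h.aestronglyMeasurable_flow hU hκ hp))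
    (fun κ hκ p hp z hz => (h.hasFDerivAt_flow hκ hp hz).differentiableAt.const_mul _)
    (fun κ hκ p hp z hz => ?_) (fun κ hκ p hp z hz => ?_)
  · rw [abs_mul]
    exact Admissible.weighted_bound hC hz (by simpa using h.abs_flow_le hκ hp hz)
      (h.g_nonneg hκ hp hz)
  · rw [fderiv_const_mul (h.hasFDerivAt_flow hκ hp hz).differentiableAt, norm_smul]
    exact Admissible.weighted_bound hC hz (by simpa using h.norm_fderiv_flow_le hκ hp hz)
      (h.g_nonneg hκ hp hz)

theorem integrable_mul (_hU : IsOpen U) {κ : ℝ} (hκ : κ ∈ Ioo 0 Kn₀) {p : ST} (hp : p ∈ U)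
    {ψ : Phase → ℝ} (hψ : Admissible 0 ψ) :
    Integrable (fun z => ψ z * f κ p.1 p.2 z) phaseMeasure := by
  obtain ⟨C, hC⟩ := hψ.bound
  refine (h.g_int.const_mul C).mono' (hψ.meas.aestronglyMeasurable.mul (h.meas κ hκ p hp))
    (ae_nonneg_energy.mono fun z hz => ?_)
  rw [norm_mul]
  exact Admissible.weighted_bound hC hz (by simpa using h.bound_zero κ hκ p hp z hz)
    (h.g_nonneg hκ hp hz)

theorem integrable_mul_flow (hU : IsOpen U) {κ : ℝ} (hκ : κ ∈ Ioo 0 Kn₀) {p : ST} (hp : p ∈ U)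
    {ψ : Phase → ℝ} (hψ : Admissible 1 ψ) :
    Integrable (fun z => ψ z * flow f κ p z) phaseMeasure := by
  obtain ⟨C, hC⟩ := hψ.bound
  refine (h.g_int.const_mul C).mono'
    (hψ.meas.aestronglyMeasurable.mul (h.aestronglyMeasurable_flow hU hκ hp))
    (ae_nonneg_energy.mono fun z hz => ?_)
  rw [norm_mul]
  exact Admissible.weighted_bound hC hz (by simpa using h.abs_flow_le hκ hp hz)
    (h.g_nonneg hκ hp hz)

theorem integrable_smul_fderiv (hU : IsOpen U) {κ : ℝ} (hκ : κ ∈ Ioo 0 Kn₀) {p : ST} (hp : p ∈ U)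
    {ψ : Phase → ℝ} (hψ : Admissible 0 ψ) :
    Integrable (fun z => ψ z • fderiv ℝ (fun p : ST => f κ p.1 p.2 z) p) phaseMeasure := by
  obtain ⟨C, hC⟩ := hψ.bound
  refine (h.g_int.const_mul C).mono'
    (hψ.meas.aestronglyMeasurable.smul (h.aestronglyMeasurable_fderiv hU hκ hp))
    (ae_nonneg_energy.mono fun z hz => ?_)
  rw [norm_smul]
  exact Admissible.weighted_bound hC hz (by simpa using h.bound_one κ hκ p hp z hz)
    (h.g_nonneg hκ hp hz)

theorem fderiv_mom (hU : IsOpen U) {κ : ℝ} (hκ : κ ∈ Ioo 0 Kn₀) {p : ST} (hp : p ∈ U)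
    {ψ : Phase → ℝ} (hψ : Admissible 0 ψ) (w : ST) : fderiv ℝ (mom f ψ κ) p w
      = ∫ z, ψ z * fderiv ℝ (fun p : ST => f κ p.1 p.2 z) p w ∂phaseMeasure := by
  obtain ⟨C, hC⟩ := hψ.bound
  have key := hasFDerivAt_bracket hU (H := fun p z => ψ z * f κ p.1 p.2 z) (h.g_int.const_mul C)
    (fun p hp => hψ.meas.aestronglyMeasurable.mul (h.meas κ hκ p hp))
    (fun p hp z hz => (h.diff κ hκ p hp z hz).const_mul _)
    (fun p hp z hz => by
      rw [abs_mul]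
      exact Admissible.weighted_bound hC hz (by simpa using h.bound_zero κ hκ p hp z hz)
        (h.g_nonneg hκ hp hz))
    (fun p hp z hz => by
      rw [fderiv_const_mul (h.diff κ hκ p hp z hz), norm_smul]
      exact Admissible.weighted_bound hC hz (by simpa using h.bound_one κ hκ p hp z hz)
        (h.g_nonneg hκ hp hz)) hp
  have e : ∫ z, fderiv ℝ (fun p : ST => ψ z * f κ p.1 p.2 z) p ∂phaseMeasure
      = ∫ z, ψ z • fderiv ℝ (fun p : ST => f κ p.1 p.2 z) p ∂phaseMeasure :=
    integral_congr_ae (ae_nonneg_energy.mono fun z hz =>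
      fderiv_const_mul (h.diff κ hκ p hp z hz) _)
  rw [e] at key
  have := key.fderiv
  change fderiv ℝ (fun p => bracket fun z => ψ z * f κ p.1 p.2 z) p w = _
  rw [this, ContinuousLinearMap.integral_apply (h.integrable_smul_fderiv hU hκ hp hψ)]
  rfl

/-- Moments of the transport derivative are divergences of moments of `f`. -/
theorem flowMom_eq (hU : IsOpen U) {κ : ℝ} (hκ : κ ∈ Ioo 0 Kn₀) {p : ST} (hp : p ∈ U)
    {ψ : Phase → ℝ} (hψ : Admissible 1 ψ) : flowMom f ψ κ p = fderiv ℝ (mom f ψ κ) p (1, 0)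
      + ∑ j, fderiv ℝ (mom f (fun z => ψ z * z.1 j) κ) p (0, EuclideanSpace.single j 1) := by
  have hψ0 : Admissible 0 ψ := hψ.mono (Nat.zero_le 1)
  have hi : ∀ (χ : Phase → ℝ) (w : ST), Admissible 0 χ → Integrable
      (fun z => χ z * fderiv ℝ (fun p : ST => f κ p.1 p.2 z) p w) phaseMeasure := fun χ w hχ =>
    (ContinuousLinearMap.apply ℝ ℝ w).integrable_comp (h.integrable_smul_fderiv hU hκ hp hχ)
  rw [h.fderiv_mom hU hκ hp hψ0]
  simp only [fun j => h.fderiv_mom hU hκ hp (hψ.mul_coord j)]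
  rw [← integral_finsetSum _ fun j _ => hi _ _ (hψ.mul_coord j),
    ← integral_add (hi _ _ hψ0) (integrable_finsetSum _ fun j _ => hi _ _ (hψ.mul_coord j))]
  refine integral_congr_ae (Eventually.of_forall fun z => ?_)
  -- The direction (1, v) is resolved along the coordinate axes, and each factor v_j is moved into
  -- the test function.
  have e : ((1 : ℝ), z.1) = ((1 : ℝ), (0 : E3))
      + ∑ j, z.1 j • ((0 : ℝ), (EuclideanSpace.single j 1 : E3)) := by
    refine Prod.ext (by simp [Prod.fst_sum]) ?_
    ext i
    simp [Prod.snd_sum, Finset.sum_apply, Pi.single_apply]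
  simp only [flow]
  rw [e, map_add, map_sum, mul_add, Finset.mul_sum]
  simp only [map_smul, smul_eq_mul, mul_assoc]

end RegFamily

/-! ### Moments of a single distribution -/

section Single

variable {P : GasParams} {φ : Phase → ℝ}

theorem bracket_one (φ : Phase → ℝ) : bracket (fun z => (1 : ℝ) * φ z) = density φ := by
  simp [density]

theorem bracket_coord (hρ : 0 < density φ) (i : Fin 3) :
    bracket (fun z => z.1 i * φ z) = density φ * velocity φ i := by
  simp only [velocity]
  rw [mul_div_cancel₀ _ hρ.ne']

theorem bracket_rot (hρ : 0 < density φ) :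
    bracket (fun z => z.2.1 * φ z) = density φ * energyRot φ := by
  rw [energyRot, mul_div_cancel₀ _ hρ.ne']

theorem bracket_vib (hρ : 0 < density φ) :
    bracket (fun z => (z.2.2 : ℝ) * φ z) = density φ * (energyVib P φ / (P.R * P.T₀)) := by
  have e : ∀ z : Phase, (z.2.2 : ℝ) * P.R * P.T₀ * φ z = (P.R * P.T₀) * ((z.2.2 : ℝ) * φ z) :=
    fun z => by ring
  simp only [energyVib, e]
  rw [show bracket (fun z => (P.R * P.T₀) * ((z.2.2 : ℝ) * φ z))
    = (P.R * P.T₀) * bracket (fun z => (z.2.2 : ℝ) * φ z) from integral_const_mul _ _]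
  have h1 := hρ.ne'
  have h2 := P.R_pos.ne'
  have h3 := P.T₀_pos.ne'
  field_simp

theorem admissible_coord_two (i j : Fin 3) : Admissible 2 (fun z : Phase => z.1 i * z.1 j) := by
  simpa using ((admissible_one.mul_coord i).mul_coord j)

theorem admissible_coord (i : Fin 3) : Admissible 3 (fun z : Phase => z.1 i) := by
  simpa using (admissible_one.mul_coord i)

variable (hI : ∀ ψ, Admissible 0 ψ → Integrable (fun z => ψ z * φ z) phaseMeasure)

include hI

theorem bracket_two (hρ : 0 < density φ) (i j : Fin 3) :
    bracket (fun z => z.1 i * z.1 j * φ z)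
      = density φ * (velocity φ i * velocity φ j + Theta φ i j) := by
  have i2 := hI _ ((admissible_coord_two i j).mono (Nat.zero_le _))
  have i1 := fun i => hI _ ((admissible_coord i).mono (Nat.zero_le _))
  have i0 := hI _ (admissible_one.mono (Nat.zero_le _))
  have e : bracket (fun z => (z.1 - velocity φ) i * (z.1 - velocity φ) j * φ z)
      = bracket (fun z => z.1 i * z.1 j * φ z) - velocity φ j * bracket (fun z => z.1 i * φ z)
        - velocity φ i * bracket (fun z => z.1 j * φ z)
        + velocity φ i * velocity φ j * bracket (fun z => 1 * φ z) := by
    have : ∀ z : Phase, (z.1 - velocity φ) i * (z.1 - velocity φ) j * φ z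
        = z.1 i * z.1 j * φ z + (-velocity φ j) * (z.1 i * φ z)
        + (-velocity φ i) * (z.1 j * φ z) + velocity φ i * velocity φ j * (1 * φ z) := fun z => by
      simp only [PiLp.sub_apply]; ring
    simp only [bracket, this]
    have a1 := (i1 i).const_mul (-velocity φ j)
    have a2 := (i1 j).const_mul (-velocity φ i)
    have a3 := i0.const_mul (velocity φ i * velocity φ j)
    rw [integral_add ((i2.fun_add a1).fun_add a2) a3, integral_add (i2.fun_add a1) a2,
      integral_add i2 a1]
    simp only [integral_const_mul]
    ring
  simp only [Theta, Matrix.of_apply]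
  rw [e, bracket_coord hρ, bracket_coord hρ, bracket_one]
  field_simp
  ring

theorem integrable_centered (i : Fin 3) :
    Integrable (fun z => (z.1 - velocity φ) i * (z.1 - velocity φ) i * φ z) phaseMeasure := by
  have i2 := hI _ ((admissible_coord_two i i).mono (Nat.zero_le _))
  have i1 := fun i => hI _ ((admissible_coord i).mono (Nat.zero_le _))
  have i0 := hI _ (admissible_one.mono (Nat.zero_le _))
  have a1 := (i1 i).const_mul (-(2 * velocity φ i))
  have a3 := i0.const_mul (velocity φ i * velocity φ i)
  refine ((i2.fun_add a1).fun_add a3).congr (Eventually.of_forall fun z => ?_)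
  simp only [PiLp.sub_apply]; ring

theorem bracket_norm_sq :
    bracket (fun z => 1 / 2 * ‖z.1 - velocity φ‖ ^ 2 * φ z)
      = 1 / 2 * ∑ i, bracket (fun z => (z.1 - velocity φ) i * (z.1 - velocity φ) i * φ z) := by
  simp only [bracket]
  rw [← integral_finsetSum _ fun i _ => integrable_centered hI i, ← integral_const_mul]
  congr 1
  ext z
  simp only [EuclideanSpace.norm_sq_eq, Real.norm_eq_abs, sq_abs]
  rw [mul_assoc, Finset.sum_mul]
  simp only [sq]

theorem energyTr_eq : energyTr φ = 1 / 2 * ∑ i, Theta φ i i := by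
  rw [energyTr, bracket_norm_sq hI, mul_div_assoc, Finset.sum_div]
  simp [Theta]

theorem integrable_norm_sq :
    Integrable (fun z => 1 / 2 * ‖z.1 - velocity φ‖ ^ 2 * φ z) phaseMeasure := by
  refine ((integrable_finsetSum Finset.univ fun i _ => integrable_centered hI i).const_mul
    (1 / 2)).congr (Eventually.of_forall fun z => ?_)
  simp only [EuclideanSpace.norm_sq_eq, Real.norm_eq_abs, sq_abs]
  rw [mul_assoc, Finset.sum_mul]
  simp only [sq]

theorem energy_eq (P : GasParams) : energy P φ = energyTr φ + energyRot φ + energyVib P φ := by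
  have ir := hI _ (admissible_rot.mono (Nat.zero_le _))
  have iv : Integrable (fun z : Phase => (z.2.2 : ℝ) * P.R * P.T₀ * φ z) phaseMeasure :=
    ((hI _ (admissible_vib.mono (Nat.zero_le _))).const_mul (P.R * P.T₀)).congr
      (Eventually.of_forall fun z => by ring)
  simp only [energy, energyTr, energyRot, energyVib, ← add_div]
  congr 1
  simp only [bracket, add_mul]
  rw [integral_add ((integrable_norm_sq hI).fun_add ir) iv,
    integral_add (integrable_norm_sq hI) ir]

omit hI

theorem eTr_tempTr : 3 / 2 * (P.R * tempTr P φ) = energyTr φ := by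
  rw [tempTr, ← mul_assoc]; exact eTr_eTrInv P _

theorem relTensor_apply (i j : Fin 3) : relTensor P φ i j
    = (if i = j then P.R * relTempTr P φ else 0)
      + (P.Pr - 1) / P.Pr * (Theta φ i j - if i = j then P.R * tempTr P φ else 0) := by
  simp [relTensor, Matrix.one_apply]

theorem mul_tempRot : P.R * tempRot P φ = energyRot φ := by
  rw [tempRot, ← eRot_eq, eRot_eRotInv]

theorem relEnergyRot_eq : relEnergyRot P φ
    = energyRot φ + thetaRot P φ * (P.R * tempTr P φ - energyRot φ) := by
  simp only [relEnergyRot, eRot_eq, mul_tempRot]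

variable (hv : 0 ≤ energyVib P φ)

include hv in
theorem relEnergyVib_eq : relEnergyVib P φ
    = energyVib P φ + thetaVib P φ * (eVib P (tempTr P φ) - energyVib P φ) := by
  simp only [relEnergyVib, tempVib, eVib_eVibInv P hv]

include hv in
-- The relaxation takes from the translational energy exactly what it gives to the internal modes.
-- This is the source of energy conservation.
theorem relTempTr_eq : 3 / 2 * (P.R * relTempTr P φ) = energyTr φ
    - (relEnergyRot P φ - energyRot φ) - (relEnergyVib P φ - energyVib P φ) := by
  rw [relTempTr, ← mul_assoc]
  refine (eTr_eTrInv P _).trans ?_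
  rw [relEnergyRot_eq, relEnergyVib_eq hv, relEnergyTr, tempVib, eVib_eVibInv P hv, eRot_eq,
    eRot_eq, mul_tempRot, ← eTr_tempTr (P := P), eTr]
  ring

omit hv in
include hI in
-- The tensor Θ - R T_tr I is traceless, so only the isotropic part of Π contributes.
theorem trace_relTensor : ∑ i, relTensor P φ i i = 3 * (P.R * relTempTr P φ) := by
  have h1 := energyTr_eq hI
  have h2 := eTr_tempTr (P := P) (φ := φ)
  simp only [relTensor_apply, if_true, Fin.sum_univ_three] at h1 ⊢
  have : Theta φ 0 0 + Theta φ 1 1 + Theta φ 2 2 = 3 * (P.R * tempTr P φ) := by linarith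
  linear_combination (P.Pr - 1) / P.Pr * this

end Single

/-! ### Families of solutions -/

/-- A uniformly regular family of solutions, with the dominating function `g` exposed. -/
structure SolFamily (P : GasParams) (Kn₀ : ℝ) (U : Set ST) (g : Phase → ℝ)
    (f : ℝ → ℝ → E3 → Phase → ℝ) : Prop extends RegFamily Kn₀ U g f where
  isOpen : IsOpen U
  sol : ∀ κ ∈ Ioo 0 Kn₀, IsSolution P κ U (f κ)
  lower : ∃ m, 0 < m ∧ ∀ κ ∈ Ioo 0 Kn₀, ∀ p ∈ U,
    m ≤ density (f κ p.1 p.2) ∧ m ≤ tempTr P (f κ p.1 p.2)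

theorem exists_solFamily {P : GasParams} {Kn₀ : ℝ} {U : Set ST} {f : ℝ → ℝ → E3 → Phase → ℝ}
    (hU : IsOpen U) (hsol : ∀ κ ∈ Ioo 0 Kn₀, IsSolution P κ U (f κ))
    (hreg : UniformlyRegular P Kn₀ U f) : ∃ g, SolFamily P Kn₀ U g f := by
  obtain ⟨g, hg, hb⟩ := hreg.dominated
  obtain ⟨m, hm, hm'⟩ := hreg.bounded_below
  have hs : ∀ κ ∈ Ioo 0 Kn₀, ∀ p ∈ U, ∀ z : Phase, 0 ≤ z.2.1 →
      ContDiffAt ℝ 2 (fun p : ST => f κ p.1 p.2 z) p := fun κ hκ p hp z hz =>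
    (hreg.smooth κ hκ z hz).contDiffAt (hU.mem_nhds hp)
  refine ⟨g, ⟨⟨hg, ?_, ?_, ?_, ?_, ?_, ?_⟩, hU, hsol, m, hm,
    fun κ hκ p hp => hm' κ hκ p.1 p.2 hp⟩⟩
  · exact fun κ hκ p hp => (hsol κ hκ).measurable p.1 p.2 hp
  · exact fun κ hκ p hp z hz => (hs κ hκ p hp z hz).differentiableAt two_ne_zero
  · exact fun κ hκ p hp z hz => ((hs κ hκ p hp z hz).fderiv_right (m := 1)
      (by rw [one_add_one_eq_two])).differentiableAt one_ne_zero
  · intro κ hκ p hp z hz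
    simpa using hb κ hκ p.1 p.2 hp z hz 0 (by norm_num)
  · intro κ hκ p hp z hz
    simpa [norm_iteratedFDeriv_one] using hb κ hκ p.1 p.2 hp z hz 1 (by norm_num)
  · intro κ hκ p hp z hz
    have := hb κ hκ p.1 p.2 hp z hz 2 le_rfl
    rwa [← norm_iteratedFDeriv_fderiv, norm_iteratedFDeriv_one] at this

/-- The relaxation time along a family. -/
noncomputable def tauFam (P : GasParams) (f : ℝ → ℝ → E3 → Phase → ℝ) (κ : ℝ) (p : ST) : ℝ :=
  tauOf P (f κ p.1 p.2)

namespace SolFamily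

variable {P : GasParams} {Kn₀ : ℝ} {U : Set ST} {g : Phase → ℝ} {f : ℝ → ℝ → E3 → Phase → ℝ}
  (h : SolFamily P Kn₀ U g f) {κ : ℝ} (hκ : κ ∈ Ioo 0 Kn₀) {p : ST} (hp : p ∈ U)

include h hκ hp

theorem density_pos : 0 < density (f κ p.1 p.2) := (h.sol κ hκ).density_pos p.1 p.2 hp

theorem tempTr_pos : 0 < tempTr P (f κ p.1 p.2) := by
  obtain ⟨m, hm, hl⟩ := h.lower
  exact hm.trans_le (hl κ hκ p hp).2

theorem tau_pos : 0 < tauFam P f κ p := by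
  have h1 := h.density_pos hκ hp
  have h2 := h.tempTr_pos hκ hp
  have := P.visc_pos _ h2; have := P.R_pos; have := P.Pr_pos
  unfold tauFam tauOf tau; positivity

theorem integrable {ψ : Phase → ℝ} (hψ : Admissible 0 ψ) :
    Integrable (fun z => ψ z * f κ p.1 p.2 z) phaseMeasure :=
  h.integrable_mul h.isOpen hκ hp hψ

/-- The kinetic equation solved for G[f]; all relations between the moments of f and those of the
Gaussian come from it. -/
theorem gaussian_eq {z : Phase} (hz : 0 ≤ z.2.1) : gaussian P (f κ p.1 p.2) z
    = f κ p.1 p.2 z + κ * tauFam P f κ p * flow f κ p z := by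
  have heq := (h.sol κ hκ).equation p.1 p.2 hp z hz
  have hd := (h.diff κ hκ p hp z hz).hasFDerivAt
  have e : ((1 : ℝ), z.1) = ((1 : ℝ), (0 : E3))
      + ∑ j, z.1 j • ((0 : ℝ), (EuclideanSpace.single j 1 : E3)) := by
    refine Prod.ext (by simp [Prod.fst_sum]) ?_
    ext i
    simp [Prod.snd_sum, Finset.sum_apply, Pi.single_apply]
  have e1 : deriv (fun s => f κ s p.2 z) p.1
      = fderiv ℝ (fun p : ST => f κ p.1 p.2 z) p ((1 : ℝ), (0 : E3)) :=
    (HasFDerivAt.comp_hasDerivAt (l := fun p : ST => f κ p.1 p.2 z) p.1 hd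
      ((hasDerivAt_id' p.1).prodMk (hasDerivAt_const p.1 p.2))).deriv
  have e2 : ∀ j, partialX j (fun y => f κ p.1 y z) p.2
      = fderiv ℝ (fun p : ST => f κ p.1 p.2 z) p (0, EuclideanSpace.single j 1) := fun j => by
    have := (HasFDerivAt.comp (g := fun p : ST => f κ p.1 p.2 z) p.2 hd
      ((hasFDerivAt_const p.1 p.2).prodMk (hasFDerivAt_id (𝕜 := ℝ) p.2))).fderiv
    simp only [Function.comp_def, id] at this
    rw [partialX, this]
    simp
  have hflow : flow f κ p z = 1 / (κ * tauFam P f κ p)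
      * (gaussian P (f κ p.1 p.2) z - f κ p.1 p.2 z) := by
    rw [tauFam, ← heq, e1, flow, e, map_add, map_sum]
    simp only [e2, map_smul, smul_eq_mul]
  have := (h.tau_pos hκ hp).ne'
  have := hκ.1.ne'
  rw [hflow]
  field_simp
  ring

theorem bracket_gaussian {ψ : Phase → ℝ} (hψ : Admissible 1 ψ) :
    bracket (fun z => ψ z * gaussian P (f κ p.1 p.2) z)
      = mom f ψ κ p + κ * tauFam P f κ p * flowMom f ψ κ p := by
  have i1 := h.integrable hκ hp (hψ.mono (Nat.zero_le 1))
  have i2 := (h.integrable_mul_flow h.isOpen hκ hp hψ).const_mul (κ * tauFam P f κ p)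
  have e : bracket (fun z => ψ z * gaussian P (f κ p.1 p.2) z) = bracket (fun z =>
      ψ z * f κ p.1 p.2 z + κ * tauFam P f κ p * (ψ z * flow f κ p z)) :=
    integral_congr_ae (ae_nonneg_energy.mono fun z hz => by
      simp only [h.gaussian_eq hκ hp hz]; ring)
  rw [e, bracket, integral_add i1 i2, integral_const_mul]
  rfl

theorem energyVib_nonneg : 0 ≤ energyVib P (f κ p.1 p.2) := by
  have := P.R_pos; have := P.T₀_pos
  refine div_nonneg (integral_nonneg_of_ae ?_) (h.density_pos hκ hp).le
  filter_upwards [ae_nonneg_energy] with z hz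
  have := (h.sol κ hκ).nonneg p.1 p.2 hp z hz
  simp only [Pi.zero_apply]; positivity

theorem energyRot_nonneg : 0 ≤ energyRot (f κ p.1 p.2) := by
  refine div_nonneg (integral_nonneg_of_ae ?_) (h.density_pos hκ hp).le
  filter_upwards [ae_nonneg_energy] with z hz
  have := (h.sol κ hκ).nonneg p.1 p.2 hp z hz
  simp only [Pi.zero_apply]; positivity

omit h hκ hp in
theorem mom_one : mom f (fun _ => 1) κ p = density (f κ p.1 p.2) := bracket_one _

theorem mom_coord (i : Fin 3) : mom f (fun z => z.1 i) κ p
    = density (f κ p.1 p.2) * velocity (f κ p.1 p.2) i :=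
  bracket_coord (h.density_pos hκ hp) i

theorem mom_two (i j : Fin 3) : mom f (fun z => z.1 i * z.1 j) κ p
    = density (f κ p.1 p.2) * (velocity (f κ p.1 p.2) i * velocity (f κ p.1 p.2) j
      + Theta (f κ p.1 p.2) i j) :=
  bracket_two (fun _ hψ => h.integrable hκ hp hψ) (h.density_pos hκ hp) i j

theorem mom_rot : mom f (fun z => z.2.1) κ p
    = density (f κ p.1 p.2) * energyRot (f κ p.1 p.2) :=
  bracket_rot (h.density_pos hκ hp)

theorem mom_vib : mom f (fun z => (z.2.2 : ℝ)) κ p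
    = density (f κ p.1 p.2) * (energyVib P (f κ p.1 p.2) / (P.R * P.T₀)) :=
  bracket_vib (h.density_pos hκ hp)

theorem kappa_tau_ne : κ * tauFam P f κ p ≠ 0 :=
  mul_ne_zero hκ.1.ne' (h.tau_pos hκ hp).ne'

/-- The Gaussian has the mass of f, so κ τ times the moment of Df is zero, and κ τ ≠ 0. -/
theorem flowMom_one : flowMom f (fun _ => 1) κ p = 0 := by
  have e := h.bracket_gaussian hκ hp (admissible_one.mono (by norm_num))
  have hs := h.sol κ hκ
  have e2 := bracket_tr_gaussian (hs.relEnergyRot_pos _ _ hp) (hs.relEnergyVib_pos _ _ hp)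
    (fun _ => 1)
  simp only [one_mul, integral_gaussTr (hs.relTensor_posDef _ _ hp)] at e2
  simp only [one_mul, e2, mom_one] at e
  have := h.kappa_tau_ne hκ hp
  have : κ * tauFam P f κ p * flowMom f (fun _ => 1) κ p = 0 := by linarith
  simpa [h.kappa_tau_ne hκ hp] using this

theorem flowMom_coord (i : Fin 3) : flowMom f (fun z => z.1 i) κ p = 0 := by
  have e := h.bracket_gaussian hκ hp ((admissible_coord i).mono (by norm_num))
  have hs := h.sol κ hκ
  have e2 := bracket_tr_gaussian (hs.relEnergyRot_pos _ _ hp) (hs.relEnergyVib_pos _ _ hp)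
    (fun v => v i)
  rw [integral_one_gaussTr (hs.relTensor_posDef _ _ hp)] at e2
  rw [e2, h.mom_coord hκ hp] at e
  have : κ * tauFam P f κ p * flowMom f (fun z => z.1 i) κ p = 0 := by linarith
  simpa [h.kappa_tau_ne hκ hp] using this

/-- An exact identity, not an estimate: it converts the boundedness of a moment of Df into Π - Θ =
O(κ). -/
theorem flowMom_two (i j : Fin 3) : κ * tauFam P f κ p * flowMom f (fun z => z.1 i * z.1 j) κ p
    = density (f κ p.1 p.2) * (relTensor P (f κ p.1 p.2) i j - Theta (f κ p.1 p.2) i j) := by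
  have e := h.bracket_gaussian hκ hp ((admissible_coord_two i j).mono (by norm_num))
  have hs := h.sol κ hκ
  have e2 := bracket_tr_gaussian (hs.relEnergyRot_pos _ _ hp) (hs.relEnergyVib_pos _ _ hp)
    (fun v => v i * v j)
  rw [integral_two_gaussTr (hs.relTensor_posDef _ _ hp)] at e2
  rw [e2, h.mom_two hκ hp] at e
  linear_combination -e

theorem flowMom_rot : κ * tauFam P f κ p * flowMom f (fun z => z.2.1) κ p
    = density (f κ p.1 p.2) * (relEnergyRot P (f κ p.1 p.2) - energyRot (f κ p.1 p.2)) := by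
  have e := h.bracket_gaussian hκ hp (admissible_rot.mono (by norm_num))
  have hs := h.sol κ hκ
  have e2 := bracket_rot_gaussian (hs.relEnergyRot_pos _ _ hp) (hs.relEnergyVib_pos _ _ hp)
    (fun _ => 1)
  simp only [one_mul, integral_gaussTr (hs.relTensor_posDef _ _ hp)] at e2
  rw [e2, h.mom_rot hκ hp] at e
  linear_combination -e

theorem flowMom_vib : κ * tauFam P f κ p * (P.R * P.T₀ * flowMom f (fun z => (z.2.2 : ℝ)) κ p)
    = density (f κ p.1 p.2) * (relEnergyVib P (f κ p.1 p.2) - energyVib P (f κ p.1 p.2)) := by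
  have e := h.bracket_gaussian hκ hp (admissible_vib.mono (by norm_num))
  have hs := h.sol κ hκ
  have e2 := bracket_vib_gaussian (hs.relEnergyRot_pos _ _ hp) (hs.relEnergyVib_pos _ _ hp)
    (fun _ => 1)
  simp only [one_mul, integral_gaussTr (hs.relTensor_posDef _ _ hp)] at e2
  rw [e2, h.mom_vib hκ hp] at e
  have hR := P.R_pos.ne'; have hT := P.T₀_pos.ne'
  field_simp at e
  linear_combination -e

/-- Closure of the hierarchy: the third moments of f are those of the Gaussian, which are explicit
in u and Π, up to κ τ times one more moment of Df. -/
theorem mom_three (i k j : Fin 3) : mom f (fun z => z.1 i * z.1 k * z.1 j) κ p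
    = density (f κ p.1 p.2) * (velocity (f κ p.1 p.2) i * velocity (f κ p.1 p.2) k
        * velocity (f κ p.1 p.2) j
        + velocity (f κ p.1 p.2) i * relTensor P (f κ p.1 p.2) k j
        + velocity (f κ p.1 p.2) k * relTensor P (f κ p.1 p.2) i j
        + velocity (f κ p.1 p.2) j * relTensor P (f κ p.1 p.2) i k)
      - κ * tauFam P f κ p * flowMom f (fun z => z.1 i * z.1 k * z.1 j) κ p := by
  have e := h.bracket_gaussian hκ hp ((admissible_coord_two i k).mul_coord j)
  have hs := h.sol κ hκ
  have e2 := bracket_tr_gaussian (hs.relEnergyRot_pos _ _ hp) (hs.relEnergyVib_pos _ _ hp)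
    (fun v => v i * v k * v j)
  rw [integral_three_gaussTr (hs.relTensor_posDef _ _ hp)] at e2
  rw [e2] at e
  linear_combination -e

theorem mom_rot_coord (j : Fin 3) : mom f (fun z => z.2.1 * z.1 j) κ p
    = density (f κ p.1 p.2) * relEnergyRot P (f κ p.1 p.2) * velocity (f κ p.1 p.2) j
      - κ * tauFam P f κ p * flowMom f (fun z => z.2.1 * z.1 j) κ p := by
  have e := h.bracket_gaussian hκ hp (admissible_rot.mul_coord j)
  have hs := h.sol κ hκ
  have e2 := bracket_rot_gaussian (hs.relEnergyRot_pos _ _ hp) (hs.relEnergyVib_pos _ _ hp)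
    (fun v => v j)
  rw [integral_one_gaussTr (hs.relTensor_posDef _ _ hp)] at e2
  simp only [mul_comm (_ : ℝ) (WithLp.ofLp (_ : E3) j)] at e e2 ⊢
  rw [e2] at e
  linear_combination -e

theorem mom_vib_coord (j : Fin 3) : mom f (fun z => (z.2.2 : ℝ) * z.1 j) κ p
    = density (f κ p.1 p.2) * (relEnergyVib P (f κ p.1 p.2) / (P.R * P.T₀))
        * velocity (f κ p.1 p.2) j
      - κ * tauFam P f κ p * flowMom f (fun z => (z.2.2 : ℝ) * z.1 j) κ p := by
  have e := h.bracket_gaussian hκ hp (admissible_vib.mul_coord j)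
  have hs := h.sol κ hκ
  have e2 := bracket_vib_gaussian (hs.relEnergyRot_pos _ _ hp) (hs.relEnergyVib_pos _ _ hp)
    (fun v => v j)
  rw [integral_one_gaussTr (hs.relTensor_posDef _ _ hp)] at e2
  simp only [mul_comm (_ : ℝ) (WithLp.ofLp (_ : E3) j)] at e e2 ⊢
  rw [e2] at e
  linear_combination -e

/-- Half the trace of Π - Θ is the translational energy change, which cancels the two internal gains
by `relTempTr_eq`. -/
theorem flowMom_energy : 1 / 2 * ∑ i, flowMom f (fun z => z.1 i * z.1 i) κ p
    + flowMom f (fun z => z.2.1) κ p + P.R * P.T₀ * flowMom f (fun z => (z.2.2 : ℝ)) κ p = 0 := by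
  have h1 := fun i => h.flowMom_two hκ hp i i
  have h2 := h.flowMom_rot hκ hp
  have h3 := h.flowMom_vib hκ hp
  have hI : ∀ ψ, Admissible 0 ψ → Integrable (fun z => ψ z * f κ p.1 p.2 z) phaseMeasure :=
    fun ψ hψ => h.integrable hκ hp hψ
  have hv := h.energyVib_nonneg hκ hp
  have h4 := trace_relTensor (P := P) hI
  have h5 := relTempTr_eq hv
  have h6 := energyTr_eq hI
  refine (mul_eq_zero.1 ?_).resolve_left (h.kappa_tau_ne hκ hp)
  have h10 := h1 0; have h11 := h1 1; have h12 := h1 2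
  simp only [Fin.sum_univ_three] at h4 h6 ⊢
  linear_combination 1 / 2 * (h10 + h11 + h12) + h2 + h3
    + density (f κ p.1 p.2) * (1 / 2 * h4 + h5 + h6)

end SolFamily

/-! ### Macroscopic fields of a family -/

section Fields

variable (P : GasParams) (f : ℝ → ℝ → E3 → Phase → ℝ)

/-- Density field. -/
noncomputable def rhoF (κ : ℝ) (p : ST) : ℝ := density (f κ p.1 p.2)
/-- Velocity components. -/
noncomputable def velF (i : Fin 3) (κ : ℝ) (p : ST) : ℝ := velocity (f κ p.1 p.2) i
/-- Components of `Θ`. -/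
noncomputable def thF (i j : Fin 3) (κ : ℝ) (p : ST) : ℝ := Theta (f κ p.1 p.2) i j
/-- Components of `Π`. -/
noncomputable def piF (i j : Fin 3) (κ : ℝ) (p : ST) : ℝ := relTensor P (f κ p.1 p.2) i j
/-- Rotational energy. -/
noncomputable def rotF (κ : ℝ) (p : ST) : ℝ := energyRot (f κ p.1 p.2)
/-- Vibrational energy. -/
noncomputable def vibF (κ : ℝ) (p : ST) : ℝ := energyVib P (f κ p.1 p.2)
/-- Relaxation rotational energy. -/
noncomputable def relRotF (κ : ℝ) (p : ST) : ℝ := relEnergyRot P (f κ p.1 p.2)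
/-- Relaxation vibrational energy. -/
noncomputable def relVibF (κ : ℝ) (p : ST) : ℝ := relEnergyVib P (f κ p.1 p.2)
/-- Total energy. -/
noncomputable def enF (κ : ℝ) (p : ST) : ℝ := energy P (f κ p.1 p.2)
/-- Translational temperature. -/
noncomputable def trF (κ : ℝ) (p : ST) : ℝ := tempTr P (f κ p.1 p.2)
/-- Equilibrium temperature. -/
noncomputable def eqF (κ : ℝ) (p : ST) : ℝ := tempEq P (f κ p.1 p.2)
/-- `R T_eq`. -/
noncomputable def reqF (κ : ℝ) (p : ST) : ℝ := P.R * tempEq P (f κ p.1 p.2)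

end Fields

theorem UnifPos.pos {l : Filter ℝ} {U : Set ST} {a : ℝ → ST → ℝ} (ha : UnifPos l U a) :
    ∀ᶠ q in l ×ˢ 𝓟 U, 0 < a q.1 q.2 := by
  obtain ⟨m, hm, h⟩ := ha
  exact h.mono fun q hq => hm.trans_le hq

theorem UnifPos.const_mul {l : Filter ℝ} {U : Set ST} {a : ℝ → ST → ℝ} (ha : UnifPos l U a)
    {r : ℝ} (hr : 0 < r) : UnifPos l U (fun κ p => r * a κ p) := by
  obtain ⟨m, hm, h⟩ := ha
  exact ⟨r * m, by positivity, h.mono fun q hq => mul_le_mul_of_nonneg_left hq hr.le⟩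

namespace SolFamily

variable {P : GasParams} {Kn₀ : ℝ} {U : Set ST} {g : Phase → ℝ} {f : ℝ → ℝ → E3 → Phase → ℝ}
  (h : SolFamily P Kn₀ U g f) {l : Filter ℝ} (hl : ∀ᶠ κ in l, κ ∈ Ioo 0 Kn₀)

include hl in
omit h in
theorem eventually_mem : ∀ᶠ q : ℝ × ST in l ×ˢ 𝓟 U, q.1 ∈ Ioo 0 Kn₀ ∧ q.2 ∈ U := by
  rw [eventually_prod_principal_iff]
  exact hl.mono fun κ hκ p hp => ⟨hκ, hp⟩

include h hl

theorem smallC1_congr {k : ℕ} {a b : ℝ → ST → ℝ} (ha : SmallC1 l U k a)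
    (hab : ∀ κ ∈ Ioo 0 Kn₀, ∀ p ∈ U, a κ p = b κ p) : SmallC1 l U k b :=
  ha.congr h.isOpen (hl.mono fun κ hκ p hp => hab κ hκ p hp)

omit h in
theorem smallC1_mono {j k : ℕ} {a : ℝ → ST → ℝ} (hjk : j ≤ k) (ha : SmallC1 l U k a) :
    SmallC1 l U j a :=
  ha.mono (r := Kn₀) (hl.mono fun _ h => ⟨h.1, h.2.le⟩) hjk

theorem smallC1_rho : SmallC1 l U 0 (rhoF f) :=
  h.smallC1_congr hl (h.smallC1_mom hl h.isOpen (admissible_one.mono (Nat.zero_le _)))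
    fun _ _ _ _ => mom_one

theorem unifPos_rho : UnifPos l U (rhoF f) := by
  obtain ⟨m, hm, hl'⟩ := h.lower
  exact ⟨m, hm, (eventually_mem hl).mono fun q hq => (hl' q.1 hq.1 q.2 hq.2).1⟩

theorem unifPos_tr : UnifPos l U (trF P f) := by
  obtain ⟨m, hm, hl'⟩ := h.lower
  exact ⟨m, hm, (eventually_mem hl).mono fun q hq => (hl' q.1 hq.1 q.2 hq.2).2⟩

theorem smallC1_div_rho {k : ℕ} {a b : ℝ → ST → ℝ} (ha : SmallC1 l U k a)
    (hab : ∀ κ ∈ Ioo 0 Kn₀, ∀ p ∈ U, a κ p = rhoF f κ p * b κ p) : SmallC1 l U k b :=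
  h.smallC1_congr hl (ha.div (h.smallC1_rho hl) (h.unifPos_rho hl)) fun κ hκ p hp => by
    have : rhoF f κ p ≠ 0 := (h.density_pos hκ hp).ne'
    rw [hab κ hκ p hp, mul_div_cancel_left₀ _ this]

theorem smallC1_vel (i : Fin 3) : SmallC1 l U 0 (velF f i) :=
  h.smallC1_div_rho hl (h.smallC1_mom hl h.isOpen ((admissible_coord i).mono (Nat.zero_le _)))
    fun _ hκ _ hp => h.mom_coord hκ hp i

theorem smallC1_th (i j : Fin 3) : SmallC1 l U 0 (thF f i j) := by
  have h1 : SmallC1 l U 0 (fun κ p => velF f i κ p * velF f j κ p + thF f i j κ p) :=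
    h.smallC1_div_rho hl (h.smallC1_mom hl h.isOpen
      ((admissible_coord_two i j).mono (Nat.zero_le _))) fun _ hκ _ hp => h.mom_two hκ hp i j
  exact h.smallC1_congr hl (h1.sub ((h.smallC1_vel hl i).mul (h.smallC1_vel hl j)))
    fun _ _ _ _ => by ring

theorem smallC1_rot : SmallC1 l U 0 (rotF f) :=
  h.smallC1_div_rho hl (h.smallC1_mom hl h.isOpen (admissible_rot.mono (Nat.zero_le _)))
    fun _ hκ _ hp => h.mom_rot hκ hp

theorem smallC1_vib : SmallC1 l U 0 (vibF P f) := by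
  have hR := P.R_pos.ne'; have hT := P.T₀_pos.ne'
  refine h.smallC1_div_rho hl ((h.smallC1_mom hl h.isOpen
    (admissible_vib.mono (Nat.zero_le _))).const_mul (P.R * P.T₀)) fun _ hκ _ hp => ?_
  rw [h.mom_vib hκ hp, rhoF, vibF]
  field_simp

omit hl in
theorem trF_eq {κ : ℝ} (hκ : κ ∈ Ioo 0 Kn₀) {p : ST} (hp : p ∈ U) :
    P.R * trF P f κ p = 1 / 3 * ∑ i, thF f i i κ p := by
  have h1 := energyTr_eq fun ψ (hψ : Admissible 0 ψ) => h.integrable hκ hp hψ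
  have h2 := eTr_tempTr (P := P) (φ := f κ p.1 p.2)
  simp only [trF, thF]
  linarith

theorem smallC1_tr : SmallC1 l U 0 (trF P f) := by
  refine h.smallC1_congr hl ((SmallC1.sum Finset.univ fun i _ => h.smallC1_th hl i i).const_mul
    (1 / 3 * P.R⁻¹)) fun κ hκ p hp => ?_
  have := h.trF_eq hκ hp
  have hR := P.R_pos.ne'
  field_simp
  linarith

omit hl in
theorem enF_eq {κ : ℝ} (hκ : κ ∈ Ioo 0 Kn₀) {p : ST} (hp : p ∈ U) :
    enF P f κ p = 3 / 2 * (P.R * trF P f κ p) + rotF f κ p + vibF P f κ p := by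
  rw [enF, energy_eq fun ψ (hψ : Admissible 0 ψ) => h.integrable hκ hp hψ, trF, eTr_tempTr]
  rfl

theorem smallC1_en : SmallC1 l U 0 (enF P f) :=
  h.smallC1_congr hl (((((h.smallC1_tr hl).const_mul P.R).const_mul (3 / 2)).add
    (h.smallC1_rot hl)).add (h.smallC1_vib hl)) fun _ hκ _ hp => (h.enF_eq hκ hp).symm

omit hl in
-- The internal energies are nonnegative because f is, so the lower bound on T_tr passes to the
-- total energy.
theorem le_enF {κ : ℝ} (hκ : κ ∈ Ioo 0 Kn₀) {p : ST} (hp : p ∈ U) :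
    3 / 2 * P.R * trF P f κ p ≤ enF P f κ p := by
  have h1 := h.energyRot_nonneg hκ hp
  have h2 := h.energyVib_nonneg hκ hp
  rw [h.enF_eq hκ hp, rotF, vibF]
  linarith

omit hl in
theorem enF_pos {κ : ℝ} (hκ : κ ∈ Ioo 0 Kn₀) {p : ST} (hp : p ∈ U) : 0 < enF P f κ p := by
  have h1 : 0 < trF P f κ p := h.tempTr_pos hκ hp
  have h2 := h.le_enF hκ hp
  have := P.R_pos
  have : 0 < 3 / 2 * P.R * trF P f κ p := by positivity
  linarith

theorem unifPos_en : UnifPos l U (enF P f) := by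
  have hR := P.R_pos
  obtain ⟨m, hm, h'⟩ := (h.unifPos_tr hl).const_mul (r := 3 / 2 * P.R) (by positivity)
  refine ⟨m, hm, ?_⟩
  filter_upwards [h', eventually_mem hl] with q hq hq'
  exact hq.trans (h.le_enF hq'.1 hq'.2)

theorem smallC1_eq : SmallC1 l U 0 (eqF P f) :=
  (h.smallC1_en hl).comp (Φ := eTotInv P) ((contDiffOn_eTotInv P).of_le (by norm_num))
    (h.unifPos_en hl)

omit hl in
theorem eqF_pos {κ : ℝ} (hκ : κ ∈ Ioo 0 Kn₀) {p : ST} (hp : p ∈ U) : 0 < eqF P f κ p :=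
  eTotInv_pos P (h.enF_pos hκ hp)

theorem unifPos_eq : UnifPos l U (eqF P f) := by
  have hR := P.R_pos
  obtain ⟨m, hm, h'⟩ := h.unifPos_en hl
  refine ⟨2 * m / (7 * P.R), by positivity, ?_⟩
  filter_upwards [h', eventually_mem hl] with q hq hq'
  refine le_trans ?_ (le_eTotInv P (h.enF_pos hq'.1 hq'.2))
  change _ ≤ 2 * enF P f q.1 q.2 / _
  gcongr

theorem smallC1_req : SmallC1 l U 0 (reqF P f) := (h.smallC1_eq hl).const_mul P.R

theorem unifPos_req : UnifPos l U (reqF P f) := (h.unifPos_eq hl).const_mul P.R_pos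

/-! Relaxation: distances to equilibrium. -/

theorem smallC1_tauC : SmallC1 l U 0 (fun κ p => P.tauC (rhoF f κ p) (trF P f κ p)) :=
  SmallC1.comp_pair P.tauC_smooth (h.smallC1_rho hl) (h.smallC1_tr hl) (h.unifPos_rho hl)
    (h.unifPos_tr hl)

theorem smallC1_tau : SmallC1 l U 0 (tauFam P f) := by
  have hpos : UnifPos l U (fun κ p => rhoF f κ p * P.R * trF P f κ p * P.Pr) := by
    obtain ⟨m, hm, h1⟩ := h.unifPos_rho hl
    obtain ⟨m', hm', h2⟩ := h.unifPos_tr hl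
    have := P.R_pos; have := P.Pr_pos
    refine ⟨m * P.R * m' * P.Pr, by positivity, ?_⟩
    filter_upwards [h1, h2] with q h1 h2
    have := hm.le.trans h1
    gcongr
  have hd : SmallC1 l U 0 (fun κ p => rhoF f κ p * P.R * trF P f κ p * P.Pr) :=
    h.smallC1_congr hl (((h.smallC1_rho hl).mul (h.smallC1_tr hl)).const_mul (P.R * P.Pr))
      fun κ hκ p hp => by ring
  exact ((h.smallC1_tr hl).comp P.visc_smooth (h.unifPos_tr hl)).div hd hpos

omit hl in
/-- The difference `R T_tr - E_rot` is driven by the transport derivative. -/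
theorem rot_relax {κ : ℝ}
    (hκ : κ ∈ Ioo 0 Kn₀) {p : ST} (hp : p ∈ U) :
    P.R * trF P f κ p - rotF f κ p = κ * (P.Zrot (trF P f κ p)
      * P.tauC (rhoF f κ p) (trF P f κ p) * flowMom f (fun z => z.2.1) κ p / rhoF f κ p) := by
  have e := h.flowMom_rot hκ hp
  have hρ := h.density_pos hκ hp
  have hT := h.tempTr_pos hκ hp
  have hZ := P.Zrot_pos _ hT
  have hC := P.tauC_pos _ _ hρ hT
  have hτ := h.tau_pos hκ hp
  -- The factor τ of θ_rot = τ / (Z_rot τ_C) cancels the one in κ τ and leaves κ Z_rot τ_C.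
  rw [relEnergyRot_eq, add_sub_cancel_left, thetaRot] at e
  change _ = _ * (tauFam P f κ p / _ * _) at e
  simp only [trF, rhoF, rotF]
  generalize flowMom f (fun z => z.2.1) κ p = n at *
  generalize tauFam P f κ p = τ at *
  field_simp at e ⊢
  linear_combination -e

omit hl in
theorem vib_relax {κ : ℝ}
    (hκ : κ ∈ Ioo 0 Kn₀) {p : ST} (hp : p ∈ U) :
    eVib P (trF P f κ p) - vibF P f κ p = κ * (P.Zvib (trF P f κ p)
      * P.tauC (rhoF f κ p) (trF P f κ p) * (P.R * P.T₀ * flowMom f (fun z => (z.2.2 : ℝ)) κ p)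
        / rhoF f κ p) := by
  have e := h.flowMom_vib hκ hp
  have hρ := h.density_pos hκ hp
  have hT := h.tempTr_pos hκ hp
  have hZ := P.Zvib_pos _ hT
  have hC := P.tauC_pos _ _ hρ hT
  have hτ := h.tau_pos hκ hp
  rw [relEnergyVib_eq (h.energyVib_nonneg hκ hp), add_sub_cancel_left, thetaVib] at e
  change _ = _ * (tauFam P f κ p / _ * _) at e
  simp only [trF, rhoF, vibF]
  generalize P.R * P.T₀ * flowMom f (fun z => (z.2.2 : ℝ)) κ p = n at *
  generalize tauFam P f κ p = τ at *
  field_simp at e ⊢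
  linear_combination -e

theorem smallC1_rot_relax : SmallC1 l U 1 (fun κ p => P.R * trF P f κ p - rotF f κ p) := by
  have h1 := ((((h.smallC1_tr hl).comp P.Zrot_smooth (h.unifPos_tr hl)).mul
    (h.smallC1_tauC hl)).mul (h.smallC1_flowMom hl h.isOpen
      (admissible_rot.mono (by norm_num)))).div (h.smallC1_rho hl) (h.unifPos_rho hl)
  exact h.smallC1_congr hl (SmallC1.param.mul h1) fun κ hκ p hp => (h.rot_relax hκ hp).symm

theorem smallC1_vib_relax :
    SmallC1 l U 1 (fun κ p => eVib P (trF P f κ p) - vibF P f κ p) := by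
  have h1 := ((((h.smallC1_tr hl).comp P.Zvib_smooth (h.unifPos_tr hl)).mul
    (h.smallC1_tauC hl)).mul ((h.smallC1_flowMom hl h.isOpen
      (admissible_vib.mono (by norm_num))).const_mul (P.R * P.T₀))).div
      (h.smallC1_rho hl) (h.unifPos_rho hl)
  exact h.smallC1_congr hl (SmallC1.param.mul h1) fun κ hκ p hp => (h.vib_relax hκ hp).symm

omit hl in
theorem eTot_tr_sub_en {κ : ℝ} (hκ : κ ∈ Ioo 0 Kn₀) {p : ST} (hp : p ∈ U) :
    eTot P (trF P f κ p) - enF P f κ p = (P.R * trF P f κ p - rotF f κ p)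
      + (eVib P (trF P f κ p) - vibF P f κ p) := by
  rw [eTot_eq, h.enF_eq hκ hp]; ring

theorem smallC1_eTot_tr_sub_en :
    SmallC1 l U 1 (fun κ p => eTot P (trF P f κ p) - enF P f κ p) :=
  h.smallC1_congr hl ((h.smallC1_rot_relax hl).add (h.smallC1_vib_relax hl))
    fun _ hκ _ hp => (h.eTot_tr_sub_en hκ hp).symm

theorem smallC1_eTot_tr : SmallC1 l U 0 (fun κ p => eTot P (trF P f κ p)) :=
  (h.smallC1_tr hl).comp ((contDiffOn_eTot P).of_le (by norm_num)) (h.unifPos_tr hl)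

theorem unifPos_eTot_tr : UnifPos l U (fun κ p => eTot P (trF P f κ p)) := by
  have hR := P.R_pos
  obtain ⟨m, hm, h'⟩ := (h.unifPos_tr hl).const_mul (r := 5 / 2 * P.R) (by positivity)
  refine ⟨m, hm, ?_⟩
  filter_upwards [h', eventually_mem hl] with q hq hq'
  have := eVib_pos P (h.tempTr_pos hq'.1 hq'.2)
  rw [eTot_eq, trF] at *
  linarith

/-- The energy of equilibrium at T_tr exceeds the actual energy by the two internal defects, which
are O(κ) with their derivatives; the inverse of the total energy is C² and preserves this. -/
theorem smallC1_tr_sub_eq : SmallC1 l U 1 (fun κ p => trF P f κ p - eqF P f κ p) := by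
  refine h.smallC1_congr hl (SmallC1.comp_sub (contDiffOn_eTotInv P) (h.smallC1_eTot_tr hl)
    (h.smallC1_en hl) (h.unifPos_eTot_tr hl) (h.unifPos_en hl) (h.smallC1_eTot_tr_sub_en hl))
    fun κ hκ p hp => ?_
  rw [eTotInv_eTot P (show 0 < trF P f κ p from h.tempTr_pos hκ hp)]
  rfl

theorem smallC1_pi_sub_th (i j : Fin 3) :
    SmallC1 l U 1 (fun κ p => piF P f i j κ p - thF f i j κ p) := by
  refine h.smallC1_div_rho hl ((SmallC1.param.mul (h.smallC1_tau hl)).mul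
    (h.smallC1_flowMom hl h.isOpen ((admissible_coord_two i j).mono (by norm_num))))
    fun κ hκ p hp => h.flowMom_two hκ hp i j

theorem smallC1_relRot_sub_rot : SmallC1 l U 1 (fun κ p => relRotF P f κ p - rotF f κ p) :=
  h.smallC1_div_rho hl ((SmallC1.param.mul (h.smallC1_tau hl)).mul
    (h.smallC1_flowMom hl h.isOpen (admissible_rot.mono (by norm_num))))
    fun κ hκ p hp => h.flowMom_rot hκ hp

theorem smallC1_relVib_sub_vib : SmallC1 l U 1 (fun κ p => relVibF P f κ p - vibF P f κ p) :=
  h.smallC1_div_rho hl ((SmallC1.param.mul (h.smallC1_tau hl)).mul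
    ((h.smallC1_flowMom hl h.isOpen (admissible_vib.mono (by norm_num))).const_mul (P.R * P.T₀)))
    fun κ hκ p hp => h.flowMom_vib hκ hp

omit hl in
/-- The deviatoric part of `Π - Θ` determines that of `Θ`. -/
theorem th_sub_eq {κ : ℝ} (hκ : κ ∈ Ioo 0 Kn₀) {p : ST} (hp : p ∈ U) (i j : Fin 3) :
    thF f i j κ p - (if i = j then P.R * trF P f κ p else 0)
      = P.Pr * ((if i = j then 1 / 3 * ∑ k, (piF P f k k κ p - thF f k k κ p) else 0)
        - (piF P f i j κ p - thF f i j κ p)) := by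
  have h1 := trace_relTensor (P := P) fun ψ (hψ : Admissible 0 ψ) => h.integrable hκ hp hψ
  have h2 := h.trF_eq hκ hp
  have hPr := P.Pr_pos.ne'
  -- Subtracting from Π - Θ a third of this trace times I leaves -(1 / Pr) (Θ - R T_tr I).
  have h4 : ∑ k, (piF P f k k κ p - thF f k k κ p)
      = 3 * (P.R * relTempTr P (f κ p.1 p.2)) - 3 * (P.R * trF P f κ p) := by
    rw [Finset.sum_sub_distrib, h2, ← h1]; simp only [piF]; ring
  rw [h4]
  simp only [piF, relTensor_apply, thF, trF]
  split_ifs <;> field_simp <;> ring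

theorem smallC1_th_sub_tr (i j : Fin 3) :
    SmallC1 l U 1 (fun κ p => thF f i j κ p - (if i = j then P.R * trF P f κ p else 0)) := by
  have h1 := (SmallC1.sum Finset.univ fun k _ => h.smallC1_pi_sub_th hl k k).const_mul (1 / 3)
  have h0 : SmallC1 l U 1 (fun κ p => if i = j then
      1 / 3 * ∑ k, (piF P f k k κ p - thF f k k κ p) else 0) := by
    by_cases hij : i = j
    · simpa [hij] using h1
    -- The zero family, obtained as an empty sum, is O(κ).
    · simpa [hij] using SmallC1.sum (l := l) (U := U) (k := 1) (∅ : Finset (Fin 3))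
        (A := fun _ _ _ => 0) (by simp)
  exact h.smallC1_congr hl ((h0.sub (h.smallC1_pi_sub_th hl i j)).const_mul P.Pr)
    fun κ hκ p hp => (h.th_sub_eq hκ hp i j).symm

theorem smallC1_th_sub_req (i j : Fin 3) :
    SmallC1 l U 1 (fun κ p => thF f i j κ p - (if i = j then reqF P f κ p else 0)) := by
  have h0 : SmallC1 l U 1 (fun κ p => if i = j then
      P.R * (trF P f κ p - eqF P f κ p) else 0) := by
    by_cases hij : i = j
    · simpa [hij] using (h.smallC1_tr_sub_eq hl).const_mul P.R
    · simpa [hij] using SmallC1.sum (l := l) (U := U) (k := 1) (∅ : Finset (Fin 3))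
        (A := fun _ _ _ => 0) (by simp)
  refine h.smallC1_congr hl ((h.smallC1_th_sub_tr hl i j).add h0) fun κ hκ p hp => ?_
  simp only [reqF, eqF]
  split_ifs <;> ring

theorem smallC1_pi_sub_req (i j : Fin 3) :
    SmallC1 l U 1 (fun κ p => piF P f i j κ p - (if i = j then reqF P f κ p else 0)) :=
  h.smallC1_congr hl ((h.smallC1_pi_sub_th hl i j).add (h.smallC1_th_sub_req hl i j))
    fun κ hκ p hp => by ring

theorem smallC1_rot_sub_req : SmallC1 l U 1 (fun κ p => rotF f κ p - reqF P f κ p) :=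
  h.smallC1_congr hl (((h.smallC1_tr_sub_eq hl).const_mul P.R).sub (h.smallC1_rot_relax hl))
    fun κ hκ p hp => by simp only [reqF, eqF]; ring

theorem smallC1_relRot_sub_req : SmallC1 l U 1 (fun κ p => relRotF P f κ p - reqF P f κ p) :=
  h.smallC1_congr hl ((h.smallC1_relRot_sub_rot hl).add (h.smallC1_rot_sub_req hl))
    fun κ hκ p hp => by ring

theorem smallC1_eVib_sub :
    SmallC1 l U 1 (fun κ p => eVib P (trF P f κ p) - eVib P (eqF P f κ p)) :=
  SmallC1.comp_sub (contDiffOn_eVib P) (h.smallC1_tr hl) (h.smallC1_eq hl) (h.unifPos_tr hl)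
    (h.unifPos_eq hl) (h.smallC1_tr_sub_eq hl)

theorem smallC1_vib_sub_eq : SmallC1 l U 1 (fun κ p => vibF P f κ p - eVib P (eqF P f κ p)) :=
  h.smallC1_congr hl ((h.smallC1_eVib_sub hl).sub (h.smallC1_vib_relax hl))
    fun κ hκ p hp => by ring

theorem smallC1_relVib_sub_eq :
    SmallC1 l U 1 (fun κ p => relVibF P f κ p - eVib P (eqF P f κ p)) :=
  h.smallC1_congr hl ((h.smallC1_relVib_sub_vib hl).add (h.smallC1_vib_sub_eq hl))
    fun κ hκ p hp => by ring

end SolFamily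

/-! ### Leading-order transport equations -/

/-- `a` and `b` are bounded and differ by `O(κ)`, uniformly on `U`. -/
structure Approx (l : Filter ℝ) (U : Set ST) (a b : ℝ → ST → ℝ) : Prop where
  left : (fun q : ℝ × ST => a q.1 q.2) =O[l ×ˢ 𝓟 U] fun _ => (1 : ℝ)
  right : (fun q : ℝ × ST => b q.1 q.2) =O[l ×ˢ 𝓟 U] fun _ => (1 : ℝ)
  sub : (fun q : ℝ × ST => a q.1 q.2 - b q.1 q.2) =O[l ×ˢ 𝓟 U] fun q => q.1

section Approx

variable {l : Filter ℝ} {U : Set ST} {a a' b b' c : ℝ → ST → ℝ}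

theorem SmallC1.bdd (ha : SmallC1 l U 0 a) :
    (fun q : ℝ × ST => a q.1 q.2) =O[l ×ˢ 𝓟 U] fun _ => (1 : ℝ) := by
  simpa using ha.val

theorem SmallC1.val_one (ha : SmallC1 l U 1 a) :
    (fun q : ℝ × ST => a q.1 q.2) =O[l ×ˢ 𝓟 U] fun q => q.1 := by
  simpa using ha.val

theorem SmallC1.der_apply {k : ℕ} (ha : SmallC1 l U k a) (w : ST) :
    (fun q : ℝ × ST => fderiv ℝ (a q.1) q.2 w) =O[l ×ˢ 𝓟 U] fun q => q.1 ^ k := by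
  refine IsBigO.trans (IsBigO.of_bound ‖w‖ (Eventually.of_forall fun q => ?_)) ha.der
  rw [mul_comm]
  exact ContinuousLinearMap.le_opNorm _ _

theorem Approx.refl (ha : (fun q : ℝ × ST => a q.1 q.2) =O[l ×ˢ 𝓟 U] fun _ => (1 : ℝ)) :
    Approx l U a a := ⟨ha, ha, by simpa using isBigO_zero _ _⟩

theorem Approx.symm (h : Approx l U a b) : Approx l U b a :=
  ⟨h.right, h.left, h.sub.symm⟩

theorem Approx.trans (h : Approx l U a b) (h' : Approx l U b c) : Approx l U a c :=
  ⟨h.left, h'.right, (h.sub.add h'.sub).congr_left fun q => by ring⟩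

theorem Approx.const (r : ℝ) : Approx l U (fun _ _ => r) (fun _ _ => r) :=
  Approx.refl (isBigO_const_const r one_ne_zero _)

theorem Approx.add (h : Approx l U a b) (h' : Approx l U a' b') :
    Approx l U (fun κ p => a κ p + a' κ p) (fun κ p => b κ p + b' κ p) :=
  ⟨h.left.add h'.left, h.right.add h'.right, (h.sub.add h'.sub).congr_left fun q => by ring⟩

theorem Approx.mul (h : Approx l U a b) (h' : Approx l U a' b') :
    Approx l U (fun κ p => a κ p * a' κ p) (fun κ p => b κ p * b' κ p) := by
  refine ⟨by simpa using h.left.mul h'.left, by simpa using h.right.mul h'.right, ?_⟩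
  have h1 : (fun q : ℝ × ST => (a q.1 q.2 - b q.1 q.2) * a' q.1 q.2)
      =O[l ×ˢ 𝓟 U] fun q => q.1 := by simpa using h.sub.mul h'.left
  have h2 : (fun q : ℝ × ST => b q.1 q.2 * (a' q.1 q.2 - b' q.1 q.2))
      =O[l ×ˢ 𝓟 U] fun q => q.1 := by simpa using h.right.mul h'.sub
  exact (h1.add h2).congr_left fun q => by ring

theorem Approx.const_mul (r : ℝ) (h : Approx l U a b) :
    Approx l U (fun κ p => r * a κ p) (fun κ p => r * b κ p) := (Approx.const r).mul h

theorem Approx.neg (h : Approx l U a b) :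
    Approx l U (fun κ p => - a κ p) (fun κ p => - b κ p) := by simpa using h.const_mul (-1)

theorem Approx.sub' (h : Approx l U a b) (h' : Approx l U a' b') :
    Approx l U (fun κ p => a κ p - a' κ p) (fun κ p => b κ p - b' κ p) := by
  simpa [sub_eq_add_neg] using h.add h'.neg

theorem Approx.sum {ι : Type*} (s : Finset ι) {A B : ι → ℝ → ST → ℝ}
    (h : ∀ i ∈ s, Approx l U (A i) (B i)) :
    Approx l U (fun κ p => ∑ i ∈ s, A i κ p) (fun κ p => ∑ i ∈ s, B i κ p) := by
  classical
  induction s using Finset.induction_on with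
  | empty => simpa using Approx.const (l := l) (U := U) 0
  | insert i s hi ih =>
    simp only [Finset.sum_insert hi]
    exact (h i (by simp)).add (ih fun i' hi' => h i' (by simp [hi']))

theorem Approx.congr (h : Approx l U a b) (ha : ∀ᶠ q in l ×ˢ 𝓟 U, a q.1 q.2 = a' q.1 q.2)
    (hb : ∀ᶠ q in l ×ˢ 𝓟 U, b q.1 q.2 = b' q.1 q.2) : Approx l U a' b' :=
  ⟨h.left.congr' ha EventuallyEq.rfl, h.right.congr' hb EventuallyEq.rfl,
    h.sub.congr' ((ha.and hb).mono fun q hq => by simp only [hq.1, hq.2]) EventuallyEq.rfl⟩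

theorem Approx.der_apply (ha : SmallC1 l U 0 a) (hb : SmallC1 l U 0 b)
    (hab : SmallC1 l U 1 (fun κ p => a κ p - b κ p)) (w : ST) :
    Approx l U (fun κ p => fderiv ℝ (a κ) p w) (fun κ p => fderiv ℝ (b κ) p w) := by
  refine ⟨by simpa using ha.der_apply w, by simpa using hb.der_apply w, ?_⟩
  have h1 := hab.der_apply w
  simp only [pow_one] at h1
  refine h1.congr' ?_ EventuallyEq.rfl
  filter_upwards [ha.diff, hb.diff] with q h1 h2
  rw [fderiv_fun_sub h1 h2]; rfl

/-- Multiplying an `O(1)` approximation by `κ` gives an `O(κ²)` error. -/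
theorem Approx.kappa_mul (h : Approx l U a b) :
    (fun q : ℝ × ST => q.1 * a q.1 q.2 - q.1 * b q.1 q.2) =O[l ×ˢ 𝓟 U] fun q => q.1 ^ 2 := by
  have := (isBigO_refl (fun q : ℝ × ST => q.1) (l ×ˢ 𝓟 U)).mul h.sub
  exact (this.congr_left fun q => by ring).congr_right fun q => by ring

end Approx

/-- The time direction. -/
def dirT : ST := (1, 0)

/-- The space directions. -/
noncomputable def dirX (j : Fin 3) : ST := (0, EuclideanSpace.single j 1)

/-- The convective derivative of a family of fields. -/
noncomputable def convF (f : ℝ → ℝ → E3 → Phase → ℝ) (a : ℝ → ST → ℝ) (κ : ℝ) (p : ST) : ℝ :=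
  fderiv ℝ (a κ) p dirT + ∑ j, velF f j κ p * fderiv ℝ (a κ) p (dirX j)

/-- The divergence of the velocity field. -/
noncomputable def divF (f : ℝ → ℝ → E3 → Phase → ℝ) (κ : ℝ) (p : ST) : ℝ :=
  ∑ j, fderiv ℝ (velF f j κ) p (dirX j)

theorem fderiv_mul_apply {a b : ST → ℝ} {p : ST} (ha : DifferentiableAt ℝ a p)
    (hb : DifferentiableAt ℝ b p) (w : ST) :
    fderiv ℝ (fun p => a p * b p) p w = a p * fderiv ℝ b p w + b p * fderiv ℝ a p w := by
  rw [fderiv_fun_mul ha hb]; simp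

theorem fderiv_add_apply {a b : ST → ℝ} {p : ST} (ha : DifferentiableAt ℝ a p)
    (hb : DifferentiableAt ℝ b p) (w : ST) :
    fderiv ℝ (fun p => a p + b p) p w = fderiv ℝ a p w + fderiv ℝ b p w := by
  rw [fderiv_fun_add ha hb]; rfl

theorem transport_mul {ρ X : ST → ℝ} {u : Fin 3 → ST → ℝ} {p : ST} (hρ : DifferentiableAt ℝ ρ p)
    (hX : DifferentiableAt ℝ X p) (hu : ∀ j, DifferentiableAt ℝ (u j) p)
    (hc : fderiv ℝ ρ p dirT + ∑ j, fderiv ℝ (fun p => ρ p * u j p) p (dirX j) = 0) :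
    fderiv ℝ (fun p => ρ p * X p) p dirT
      + ∑ j, fderiv ℝ (fun p => ρ p * X p * u j p) p (dirX j)
      = ρ p * (fderiv ℝ X p dirT + ∑ j, u j p * fderiv ℝ X p (dirX j)) := by
  have e : ∀ j, fderiv ℝ (fun p => ρ p * X p * u j p) p (dirX j)
      = X p * fderiv ℝ (fun p => ρ p * u j p) p (dirX j)
        + ρ p * (u j p * fderiv ℝ X p (dirX j)) := fun j => by
    rw [fderiv_mul_apply (hρ.fun_mul hX) (hu j), fderiv_mul_apply hρ hX, fderiv_mul_apply hρ (hu j)]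
    ring
  simp only [e, Finset.sum_add_distrib, ← Finset.mul_sum]
  rw [fderiv_mul_apply hρ hX]
  linear_combination X p * hc

theorem convF_mul {f : ℝ → ℝ → E3 → Phase → ℝ} {a b : ℝ → ST → ℝ} {κ : ℝ} {p : ST}
    (ha : DifferentiableAt ℝ (a κ) p) (hb : DifferentiableAt ℝ (b κ) p) :
    convF f (fun κ p => a κ p * b κ p) κ p = a κ p * convF f b κ p + b κ p * convF f a κ p := by
  simp only [convF, fderiv_mul_apply ha hb, mul_add, Finset.sum_add_distrib, Finset.mul_sum]
  simp only [mul_left_comm]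
  ring

theorem convF_add {f : ℝ → ℝ → E3 → Phase → ℝ} {a b : ℝ → ST → ℝ} {κ : ℝ} {p : ST}
    (ha : DifferentiableAt ℝ (a κ) p) (hb : DifferentiableAt ℝ (b κ) p) :
    convF f (fun κ p => a κ p + b κ p) κ p = convF f a κ p + convF f b κ p := by
  simp only [convF, fderiv_add_apply ha hb, mul_add, Finset.sum_add_distrib]
  ring

theorem convF_const_mul {f : ℝ → ℝ → E3 → Phase → ℝ} {a : ℝ → ST → ℝ} {κ : ℝ} {p : ST}
    (r : ℝ) (ha : DifferentiableAt ℝ (a κ) p) :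
    convF f (fun κ p => r * a κ p) κ p = r * convF f a κ p := by
  rw [convF_mul (a := fun _ _ => r) (differentiableAt_const r) ha]
  simp [convF]

/-- A constant multiple of the Kronecker delta of a field. -/
theorem SmallC1.ite {l : Filter ℝ} {U : Set ST} {k : ℕ} {a : ℝ → ST → ℝ} (ha : SmallC1 l U k a) (c : Prop)
    [Decidable c] : SmallC1 l U k (fun κ p => if c then a κ p else 0) := by
  by_cases hc : c
  · simpa [hc] using ha
  · simpa [hc] using SmallC1.sum (l := l) (U := U) (k := k) (∅ : Finset (Fin 3))
        (A := fun _ _ _ => 0) (by simp)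

namespace SolFamily

variable {P : GasParams} {Kn₀ : ℝ} {U : Set ST} {g : Phase → ℝ} {f : ℝ → ℝ → E3 → Phase → ℝ}
  (h : SolFamily P Kn₀ U g f) {l : Filter ℝ} (hl : ∀ᶠ κ in l, κ ∈ Ioo 0 Kn₀)

include h

include hl in
/-- Approximate fluxes give the transport moments up to `O(κ)`. -/
theorem flowMom_approx {ψ : Phase → ℝ} (hψ : Admissible 1 ψ) {A : ℝ → ST → ℝ}
    {B : Fin 3 → ℝ → ST → ℝ} (hA : SmallC1 l U 0 A) (hB : ∀ j, SmallC1 l U 0 (B j))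
    (hA' : SmallC1 l U 1 (fun κ p => mom f ψ κ p - A κ p))
    (hB' : ∀ j, SmallC1 l U 1 (fun κ p => mom f (fun z => ψ z * z.1 j) κ p - B j κ p)) :
    Approx l U (flowMom f ψ) (fun κ p => fderiv ℝ (A κ) p dirT
      + ∑ j, fderiv ℝ (B j κ) p (dirX j)) := by
  have m0 := h.smallC1_mom hl h.isOpen (hψ.mono (Nat.zero_le 1))
  have m1 := fun j => h.smallC1_mom hl h.isOpen (hψ.mul_coord j)
  refine ((Approx.der_apply m0 hA hA' dirT).add (Approx.sum Finset.univ fun j _ =>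
    Approx.der_apply (m1 j) (hB j) (hB' j) (dirX j))).congr ?_ (Eventually.of_forall fun _ => rfl)
  filter_upwards [eventually_mem hl] with q hq
  exact (h.flowMom_eq h.isOpen hq.1 hq.2 hψ).symm

include hl

omit hl in
theorem fderiv_congr {κ : ℝ} (hκ : κ ∈ Ioo 0 Kn₀) {p : ST} (hp : p ∈ U) {a b : ℝ → ST → ℝ}
    (hab : ∀ κ ∈ Ioo 0 Kn₀, ∀ p ∈ U, a κ p = b κ p) : fderiv ℝ (a κ) p = fderiv ℝ (b κ) p :=
  Filter.EventuallyEq.fderiv_eq <| by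
    filter_upwards [h.isOpen.mem_nhds hp] with p' hp' using hab κ hκ p' hp'

omit hl in
-- Mass is conserved exactly and the mass flux is exactly ρ u, so there is no O(κ) error here.
theorem continuity_eq {κ : ℝ} (hκ : κ ∈ Ioo 0 Kn₀) {p : ST} (hp : p ∈ U) :
    fderiv ℝ (rhoF f κ) p dirT
      + ∑ j, fderiv ℝ (fun p => rhoF f κ p * velF f j κ p) p (dirX j) = 0 := by
  have e := h.flowMom_eq h.isOpen hκ hp (admissible_one.mono (by norm_num))
  rw [h.flowMom_one hκ hp] at e
  simp only [one_mul] at e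
  have e1 : fderiv ℝ (mom f (fun _ => 1) κ) p = fderiv ℝ (rhoF f κ) p :=
    h.fderiv_congr hκ hp fun _ _ _ _ => mom_one
  have e2 : ∀ j : Fin 3, fderiv ℝ (mom f (fun z => z.1 j) κ) p
      = fderiv ℝ (fun p => rhoF f κ p * velF f j κ p) p := fun j =>
    h.fderiv_congr (b := fun κ p => rhoF f κ p * velF f j κ p) hκ hp
      fun κ hκ p hp => h.mom_coord hκ hp j
  simp only [e1, e2] at e
  exact e.symm

theorem transport_fields {X : ℝ → ST → ℝ} (hX : SmallC1 l U 0 X) :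
    ∀ᶠ q in l ×ˢ 𝓟 U, fderiv ℝ (fun p => rhoF f q.1 p * X q.1 p) q.2 dirT
      + ∑ j, fderiv ℝ (fun p => rhoF f q.1 p * X q.1 p * velF f j q.1 p) q.2 (dirX j)
      = rhoF f q.1 q.2 * convF f X q.1 q.2 := by
  have hu : ∀ᶠ q in l ×ˢ 𝓟 U, ∀ j, DifferentiableAt ℝ (velF f j q.1) q.2 :=
    eventually_all.2 fun j => (h.smallC1_vel hl j).diff
  filter_upwards [(h.smallC1_rho hl).diff, hX.diff, hu, eventually_mem hl] with q h1 h2 h3 h4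
  exact transport_mul h1 h2 h3 (h.continuity_eq h4.1 h4.2)

theorem bdd_der_vel (i : Fin 3) (w : ST) :
    Approx l U (fun κ p => fderiv ℝ (velF f i κ) p w) (fun κ p => fderiv ℝ (velF f i κ) p w) :=
  Approx.refl (by simpa using (h.smallC1_vel hl i).der_apply w)

theorem bdd_div : Approx l U (divF f) (divF f) :=
  Approx.sum Finset.univ fun j _ => h.bdd_der_vel hl j (dirX j)

theorem approx_div_rho {a b : ℝ → ST → ℝ} (hab : Approx l U (fun κ p => rhoF f κ p * a κ p)
    (fun κ p => rhoF f κ p * b κ p)) : Approx l U a b := by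
  have hr := Approx.refl (a := fun κ p => (rhoF f κ p)⁻¹) ((h.smallC1_rho hl).inv (h.unifPos_rho hl)).bdd
  have hne := (h.unifPos_rho hl).pos
  refine (hr.mul hab).congr ?_ ?_ <;>
  · filter_upwards [hne] with q hq
    rw [inv_mul_cancel_left₀ hq.ne']

theorem smallC1_rho_req : SmallC1 l U 0 (fun κ p => rhoF f κ p * reqF P f κ p) :=
  (h.smallC1_rho hl).mul (h.smallC1_req hl)

theorem smallC1_rem {ψ : Phase → ℝ} (hψ : Admissible 1 ψ) :
    SmallC1 l U 1 (fun κ p => κ * tauFam P f κ p * flowMom f ψ κ p) := by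
  simpa using (SmallC1.param.mul (h.smallC1_tau hl)).mul (h.smallC1_flowMom hl h.isOpen hψ)

/-- Euler's momentum equation: the moment of Df against v vanishes exactly, and the momentum flux is
ρ u ⊗ u + ρ R T_eq I up to an O(κ) that may be differentiated. -/
theorem momentum_approx (i : Fin 3) :
    Approx l U (fun κ p => rhoF f κ p * convF f (velF f i) κ p)
      (fun κ p => - fderiv ℝ (fun p => rhoF f κ p * reqF P f κ p) p (dirX i)) := by
  have hρ := h.smallC1_rho hl
  have hu := h.smallC1_vel hl
  have hθ := h.smallC1_req hl
  have key := h.flowMom_approx hl (ψ := fun z => z.1 i) ((admissible_coord i).mono (by norm_num))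
    (A := fun κ p => rhoF f κ p * velF f i κ p)
    (B := fun j κ p => rhoF f κ p * velF f i κ p * velF f j κ p
      + if i = j then rhoF f κ p * reqF P f κ p else 0)
    (hρ.mul (hu i)) (fun j => ((hρ.mul (hu i)).mul (hu j)).add ((h.smallC1_rho_req hl).ite _))
    -- The momentum itself is exact; its zero error is written κ · 0 to count as O(κ).
    (h.smallC1_congr hl (a := fun κ p => κ * 0) (by
      simpa using (SmallC1.param (l := l) (U := U)).mul (SmallC1.const 0))
      fun κ hκ p hp => by rw [h.mom_coord hκ hp]; simp [rhoF, velF])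
    (fun j => h.smallC1_congr hl (hρ.mul (h.smallC1_th_sub_req hl i j)) fun κ hκ p hp => by
      rw [h.mom_two hκ hp]
      simp only [rhoF, velF, thF]
      split_ifs <;> ring)
  have k2 : Approx l U (fun _ _ => 0) (fun κ p => rhoF f κ p * convF f (velF f i) κ p
      + fderiv ℝ (fun p => rhoF f κ p * reqF P f κ p) p (dirX i)) := by
    refine key.congr ?_ ?_
    · filter_upwards [eventually_mem hl] with q hq using h.flowMom_coord hq.1 hq.2 i
    · have hd : ∀ᶠ q in l ×ˢ 𝓟 U, ∀ j, DifferentiableAt ℝ (velF f j q.1) q.2 :=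
        eventually_all.2 fun j => (hu j).diff
      filter_upwards [h.transport_fields hl (hu i), hρ.diff, hd, (h.smallC1_rho_req hl).diff]
        with q h1 h2 h3 h4
      rw [← h1, add_assoc]
      congr 1
      have e : ∀ j, fderiv ℝ (fun p => rhoF f q.1 p * velF f i q.1 p * velF f j q.1 p
            + if i = j then rhoF f q.1 p * reqF P f q.1 p else 0) q.2 (dirX j)
          = fderiv ℝ (fun p => rhoF f q.1 p * velF f i q.1 p * velF f j q.1 p) q.2 (dirX j)
            + if i = j then fderiv ℝ (fun p => rhoF f q.1 p * reqF P f q.1 p) q.2 (dirX j)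
              else 0 := fun j => by
        by_cases hij : i = j
        · simp only [hij, if_true]
          rw [fderiv_add_apply ((h2.fun_mul (h3 j)).fun_mul (h3 j)) h4]
        · simp [hij]
      simp [e, Finset.sum_add_distrib]
  have k3 := k2.symm.add (Approx.refl (a := fun κ p =>
    - fderiv ℝ (fun p => rhoF f κ p * reqF P f κ p) p (dirX i))
    (by simpa using ((h.smallC1_rho_req hl).der_apply (dirX i)).neg_left))
  exact k3.congr (Eventually.of_forall fun q => by ring) (Eventually.of_forall fun q => by ring)

/-- The heat flux of the mode is O(κ), so to leading order its energy is merely advected at the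
value R T_eq. -/
theorem flowMom_rot_approx : Approx l U (flowMom f (fun z => z.2.1))
    (fun κ p => rhoF f κ p * (P.R * convF f (eqF P f) κ p)) := by
  have hρ := h.smallC1_rho hl
  have hu := h.smallC1_vel hl
  have hθ := h.smallC1_req hl
  have key := h.flowMom_approx hl (ψ := fun z => z.2.1) (admissible_rot.mono (by norm_num))
    (A := fun κ p => rhoF f κ p * reqF P f κ p)
    (B := fun j κ p => rhoF f κ p * reqF P f κ p * velF f j κ p)
    (hρ.mul hθ) (fun j => (hρ.mul hθ).mul (hu j))
    (h.smallC1_congr hl (hρ.mul (h.smallC1_rot_sub_req hl)) fun κ hκ p hp => by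
      rw [h.mom_rot hκ hp]; simp only [rhoF, rotF]; ring)
    (fun j => h.smallC1_congr hl (((hρ.mul (h.smallC1_relRot_sub_req hl)).mul (hu j)).sub
      (h.smallC1_rem hl (admissible_rot.mul_coord j))) fun κ hκ p hp => by
        rw [h.mom_rot_coord hκ hp]; simp only [rhoF, relRotF, velF]; ring)
  refine key.congr (Eventually.of_forall fun _ => rfl) ?_
  filter_upwards [h.transport_fields hl hθ, (h.smallC1_eq hl).diff] with q h1 h2
  rw [h1]
  congr 1
  simp only [convF, mul_add, Finset.mul_sum]
  have e : ∀ w, fderiv ℝ (reqF P f q.1) q.2 w = P.R * fderiv ℝ (eqF P f q.1) q.2 w := fun w => by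
    change fderiv ℝ (fun p => P.R * eqF P f q.1 p) q.2 w = _
    rw [fderiv_const_mul h2]; rfl
  simp only [e]
  congr 1
  exact Finset.sum_congr rfl fun j _ => by ring

theorem smallC1_eVib_eq : SmallC1 l U 0 (fun κ p => eVib P (eqF P f κ p)) :=
  (h.smallC1_eq hl).comp ((contDiffOn_eVib P).of_le (by norm_num)) (h.unifPos_eq hl)

theorem flowMom_vib_approx :
    Approx l U (fun κ p => P.R * P.T₀ * flowMom f (fun z => (z.2.2 : ℝ)) κ p)
    (fun κ p => rhoF f κ p * (cVib P (eqF P f κ p) * convF f (eqF P f) κ p)) := by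
  have hρ := h.smallC1_rho hl
  have hu := h.smallC1_vel hl
  have hX := h.smallC1_eVib_eq hl
  have hR := P.R_pos.ne'; have hT := P.T₀_pos.ne'
  have hX' := hX.const_mul (P.R * P.T₀)⁻¹
  have key := h.flowMom_approx hl (ψ := fun z => (z.2.2 : ℝ)) (admissible_vib.mono (by norm_num))
    (A := fun κ p => rhoF f κ p * ((P.R * P.T₀)⁻¹ * eVib P (eqF P f κ p)))
    (B := fun j κ p => rhoF f κ p * ((P.R * P.T₀)⁻¹ * eVib P (eqF P f κ p)) * velF f j κ p)
    (hρ.mul hX') (fun j => (hρ.mul hX').mul (hu j))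
    (h.smallC1_congr hl ((hρ.mul (h.smallC1_vib_sub_eq hl)).const_mul (P.R * P.T₀)⁻¹)
      fun κ hκ p hp => by
        rw [h.mom_vib hκ hp]; simp only [rhoF, vibF]; field_simp)
    (fun j => h.smallC1_congr hl ((((hρ.mul (h.smallC1_relVib_sub_eq hl)).mul (hu j)).const_mul
      (P.R * P.T₀)⁻¹).sub (h.smallC1_rem hl (admissible_vib.mul_coord j))) fun κ hκ p hp => by
        rw [h.mom_vib_coord hκ hp]; simp only [rhoF, relVibF, velF]; field_simp; ring)
  refine (key.const_mul (P.R * P.T₀)).congr (Eventually.of_forall fun _ => rfl) ?_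
  filter_upwards [h.transport_fields hl hX', (h.smallC1_eq hl).diff, (h.unifPos_eq hl).pos]
    with q h1 h2 h3
  rw [h1]
  have e : ∀ w, fderiv ℝ (fun p => (P.R * P.T₀)⁻¹ * eVib P (eqF P f q.1 p)) q.2 w
      = (P.R * P.T₀)⁻¹ * (cVib P (eqF P f q.1 q.2) * fderiv ℝ (eqF P f q.1) q.2 w) := fun w => by
    have := ((hasDerivAt_eVib P h3).comp_hasFDerivAt q.2 h2.hasFDerivAt).const_mul (P.R * P.T₀)⁻¹
    have := this.fderiv
    simp only [Function.comp_def] at this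
    rw [this]; rfl
  simp only [convF, e]
  have e2 : ∀ j, velF f j q.1 q.2 * ((P.R * P.T₀)⁻¹ * (cVib P (eqF P f q.1 q.2)
      * fderiv ℝ (eqF P f q.1) q.2 (dirX j))) = ((P.R * P.T₀)⁻¹ * cVib P (eqF P f q.1 q.2))
        * (velF f j q.1 q.2 * fderiv ℝ (eqF P f q.1) q.2 (dirX j)) := fun j => by ring
  simp only [e2, ← Finset.mul_sum]
  field_simp

/-- The third moments of the Gaussian with Π replaced by R T_eq I determine the flux. The terms with
a bare velocity reassemble into the momentum equation and drop out. -/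
theorem flowMom_two_approx (i k : Fin 3) :
    Approx l U (flowMom f (fun z => z.1 i * z.1 k))
    (fun κ p => rhoF f κ p * ((if i = k then P.R * convF f (eqF P f) κ p else 0)
      + reqF P f κ p * (fderiv ℝ (velF f i κ) p (dirX k)
        + fderiv ℝ (velF f k κ) p (dirX i)))) := by
  have hρ := h.smallC1_rho hl
  have hu := h.smallC1_vel hl
  have hθ := h.smallC1_req hl
  have hρθ := h.smallC1_rho_req hl
  have hX : SmallC1 l U 0 (fun κ p => velF f i κ p * velF f k κ p
      + if i = k then reqF P f κ p else 0) := ((hu i).mul (hu k)).add (hθ.ite _)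
  have key := h.flowMom_approx hl (ψ := fun z => z.1 i * z.1 k)
    ((admissible_coord_two i k).mono (by norm_num))
    (A := fun κ p => rhoF f κ p * (velF f i κ p * velF f k κ p
      + if i = k then reqF P f κ p else 0))
    (B := fun j κ p => rhoF f κ p * (velF f i κ p * velF f k κ p
      + if i = k then reqF P f κ p else 0) * velF f j κ p
      + ((if k = j then rhoF f κ p * reqF P f κ p * velF f i κ p else 0)
        + if i = j then rhoF f κ p * reqF P f κ p * velF f k κ p else 0))
    (hρ.mul hX) (fun j => ((hρ.mul hX).mul (hu j)).add (((hρθ.mul (hu i)).ite _).add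
      ((hρθ.mul (hu k)).ite _)))
    (h.smallC1_congr hl (hρ.mul (h.smallC1_th_sub_req hl i k)) fun κ hκ p hp => by
      rw [h.mom_two hκ hp]; simp only [rhoF, velF, thF]; ring)
    (fun j => h.smallC1_congr hl (((((hρ.mul (hu i)).mul (h.smallC1_pi_sub_req hl k j)).add
      ((hρ.mul (hu k)).mul (h.smallC1_pi_sub_req hl i j))).add
      ((hρ.mul (hu j)).mul (h.smallC1_pi_sub_req hl i k))).sub
      (h.smallC1_rem hl ((admissible_coord_two i k).mul_coord j))) fun κ hκ p hp => by
        rw [h.mom_three hκ hp]; simp only [rhoF, piF, velF]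
        split_ifs <;> ring)
  -- The momentum equations multiplied by a velocity component, to be subtracted at the end.
  have m1 := (Approx.refl (hu i).bdd).mul ((h.momentum_approx hl k).add
    (Approx.refl (a := fun κ p => fderiv ℝ (fun p => rhoF f κ p * reqF P f κ p) p (dirX k))
      (by simpa using hρθ.der_apply (dirX k))))
  have m2 := (Approx.refl (hu k).bdd).mul ((h.momentum_approx hl i).add
    (Approx.refl (a := fun κ p => fderiv ℝ (fun p => rhoF f κ p * reqF P f κ p) p (dirX i))
      (by simpa using hρθ.der_apply (dirX i))))
  have key' := key.congr (a' := flowMom f (fun z => z.1 i * z.1 k))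
    (b' := fun κ p => rhoF f κ p * ((if i = k then P.R * convF f (eqF P f) κ p else 0)
      + reqF P f κ p * (fderiv ℝ (velF f i κ) p (dirX k)
        + fderiv ℝ (velF f k κ) p (dirX i)))
      + velF f i κ p * (rhoF f κ p * convF f (velF f k) κ p
        + fderiv ℝ (fun p => rhoF f κ p * reqF P f κ p) p (dirX k))
      + velF f k κ p * (rhoF f κ p * convF f (velF f i) κ p
        + fderiv ℝ (fun p => rhoF f κ p * reqF P f κ p) p (dirX i)))
    (Eventually.of_forall fun _ => rfl) (by
      have hd : ∀ᶠ q in l ×ˢ 𝓟 U, ∀ j, DifferentiableAt ℝ (velF f j q.1) q.2 :=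
        eventually_all.2 fun j => (hu j).diff
      filter_upwards [h.transport_fields hl hX, hρ.diff, hd, hρθ.diff, hX.diff,
        (h.smallC1_eq hl).diff] with q h1 h2 h3 h4 h5 h6
      have e : ∀ j, fderiv ℝ (fun p => rhoF f q.1 p * (velF f i q.1 p * velF f k q.1 p
          + if i = k then reqF P f q.1 p else 0) * velF f j q.1 p
          + ((if k = j then rhoF f q.1 p * reqF P f q.1 p * velF f i q.1 p else 0)
            + if i = j then rhoF f q.1 p * reqF P f q.1 p * velF f k q.1 p else 0)) q.2 (dirX j)
          = fderiv ℝ (fun p => rhoF f q.1 p * (velF f i q.1 p * velF f k q.1 p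
            + if i = k then reqF P f q.1 p else 0) * velF f j q.1 p) q.2 (dirX j)
            + ((if k = j then fderiv ℝ (fun p => rhoF f q.1 p * reqF P f q.1 p * velF f i q.1 p)
                q.2 (dirX j) else 0)
              + if i = j then fderiv ℝ (fun p => rhoF f q.1 p * reqF P f q.1 p * velF f k q.1 p)
                q.2 (dirX j) else 0) := fun j => by
        have d1 : DifferentiableAt ℝ (fun p => if k = j then
            rhoF f q.1 p * reqF P f q.1 p * velF f i q.1 p else 0) q.2 := by
          split_ifs
          · exact h4.fun_mul (h3 i)
          · exact differentiableAt_const _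
        have d2 : DifferentiableAt ℝ (fun p => if i = j then
            rhoF f q.1 p * reqF P f q.1 p * velF f k q.1 p else 0) q.2 := by
          split_ifs
          · exact h4.fun_mul (h3 k)
          · exact differentiableAt_const _
        rw [fderiv_add_apply ((h2.fun_mul h5).fun_mul (h3 j)) (d1.fun_add d2),
          fderiv_add_apply d1 d2]
        congr 2
        · by_cases hj : k = j <;> simp [hj]
        · by_cases hj : i = j <;> simp [hj]
      have ec : convF f (fun κ p => velF f i κ p * velF f k κ p
          + if i = k then reqF P f κ p else 0) q.1 q.2
          = velF f i q.1 q.2 * convF f (velF f k) q.1 q.2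
            + velF f k q.1 q.2 * convF f (velF f i) q.1 q.2
            + if i = k then P.R * convF f (eqF P f) q.1 q.2 else 0 := by
        have d : DifferentiableAt ℝ (fun p => if i = k then reqF P f q.1 p else 0) q.2 := by
          split_ifs
          · exact h6.const_mul P.R
          · exact differentiableAt_const _
        rw [convF_add (a := fun κ p => velF f i κ p * velF f k κ p)
          (b := fun κ p => if i = k then reqF P f κ p else 0) ((h3 i).fun_mul (h3 k)) d,
          convF_mul (h3 i) (h3 k)]
        congr 1
        by_cases hik : i = k
        · simp only [hik, if_true]
          exact convF_const_mul P.R h6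
        · simp [hik, convF]
      simp only [e, Finset.sum_add_distrib, Finset.sum_ite_eq, Finset.mem_univ, if_true]
      rw [← add_assoc, h1, ec, fderiv_mul_apply h4 (h3 i), fderiv_mul_apply h4 (h3 k)]
      ring)
  exact ((key'.sub' m1.symm).sub' m2.symm).congr (Eventually.of_forall fun q => by ring)
    (Eventually.of_forall fun q => by ring)

end SolFamily

/-! ### First-order expansion of the macroscopic parameters -/

section Fields

variable (P : GasParams) (f : ℝ → ℝ → E3 → Phase → ℝ) (κ : ℝ) (p : ST)

/-- The specific heat at the equilibrium temperature. -/
noncomputable def cvF : ℝ := cv P (eqF P f κ p)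
/-- The vibrational specific heat at the equilibrium temperature. -/
noncomputable def cVibF : ℝ := cVib P (eqF P f κ p)
/-- The relaxation time at the equilibrium temperature. -/
noncomputable def tauF : ℝ := tau P (rhoF f κ p) (eqF P f κ p)
/-- The rotational relaxation time at the equilibrium temperature. -/
noncomputable def tauRotF : ℝ := P.Zrot (eqF P f κ p) * P.tauC (rhoF f κ p) (eqF P f κ p)
/-- The vibrational relaxation time at the equilibrium temperature. -/
noncomputable def tauVibF : ℝ := P.Zvib (eqF P f κ p) * P.tauC (rhoF f κ p) (eqF P f κ p)
/-- The reduced volume viscosity at the equilibrium temperature. -/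
noncomputable def zF : ℝ :=
  P.R * (tauRotF P f κ p * P.R + tauVibF P f κ p * cVibF P f κ p) / cvF P f κ p ^ 2

end Fields

namespace SolFamily

variable {P : GasParams} {Kn₀ : ℝ} {U : Set ST} {g : Phase → ℝ} {f : ℝ → ℝ → E3 → Phase → ℝ}
  (h : SolFamily P Kn₀ U g f) {l : Filter ℝ} (hl : ∀ᶠ κ in l, κ ∈ Ioo 0 Kn₀)

include h hl

theorem smallC1_cv : SmallC1 l U 0 (cvF P f) :=
  (h.smallC1_eq hl).comp (contDiffOn_cv P) (h.unifPos_eq hl)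

theorem smallC1_cVib : SmallC1 l U 0 (cVibF P f) :=
  (h.smallC1_eq hl).comp (contDiffOn_cVib P) (h.unifPos_eq hl)

theorem unifPos_cv : UnifPos l U (cvF P f) := by
  have := P.R_pos
  refine ⟨5 / 2 * P.R, by positivity, ?_⟩
  filter_upwards [(h.unifPos_eq hl).pos] with q hq using le_cv P hq

theorem smallC1_tauF : SmallC1 l U 0 (tauF P f) := by
  have hpos : UnifPos l U (fun κ p => rhoF f κ p * P.R * eqF P f κ p * P.Pr) := by
    obtain ⟨m, hm, h1⟩ := h.unifPos_rho hl
    obtain ⟨m', hm', h2⟩ := h.unifPos_eq hl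
    have := P.R_pos; have := P.Pr_pos
    refine ⟨m * P.R * m' * P.Pr, by positivity, ?_⟩
    filter_upwards [h1, h2] with q h1 h2
    have := hm.le.trans h1
    gcongr
  have hd : SmallC1 l U 0 (fun κ p => rhoF f κ p * P.R * eqF P f κ p * P.Pr) :=
    h.smallC1_congr hl (((h.smallC1_rho hl).mul (h.smallC1_eq hl)).const_mul (P.R * P.Pr))
      fun κ hκ p hp => by ring
  exact ((h.smallC1_eq hl).comp P.visc_smooth (h.unifPos_eq hl)).div hd hpos

/-- Coefficients of the model are evaluated at T_tr; in leading-order terms T_eq may be used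
instead, with an error O(κ). -/
theorem approx_comp {Φ : ℝ → ℝ} (hΦ : ContDiffOn ℝ 1 Φ (Ioi 0)) :
    Approx l U (fun κ p => Φ (trF P f κ p)) (fun κ p => Φ (eqF P f κ p)) :=
  ⟨((h.smallC1_tr hl).comp hΦ (h.unifPos_tr hl)).bdd,
    ((h.smallC1_eq hl).comp hΦ (h.unifPos_eq hl)).bdd,
    (IsBigO.comp_sub hΦ (h.smallC1_tr hl) (h.smallC1_eq hl) (h.unifPos_tr hl)
      (h.unifPos_eq hl)).trans (h.smallC1_tr_sub_eq hl).val_one⟩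

theorem approx_tauC : Approx l U (fun κ p => P.tauC (rhoF f κ p) (trF P f κ p))
    (fun κ p => P.tauC (rhoF f κ p) (eqF P f κ p)) :=
  ⟨(h.smallC1_tauC hl).bdd,
    (SmallC1.comp_pair P.tauC_smooth (h.smallC1_rho hl) (h.smallC1_eq hl) (h.unifPos_rho hl)
      (h.unifPos_eq hl)).bdd,
    (IsBigO.comp_pair_sub P.tauC_smooth (h.smallC1_rho hl) (h.smallC1_tr hl) (h.smallC1_eq hl)
      (h.unifPos_rho hl) (h.unifPos_tr hl) (h.unifPos_eq hl)).trans
      (h.smallC1_tr_sub_eq hl).val_one⟩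

theorem approx_tauRot : Approx l U (fun κ p => P.Zrot (trF P f κ p)
    * P.tauC (rhoF f κ p) (trF P f κ p)) (tauRotF P f) :=
  (h.approx_comp hl P.Zrot_smooth).mul (h.approx_tauC hl)

theorem approx_tauVib : Approx l U (fun κ p => P.Zvib (trF P f κ p)
    * P.tauC (rhoF f κ p) (trF P f κ p)) (tauVibF P f) :=
  (h.approx_comp hl P.Zvib_smooth).mul (h.approx_tauC hl)

theorem approx_tau : Approx l U (tauFam P f) (tauF P f) := by
  have hi : ContDiffOn ℝ 1 (fun x : ℝ => x⁻¹) (Ioi 0) :=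
    contDiffOn_inv ℝ |>.mono fun _ hx => ne_of_gt hx
  have e := (((h.approx_comp hl P.visc_smooth).mul (h.approx_comp hl hi)).mul
    (Approx.refl (a := fun κ p => (rhoF f κ p)⁻¹)
      ((h.smallC1_rho hl).inv (h.unifPos_rho hl)).bdd)).const_mul (P.R⁻¹ * P.Pr⁻¹)
  refine e.congr (Eventually.of_forall fun q => ?_) (Eventually.of_forall fun q => ?_)
  · change _ = P.visc (trF P f q.1 q.2) / (rhoF f q.1 q.2 * P.R * trF P f q.1 q.2 * P.Pr)
    simp only [div_eq_mul_inv, mul_inv]; ring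
  · simp only [tauF, tau, div_eq_mul_inv, mul_inv]; ring

/-- Half the trace of the second-order transport moments plus the two internal ones vanishes by
energy conservation. In leading order the sum is ρ (c_v D T_eq + R T_eq div u), now with D the
convective derivative. -/
theorem conv_eq_approx : Approx l U (convF f (eqF P f))
    (fun κ p => -(reqF P f κ p * divF f κ p / cvF P f κ p)) := by
  have hθ := Approx.refl (h.smallC1_req hl).bdd
  have e0 := (((Approx.sum Finset.univ fun i _ => h.flowMom_two_approx hl i i).const_mul
    (1 / 2)).add (h.flowMom_rot_approx hl)).add (h.flowMom_vib_approx hl)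
  have e1 : Approx l U (fun κ p => rhoF f κ p * (fun _ _ => 0) κ p) (fun κ p => rhoF f κ p *
      (fun κ p => cvF P f κ p * convF f (eqF P f) κ p + reqF P f κ p * divF f κ p) κ p) := by
    refine e0.congr ?_ (Eventually.of_forall fun q => ?_)
    · filter_upwards [eventually_mem hl] with q hq
      simpa using h.flowMom_energy hq.1 hq.2
    · have hc : cv P (eqF P f q.1 q.2) = 5 / 2 * P.R + cVib P (eqF P f q.1 q.2) := by
        rw [cv, cTr, cRot, rotDof]; ring
      simp only [divF, cvF, hc, Fin.sum_univ_three, if_true]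
      ring
  have e2 := (h.approx_div_rho hl e1).symm
  have hc := Approx.refl (a := fun κ p => (cvF P f κ p)⁻¹)
    ((h.smallC1_cv hl).inv (h.unifPos_cv hl)).bdd
  have e3 := (hc.mul e2).add ((hc.mul (hθ.mul (h.bdd_div hl))).neg)
  refine e3.congr ?_ (Eventually.of_forall fun q => ?_)
  · filter_upwards [(h.unifPos_cv hl).pos] with q hq
    field_simp; ring
  · simp only [div_eq_mul_inv]; ring

theorem approx_div_rho' {a b : ℝ → ST → ℝ} (hab : Approx l U a (fun κ p => rhoF f κ p * b κ p)) :
    Approx l U (fun κ p => a κ p / rhoF f κ p) b :=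
  h.approx_div_rho hl <| hab.congr (by
    filter_upwards [(h.unifPos_rho hl).pos] with q hq
    field_simp) (Eventually.of_forall fun q => rfl)

theorem approx_rot_flow : Approx l U (fun κ p => flowMom f (fun z => z.2.1) κ p / rhoF f κ p)
    (fun κ p => -(P.R * (reqF P f κ p * divF f κ p / cvF P f κ p))) := by
  exact (h.approx_div_rho' hl (h.flowMom_rot_approx hl)).trans (((h.conv_eq_approx hl).const_mul P.R).congr
    (Eventually.of_forall fun q => rfl) (Eventually.of_forall fun q => by ring))

theorem approx_vib_flow : Approx l U
    (fun κ p => P.R * P.T₀ * flowMom f (fun z => (z.2.2 : ℝ)) κ p / rhoF f κ p)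
    (fun κ p => -(cVibF P f κ p * (reqF P f κ p * divF f κ p / cvF P f κ p))) := by
  exact (h.approx_div_rho' hl (h.flowMom_vib_approx hl)).trans (((Approx.refl (a := cVibF P f) (h.smallC1_cVib hl).bdd).mul
    (h.conv_eq_approx hl)).congr
    (Eventually.of_forall fun q => rfl) (Eventually.of_forall fun q => by ring))

theorem approx_two_flow (i k : Fin 3) : Approx l U
    (fun κ p => flowMom f (fun z => z.1 i * z.1 k) κ p / rhoF f κ p)
    (fun κ p => (if i = k then -(P.R * (reqF P f κ p * divF f κ p / cvF P f κ p)) else 0)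
      + reqF P f κ p * (fderiv ℝ (velF f i κ) p (dirX k) + fderiv ℝ (velF f k κ) p (dirX i))) := by
  refine (h.approx_div_rho' hl (h.flowMom_two_approx hl i k)).trans ?_
  have e2 := (Approx.refl (h.smallC1_req hl).bdd).mul
    ((h.bdd_der_vel hl i (dirX k)).add (h.bdd_der_vel hl k (dirX i)))
  by_cases hik : i = k
  · simp only [hik, if_true] at e2 ⊢
    exact (((h.conv_eq_approx hl).const_mul P.R).add e2).congr
      (Eventually.of_forall fun q => rfl) (Eventually.of_forall fun q => by ring)
  · simp only [hik, if_false, zero_add]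
    exact e2

/-- The exact relaxation law carries a factor κ, so its coefficient is only needed to leading order.
-/
theorem rot_relax_expansion :
    (fun q : ℝ × ST => P.R * trF P f q.1 q.2 - rotF f q.1 q.2
      + q.1 * (tauRotF P f q.1 q.2 * (P.R * (reqF P f q.1 q.2 * divF f q.1 q.2 / cvF P f q.1 q.2))))
      =O[l ×ˢ 𝓟 U] fun q => q.1 ^ 2 := by
  refine ((h.approx_tauRot hl).mul (h.approx_rot_flow hl)).kappa_mul.congr' ?_ EventuallyEq.rfl
  filter_upwards [eventually_mem hl] with q hq
  rw [h.rot_relax hq.1 hq.2]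
  ring

theorem vib_relax_expansion :
    (fun q : ℝ × ST => eVib P (trF P f q.1 q.2) - vibF P f q.1 q.2
      + q.1 * (tauVibF P f q.1 q.2
        * (cVibF P f q.1 q.2 * (reqF P f q.1 q.2 * divF f q.1 q.2 / cvF P f q.1 q.2))))
      =O[l ×ˢ 𝓟 U] fun q => q.1 ^ 2 := by
  refine ((h.approx_tauVib hl).mul (h.approx_vib_flow hl)).kappa_mul.congr' ?_ EventuallyEq.rfl
  filter_upwards [eventually_mem hl] with q hq
  rw [h.vib_relax hq.1 hq.2]
  ring

/-- Taylor expansion of the inverse energy: T_tr - T_eq is the sum of the two internal defects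
divided by c_v, up to O(κ²). Their expansions combine into the reduced volume viscosity `zF`. -/
theorem tr_sub_eq_expansion :
    (fun q : ℝ × ST => trF P f q.1 q.2 - eqF P f q.1 q.2
      + q.1 * (zF P f q.1 q.2 * eqF P f q.1 q.2 * divF f q.1 q.2))
      =O[l ×ˢ 𝓟 U] fun q => q.1 ^ 2 := by
  have h1 := IsBigO.comp_sub_taylor (contDiffOn_eTotInv P) (h.smallC1_eTot_tr hl)
    (h.smallC1_en hl) (h.unifPos_eTot_tr hl) (h.unifPos_en hl)
  have h2 := h1.trans ((h.smallC1_eTot_tr_sub_en hl).val_one.pow 2)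
  have h3 := (h.rot_relax_expansion hl).add (h.vib_relax_expansion hl)
  have h4 := (((h.smallC1_cv hl).inv (h.unifPos_cv hl)).bdd.mul h3).congr_right
    (g₂ := fun q => q.1 ^ 2) fun q => by ring
  refine (h2.add h4).congr' ?_ EventuallyEq.rfl
  filter_upwards [eventually_mem hl, (h.unifPos_cv hl).pos] with q hq hc
  have e1 : eTotInv P (eTot P (trF P f q.1 q.2)) = trF P f q.1 q.2 :=
    eTotInv_eTot P (h.tempTr_pos hq.1 hq.2)
  have e2 : eTotInv P (enF P f q.1 q.2) = eqF P f q.1 q.2 := rfl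
  have e3 : deriv (eTotInv P) (enF P f q.1 q.2) = (cvF P f q.1 q.2)⁻¹ :=
    (hasDerivAt_eTotInv P (h.enF_pos hq.1 hq.2)).deriv
  rw [e1, e2, e3, h.eTot_tr_sub_en hq.1 hq.2, zF]
  have : reqF P f q.1 q.2 = P.R * eqF P f q.1 q.2 := rfl
  rw [this]
  field_simp
  ring

theorem eVib_tr_expansion :
    (fun q : ℝ × ST => eVib P (trF P f q.1 q.2) - eVib P (eqF P f q.1 q.2)
      + q.1 * (cVibF P f q.1 q.2 * (zF P f q.1 q.2 * eqF P f q.1 q.2 * divF f q.1 q.2)))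
      =O[l ×ˢ 𝓟 U] fun q => q.1 ^ 2 := by
  have h2 := (IsBigO.comp_sub_taylor (contDiffOn_eVib P) (h.smallC1_tr hl) (h.smallC1_eq hl)
    (h.unifPos_tr hl) (h.unifPos_eq hl)).trans ((h.smallC1_tr_sub_eq hl).val_one.pow 2)
  have h4 := ((h.smallC1_cVib hl).bdd.mul (h.tr_sub_eq_expansion hl)).congr_right
    (g₂ := fun q => q.1 ^ 2) fun q => by ring
  refine (h2.add h4).congr' ?_ EventuallyEq.rfl
  filter_upwards [(h.unifPos_eq hl).pos] with q hq
  rw [(hasDerivAt_eVib P hq).deriv, cVibF]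
  ring

/-- Expansion of the relaxation rotational energy. -/
theorem relRot_expansion :
    (fun q : ℝ × ST => relRotF P f q.1 q.2 - reqF P f q.1 q.2
      - q.1 * (reqF P f q.1 q.2 * divF f q.1 q.2
        * ((tauRotF P f q.1 q.2 - tauF P f q.1 q.2) * P.R / cvF P f q.1 q.2 - zF P f q.1 q.2)))
      =O[l ×ˢ 𝓟 U] fun q => q.1 ^ 2 := by
  have h1 := ((h.approx_tau hl).mul (h.approx_rot_flow hl)).kappa_mul
  have h2 := h.rot_relax_expansion hl
  have h3 := (h.tr_sub_eq_expansion hl).const_mul_left P.R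
  -- With E_rot^rel = e_rot(T_rot^rel), the splitting is E_rot^rel - R T_eq = (E_rot^rel - E_rot) -
  -- (R T_tr - E_rot) + R (T_tr - T_eq).
  refine ((h1.sub h2).add h3).congr' ?_ EventuallyEq.rfl
  filter_upwards [eventually_mem hl] with q hq
  have e : relRotF P f q.1 q.2 = rotF f q.1 q.2 + q.1 * (tauFam P f q.1 q.2
      * (flowMom f (fun z => z.2.1) q.1 q.2 / rhoF f q.1 q.2)) := by
    have hρ : rhoF f q.1 q.2 ≠ 0 := (h.density_pos hq.1 hq.2).ne'
    have := h.flowMom_rot hq.1 hq.2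
    change _ = rhoF f q.1 q.2 * (relRotF P f q.1 q.2 - rotF f q.1 q.2) at this
    field_simp
    linear_combination -this
  rw [e]
  simp only [reqF, eqF]
  ring

/-- Expansion of the relaxation vibrational energy. -/
theorem relVib_expansion :
    (fun q : ℝ × ST => relVibF P f q.1 q.2 - eVib P (eqF P f q.1 q.2)
      - q.1 * (cVibF P f q.1 q.2 * eqF P f q.1 q.2 * divF f q.1 q.2
        * ((tauVibF P f q.1 q.2 - tauF P f q.1 q.2) * P.R / cvF P f q.1 q.2 - zF P f q.1 q.2)))
      =O[l ×ˢ 𝓟 U] fun q => q.1 ^ 2 := by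
  have h1 := ((h.approx_tau hl).mul (h.approx_vib_flow hl)).kappa_mul
  have h2 := h.vib_relax_expansion hl
  have h3 := h.eVib_tr_expansion hl
  refine ((h1.sub h2).add h3).congr' ?_ EventuallyEq.rfl
  filter_upwards [eventually_mem hl] with q hq
  have e : relVibF P f q.1 q.2 = vibF P f q.1 q.2 + q.1 * (tauFam P f q.1 q.2
      * (P.R * P.T₀ * flowMom f (fun z => (z.2.2 : ℝ)) q.1 q.2 / rhoF f q.1 q.2)) := by
    have hρ : rhoF f q.1 q.2 ≠ 0 := (h.density_pos hq.1 hq.2).ne'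
    have := h.flowMom_vib hq.1 hq.2
    change _ = rhoF f q.1 q.2 * (relVibF P f q.1 q.2 - vibF P f q.1 q.2) at this
    field_simp
    linear_combination -this
  rw [e]
  simp only [reqF, eqF]
  ring

/-- Expansion of the relaxation tensor. -/
theorem pi_expansion (i k : Fin 3) :
    (fun q : ℝ × ST => piF P f i k q.1 q.2 - (if i = k then reqF P f q.1 q.2 else 0)
      - q.1 * (reqF P f q.1 q.2 * (tauF P f q.1 q.2 * (1 - P.Pr)
          * (fderiv ℝ (velF f i q.1) q.2 (dirX k) + fderiv ℝ (velF f k q.1) q.2 (dirX i))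
        + if i = k then divF f q.1 q.2 * (tauF P f q.1 q.2 * (2 * P.Pr / 3 - P.R / cvF P f q.1 q.2)
          - zF P f q.1 q.2) else 0)))
      =O[l ×ˢ 𝓟 U] fun q => q.1 ^ 2 := by
  have h1 := fun i k => ((h.approx_tau hl).mul (h.approx_two_flow hl i k)).kappa_mul
  have h3 := (h.tr_sub_eq_expansion hl).const_mul_left P.R
  have e : ∀ᶠ q in l ×ˢ 𝓟 U, ∀ i k, piF P f i k q.1 q.2 - thF f i k q.1 q.2
      = q.1 * (tauFam P f q.1 q.2
      * (flowMom f (fun z => z.1 i * z.1 k) q.1 q.2 / rhoF f q.1 q.2)) := by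
    filter_upwards [eventually_mem hl] with q hq i k
    have hρ : rhoF f q.1 q.2 ≠ 0 := (h.density_pos hq.1 hq.2).ne'
    have := h.flowMom_two hq.1 hq.2 i k
    change _ = rhoF f q.1 q.2 * (piF P f i k q.1 q.2 - thF f i k q.1 q.2) at this
    field_simp
    linear_combination -this
  by_cases hik : i = k
  · subst hik
    simp only [if_true]
    -- Eliminating Θ by `th_sub_eq` gives Π - R T_tr I = (1 - Pr)(Π - Θ) + (Pr / 3) tr(Π - Θ) I; the
    -- shift from T_tr to T_eq is added.
    refine ((((h1 i i).const_mul_left (1 - P.Pr)).add ((((h1 0 0).add (h1 1 1)).add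
      (h1 2 2)).const_mul_left (P.Pr / 3))).add h3).congr' ?_ EventuallyEq.rfl
    filter_upwards [eventually_mem hl, e] with q hq e
    have e0 := h.th_sub_eq hq.1 hq.2 i i
    rw [Fin.sum_univ_three] at e0
    simp only [if_true, e] at e0
    have e1 : piF P f i i q.1 q.2 = thF f i i q.1 q.2 + q.1 * (tauFam P f q.1 q.2
      * (flowMom f (fun z => z.1 i * z.1 i) q.1 q.2 / rhoF f q.1 q.2)) := by rw [← e]; ring
    rw [e1, sub_eq_iff_eq_add.1 e0]
    simp only [reqF, eqF, divF, Fin.sum_univ_three, if_true]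
    ring
  · simp only [hik, if_false]
    refine ((h1 i k).const_mul_left (1 - P.Pr)).congr' ?_ EventuallyEq.rfl
    filter_upwards [eventually_mem hl, e] with q hq e
    have e0 := h.th_sub_eq hq.1 hq.2 i k
    simp only [hik, if_false, e] at e0
    have e1 : piF P f i k q.1 q.2 = thF f i k q.1 q.2 + q.1 * (tauFam P f q.1 q.2
      * (flowMom f (fun z => z.1 i * z.1 k) q.1 q.2 / rhoF f q.1 q.2)) := by rw [← e]; ring
    rw [e1, sub_eq_iff_eq_add.1 e0]
    simp only [hik, if_false]
    ring

end SolFamily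

/-! ### The logarithm of the ratio of the Gaussian and the Maxwellian: coefficients -/

section

variable {l : Filter ℝ} {U : Set ST} {a b : ℝ → ST → ℝ}

/-- An O(κ) perturbation uses at most half of the lower bound once κ is small. In this way the
pointwise positivity of the relaxation quantities becomes uniform. -/
theorem UnifPos.of_sub (hl : l ≤ 𝓝 0) (hb : UnifPos l U b)
    (hab : SmallC1 l U 1 (fun κ p => a κ p - b κ p)) : UnifPos l U a := by
  obtain ⟨m, hm, h1⟩ := hb
  obtain ⟨C, hC⟩ := hab.val_one.bound
  refine ⟨m / 2, by positivity, ?_⟩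
  have h2 : ∀ᶠ κ in l, C * ‖κ‖ < m / 2 := by
    have : Tendsto (fun κ : ℝ => C * ‖κ‖) (𝓝 0) (𝓝 (C * ‖(0 : ℝ)‖)) :=
      (continuous_const.mul continuous_norm).tendsto 0
    refine (this.mono_left hl).eventually_lt_const ?_
    simp; positivity
  filter_upwards [h1, hC, h2.prod_inl (𝓟 U)] with q h1 h2 h3
  have := (abs_le.1 (h2.trans h3.le)).1
  linarith

/-- A lower bound for Φ(a) is an upper bound for 1 / Φ(a), which is again the composition with a C¹
function. -/
theorem SmallC1.unifPos_comp {Φ : ℝ → ℝ} (hΦ : ContDiffOn ℝ 1 Φ (Ioi 0))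
    (hpos : ∀ x, 0 < x → 0 < Φ x) (ha : SmallC1 l U 0 a) (ha0 : UnifPos l U a) :
    UnifPos l U (fun κ p => Φ (a κ p)) := by
  have h1 := ha.comp (hΦ.inv fun x hx => (hpos x hx).ne') ha0
  obtain ⟨M, hM⟩ := exists_upper_bound h1
  refine ⟨(max M 1)⁻¹, by positivity, ?_⟩
  filter_upwards [hM, ha0.pos] with q h1 h2
  have h3 := hpos _ h2
  rw [inv_le_comm₀ (by positivity) h3]
  exact (le_abs_self _).trans (h1.trans (le_max_left _ _))

theorem SmallC1.det {A : Fin 3 → Fin 3 → ℝ → ST → ℝ} (hA : ∀ i j, SmallC1 l U 0 (A i j)) :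
    SmallC1 l U 0 (fun κ p => (Matrix.of fun i j => A i j κ p).det) := by
  simp only [Matrix.det_fin_three, Matrix.of_apply]
  have m := fun a b c d e g => ((hA a b).mul (hA c d)).mul (hA e g)
  exact (((((m _ _ _ _ _ _).sub (m _ _ _ _ _ _)).sub (m _ _ _ _ _ _)).add
    (m _ _ _ _ _ _)).add (m _ _ _ _ _ _)).sub (m _ _ _ _ _ _)

theorem SmallC1.adjugate {A : Fin 3 → Fin 3 → ℝ → ST → ℝ} (hA : ∀ i j, SmallC1 l U 0 (A i j))
    (i j : Fin 3) :
    SmallC1 l U 0 (fun κ p => (Matrix.of fun i j => A i j κ p).adjugate i j) := by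
  -- An entry of the adjugate is the determinant of the matrix with one row replaced by a basis
  -- vector.
  have := SmallC1.det (l := l) (U := U) (A := fun r s κ p => if r = j then (if s = i then 1 else 0)
    else A r s κ p) fun r s => by
      by_cases hr : r = j
      · simpa only [hr, if_true] using SmallC1.const _
      · simpa only [hr, if_false] using hA r s
  convert this using 4 with κ p
  rw [Matrix.adjugate_apply]
  congr 1
  ext r s
  by_cases hr : r = j
  · subst hr; simp [Pi.single_apply]
  · simp [hr]

end

section Fields

variable (P : GasParams) (f : ℝ → ℝ → E3 → Phase → ℝ) 

/-- Components of `Π - R T_eq I`. -/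
noncomputable def devF (i j : Fin 3) (κ : ℝ) (p : ST) : ℝ :=
  piF P f i j κ p - (if i = j then reqF P f κ p else 0)
/-- The determinant of `Π`. -/
noncomputable def detF (κ : ℝ) (p : ST) : ℝ := (relTensor P (f κ p.1 p.2)).det
/-- Components of `Π⁻¹`. -/
noncomputable def piInvF (i j : Fin 3) (κ : ℝ) (p : ST) : ℝ := (relTensor P (f κ p.1 p.2))⁻¹ i j
/-- Vibrational energy at the equilibrium temperature. -/
noncomputable def vibEqF (κ : ℝ) (p : ST) : ℝ := eVib P (eqF P f κ p)

end Fields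

namespace SolFamily

variable {P : GasParams} {Kn₀ : ℝ} {U : Set ST} {g : Phase → ℝ} {f : ℝ → ℝ → E3 → Phase → ℝ}
  (h : SolFamily P Kn₀ U g f) {l : Filter ℝ} (hl : ∀ᶠ κ in l, κ ∈ Ioo 0 Kn₀)

include h hl

theorem smallC1_dev (i j : Fin 3) : SmallC1 l U 1 (devF P f i j) := h.smallC1_pi_sub_req hl i j

theorem smallC1_pi (i j : Fin 3) : SmallC1 l U 0 (piF P f i j) :=
  h.smallC1_congr hl ((smallC1_mono hl zero_le_one (h.smallC1_pi_sub_th hl i j)).add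
    (h.smallC1_th hl i j)) fun κ hκ p hp => by ring

theorem smallC1_relRot : SmallC1 l U 0 (relRotF P f) :=
  h.smallC1_congr hl ((smallC1_mono hl zero_le_one (h.smallC1_relRot_sub_req hl)).add
    (h.smallC1_req hl)) fun κ hκ p hp => by ring

theorem smallC1_vibEq : SmallC1 l U 0 (vibEqF P f) := h.smallC1_eVib_eq hl

theorem smallC1_relVib : SmallC1 l U 0 (relVibF P f) :=
  h.smallC1_congr hl ((smallC1_mono hl zero_le_one (h.smallC1_relVib_sub_eq hl)).add
    (h.smallC1_vibEq hl)) fun κ hκ p hp => by simp only [vibEqF]; ring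

theorem smallC1_det : SmallC1 l U 0 (detF P f) := SmallC1.det (h.smallC1_pi hl)

omit h hl in
-- Expansion of det(θ I + S) in powers of S: the trace is the only linear term, and the principal
-- minors and det S are at least quadratic.
theorem detF_sub (κ : ℝ) (p : ST) : detF P f κ p - reqF P f κ p ^ 3
    = reqF P f κ p ^ 2 * (devF P f 0 0 κ p + devF P f 1 1 κ p + devF P f 2 2 κ p)
      + (reqF P f κ p * (devF P f 0 0 κ p * devF P f 1 1 κ p + devF P f 0 0 κ p * devF P f 2 2 κ p
        + devF P f 1 1 κ p * devF P f 2 2 κ p - devF P f 0 1 κ p * devF P f 1 0 κ p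
        - devF P f 0 2 κ p * devF P f 2 0 κ p - devF P f 1 2 κ p * devF P f 2 1 κ p)
        + (Matrix.of fun i j => devF P f i j κ p).det) := by
  simp only [detF, devF, piF, Matrix.det_fin_three, Matrix.of_apply, if_true,
    if_neg (show (0 : Fin 3) ≠ 1 by decide), if_neg (show (0 : Fin 3) ≠ 2 by decide),
    if_neg (show (1 : Fin 3) ≠ 0 by decide), if_neg (show (1 : Fin 3) ≠ 2 by decide),
    if_neg (show (2 : Fin 3) ≠ 0 by decide), if_neg (show (2 : Fin 3) ≠ 1 by decide)]
  ring

/-- The quadratic part of the determinant. -/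
theorem smallC1_detF_quad : SmallC1 l U 2 (fun κ p => detF P f κ p - reqF P f κ p ^ 3
    - reqF P f κ p ^ 2 * (devF P f 0 0 κ p + devF P f 1 1 κ p + devF P f 2 2 κ p)) := by
  have d := h.smallC1_dev hl
  have d2 : ∀ i j k m, SmallC1 l U 2 (fun κ p => devF P f i j κ p * devF P f k m κ p) :=
    fun i j k m => (d i j).mul (d k m)
  have d3 : ∀ i j k m r s, SmallC1 l U 2 (fun κ p => devF P f i j κ p * devF P f k m κ p
      * devF P f r s κ p) := fun i j k m r s =>
    smallC1_mono hl (by norm_num) ((d2 i j k m).mul (d r s))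
  have e1 : SmallC1 l U 2 (fun κ p => reqF P f κ p * (devF P f 0 0 κ p * devF P f 1 1 κ p
      + devF P f 0 0 κ p * devF P f 2 2 κ p
      + devF P f 1 1 κ p * devF P f 2 2 κ p - devF P f 0 1 κ p * devF P f 1 0 κ p
      - devF P f 0 2 κ p * devF P f 2 0 κ p - devF P f 1 2 κ p * devF P f 2 1 κ p)) :=
    (h.smallC1_req hl).mul ((((((d2 _ _ _ _).add (d2 _ _ _ _)).add (d2 _ _ _ _)).sub
      (d2 _ _ _ _)).sub (d2 _ _ _ _)).sub (d2 _ _ _ _))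
  have e2 : SmallC1 l U 2 (fun κ p => (Matrix.of fun i j => devF P f i j κ p).det) := by
    simp only [Matrix.det_fin_three, Matrix.of_apply]
    exact (((((d3 _ _ _ _ _ _).sub (d3 _ _ _ _ _ _)).sub (d3 _ _ _ _ _ _)).add
      (d3 _ _ _ _ _ _)).add (d3 _ _ _ _ _ _)).sub (d3 _ _ _ _ _ _)
  exact h.smallC1_congr hl (e1.add e2) fun κ _ p _ => by rw [detF_sub]; ring

theorem smallC1_req_pow (n : ℕ) : SmallC1 l U 0 (fun κ p => reqF P f κ p ^ n) := by
  induction n with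
  | zero => simpa using SmallC1.const 1
  | succ n ih => simpa only [pow_succ] using ih.mul (h.smallC1_req hl)

theorem unifPos_req_pow (n : ℕ) : UnifPos l U (fun κ p => reqF P f κ p ^ n) := by
  obtain ⟨m, hm, h1⟩ := h.unifPos_req hl
  exact ⟨m ^ n, by positivity, h1.mono fun q hq => pow_le_pow_left₀ hm.le hq n⟩

theorem smallC1_det_sub : SmallC1 l U 1 (fun κ p => detF P f κ p - reqF P f κ p ^ 3) := by
  have d := h.smallC1_dev hl
  have e : SmallC1 l U 1 (fun κ p => reqF P f κ p ^ 2 * (devF P f 0 0 κ p + devF P f 1 1 κ p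
      + devF P f 2 2 κ p)) := by
    simpa using (h.smallC1_req_pow hl 2).mul (((d 0 0).add (d 1 1)).add (d 2 2))
  exact h.smallC1_congr hl ((smallC1_mono hl (by norm_num) (h.smallC1_detF_quad hl)).add e)
    fun κ _ p _ => by ring

theorem unifPos_vibEq : UnifPos l U (vibEqF P f) :=
  SmallC1.unifPos_comp ((contDiffOn_eVib P).of_le (by norm_num)) (fun _ hx => eVib_pos P hx)
    (h.smallC1_eq hl) (h.unifPos_eq hl)

variable (h0 : l ≤ 𝓝 0)

include h0

theorem unifPos_det : UnifPos l U (detF P f) :=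
  UnifPos.of_sub h0 (h.unifPos_req_pow hl 3) (h.smallC1_det_sub hl)

theorem unifPos_relRot : UnifPos l U (relRotF P f) :=
  UnifPos.of_sub h0 (h.unifPos_req hl) (h.smallC1_relRot_sub_req hl)

theorem unifPos_relVib : UnifPos l U (relVibF P f) :=
  UnifPos.of_sub h0 (h.unifPos_vibEq hl) (h.smallC1_relVib_sub_eq hl)

theorem smallC1_piInv (i j : Fin 3) : SmallC1 l U 0 (piInvF P f i j) := by
  refine h.smallC1_congr hl (((h.smallC1_det hl).inv (h.unifPos_det hl h0)).mul
    (SmallC1.adjugate (h.smallC1_pi hl) i j)) fun κ _ p _ => ?_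
  rw [piInvF, Matrix.inv_def, Ring.inverse_eq_inv']
  rfl

omit hl h0 in
theorem piInv_mul_pi {κ : ℝ} (hκ : κ ∈ Ioo 0 Kn₀) {p : ST} (hp : p ∈ U) (i k : Fin 3) :
    ∑ j, piInvF P f i j κ p * piF P f j k κ p = if i = k then 1 else 0 := by
  have hpd := (h.sol κ hκ).relTensor_posDef _ _ hp
  have := congrFun (congrFun (Matrix.nonsing_inv_mul _
    ((Matrix.isUnit_iff_isUnit_det _).1 hpd.isUnit)) i) k
  rw [Matrix.mul_apply, Matrix.one_apply] at this
  exact this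

omit hl h0 in
-- Resolvent identity for Π = θ I + S: Π⁻¹ - θ⁻¹ I = -θ⁻¹ Π⁻¹ S.
theorem piInv_sub {κ : ℝ} (hκ : κ ∈ Ioo 0 Kn₀) {p : ST} (hp : p ∈ U) (i k : Fin 3) :
    piInvF P f i k κ p - (if i = k then (reqF P f κ p)⁻¹ else 0)
      = -(reqF P f κ p)⁻¹ * ∑ j, piInvF P f i j κ p * devF P f j k κ p := by
  have e := h.piInv_mul_pi hκ hp i k
  have hθ : reqF P f κ p ≠ 0 := (mul_pos P.R_pos (h.eqF_pos hκ hp)).ne'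
  have e1 : ∑ j, piInvF P f i j κ p * devF P f j k κ p
      = (if i = k then 1 else 0) - piInvF P f i k κ p * reqF P f κ p := by
    simp only [devF, mul_sub, Finset.sum_sub_distrib, e]
    simp
  rw [e1]
  split_ifs <;> field_simp <;> ring

theorem smallC1_piInv_sub (i k : Fin 3) : SmallC1 l U 1
    (fun κ p => piInvF P f i k κ p - (if i = k then (reqF P f κ p)⁻¹ else 0)) := by
  have e : ∀ j ∈ Finset.univ, SmallC1 l U 1 (fun κ p => piInvF P f i j κ p * devF P f j k κ p) :=
    fun j _ => by simpa using (h.smallC1_piInv hl h0 i j).mul (h.smallC1_dev hl j k)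
  refine h.smallC1_congr hl (by
    simpa using (((h.smallC1_req hl).inv (h.unifPos_req hl)).neg).mul (SmallC1.sum _ e))
    fun κ hκ p hp => (h.piInv_sub hκ hp i k).symm

/-- The resolvent identity with Π⁻¹ replaced by θ⁻¹ I + O(κ) on its right-hand side. -/
theorem piInv_expansion (i k : Fin 3) :
    (fun q : ℝ × ST => piInvF P f i k q.1 q.2 - (if i = k then (reqF P f q.1 q.2)⁻¹ else 0)
      + (reqF P f q.1 q.2)⁻¹ ^ 2 * devF P f i k q.1 q.2) =O[l ×ˢ 𝓟 U] fun q => q.1 ^ 2 := by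
  have e : ∀ j ∈ Finset.univ, SmallC1 l U 2 (fun κ p => (piInvF P f i j κ p
      - (if i = j then (reqF P f κ p)⁻¹ else 0)) * devF P f j k κ p) :=
    fun j _ => (h.smallC1_piInv_sub hl h0 i j).mul (h.smallC1_dev hl j k)
  have e2 := (((h.smallC1_req hl).inv (h.unifPos_req hl)).neg).mul (SmallC1.sum _ e)
  rw [zero_add] at e2
  refine e2.val.congr' ?_ EventuallyEq.rfl
  filter_upwards [eventually_mem hl] with q hq
  rw [h.piInv_sub hq.1 hq.2]
  simp only [sub_mul, ite_mul, zero_mul, Finset.sum_sub_distrib, Finset.sum_ite_eq,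
    Finset.mem_univ, if_true]
  ring

omit h hl h0 in
theorem contDiffOn_log : ContDiffOn ℝ 2 Real.log (Ioi 0) := fun _ hx =>
  (Real.contDiffAt_log.2 (ne_of_gt hx)).contDiffWithinAt

omit h hl h0 in
-- The logarithm of E + R T₀ enters through the vibrational normalization 1 - exp(-T₀ / T) = R T₀ /
-- (e_vib(T) + R T₀).
theorem contDiffOn_log_add {r : ℝ} (hr : 0 < r) :
    ContDiffOn ℝ 2 (fun x => Real.log (x + r)) (Ioi 0) := fun x hx =>
  ((Real.contDiffAt_log.2 (ne_of_gt (add_pos hx hr))).comp x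
    (contDiffAt_id.add contDiffAt_const)).contDiffWithinAt

omit h hl h0 in
theorem contDiffOn_inv_Ioi : ContDiffOn ℝ 2 (fun x : ℝ => x⁻¹) (Ioi 0) :=
  contDiffOn_inv ℝ |>.mono fun _ hx => ne_of_gt hx

theorem smallC1_log_det : SmallC1 l U 1
    (fun κ p => Real.log (detF P f κ p) - Real.log (reqF P f κ p ^ 3)) :=
  SmallC1.comp_sub contDiffOn_log (h.smallC1_det hl) (h.smallC1_req_pow hl 3)
    (h.unifPos_det hl h0) (h.unifPos_req_pow hl 3) (h.smallC1_det_sub hl)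

theorem log_det_expansion : (fun q : ℝ × ST => Real.log (detF P f q.1 q.2)
    - Real.log (reqF P f q.1 q.2 ^ 3) - (reqF P f q.1 q.2)⁻¹ * (devF P f 0 0 q.1 q.2
      + devF P f 1 1 q.1 q.2 + devF P f 2 2 q.1 q.2)) =O[l ×ˢ 𝓟 U] fun q => q.1 ^ 2 := by
  have h1 := (IsBigO.comp_sub_taylor contDiffOn_log (h.smallC1_det hl) (h.smallC1_req_pow hl 3)
    (h.unifPos_det hl h0) (h.unifPos_req_pow hl 3)).trans ((h.smallC1_det_sub hl).val_one.pow 2)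
  have h2 := (((h.smallC1_req_pow hl 3).inv (h.unifPos_req_pow hl 3)).mul
    (h.smallC1_detF_quad hl)).val
  rw [zero_add] at h2
  refine (h1.add h2).congr' ?_ EventuallyEq.rfl
  filter_upwards [(h.unifPos_req hl).pos] with q hq
  rw [Real.deriv_log]
  field_simp
  ring

theorem smallC1_log_rot : SmallC1 l U 1
    (fun κ p => Real.log (relRotF P f κ p) - Real.log (reqF P f κ p)) :=
  SmallC1.comp_sub contDiffOn_log (h.smallC1_relRot hl) (h.smallC1_req hl)
    (h.unifPos_relRot hl h0) (h.unifPos_req hl) (h.smallC1_relRot_sub_req hl)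

theorem log_rot_expansion : (fun q : ℝ × ST => Real.log (relRotF P f q.1 q.2)
    - Real.log (reqF P f q.1 q.2) - (reqF P f q.1 q.2)⁻¹
      * (relRotF P f q.1 q.2 - reqF P f q.1 q.2)) =O[l ×ˢ 𝓟 U] fun q => q.1 ^ 2 := by
  have h1 := (IsBigO.comp_sub_taylor contDiffOn_log (h.smallC1_relRot hl) (h.smallC1_req hl)
    (h.unifPos_relRot hl h0) (h.unifPos_req hl)).trans ((h.smallC1_relRot_sub_req hl).val_one.pow 2)
  simpa only [Real.deriv_log] using h1

theorem smallC1_inv_rot : SmallC1 l U 1 (fun κ p => (relRotF P f κ p)⁻¹ - (reqF P f κ p)⁻¹) :=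
  SmallC1.comp_sub contDiffOn_inv_Ioi (h.smallC1_relRot hl) (h.smallC1_req hl)
    (h.unifPos_relRot hl h0) (h.unifPos_req hl) (h.smallC1_relRot_sub_req hl)

theorem inv_rot_expansion : (fun q : ℝ × ST => (relRotF P f q.1 q.2)⁻¹
    - (reqF P f q.1 q.2)⁻¹ + (reqF P f q.1 q.2)⁻¹ ^ 2
      * (relRotF P f q.1 q.2 - reqF P f q.1 q.2)) =O[l ×ˢ 𝓟 U] fun q => q.1 ^ 2 := by
  have h1 := (IsBigO.comp_sub_taylor contDiffOn_inv_Ioi (h.smallC1_relRot hl) (h.smallC1_req hl)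
    (h.unifPos_relRot hl h0) (h.unifPos_req hl)).trans ((h.smallC1_relRot_sub_req hl).val_one.pow 2)
  refine h1.congr_left fun q => ?_
  rw [deriv_inv, inv_pow]; ring

theorem smallC1_log_vib : SmallC1 l U 1
    (fun κ p => Real.log (relVibF P f κ p) - Real.log (vibEqF P f κ p)) :=
  SmallC1.comp_sub contDiffOn_log (h.smallC1_relVib hl) (h.smallC1_vibEq hl)
    (h.unifPos_relVib hl h0) (h.unifPos_vibEq hl) (h.smallC1_relVib_sub_eq hl)

theorem log_vib_expansion : (fun q : ℝ × ST => Real.log (relVibF P f q.1 q.2)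
    - Real.log (vibEqF P f q.1 q.2) - (vibEqF P f q.1 q.2)⁻¹
      * (relVibF P f q.1 q.2 - vibEqF P f q.1 q.2)) =O[l ×ˢ 𝓟 U] fun q => q.1 ^ 2 := by
  have h1 := (IsBigO.comp_sub_taylor contDiffOn_log (h.smallC1_relVib hl) (h.smallC1_vibEq hl)
    (h.unifPos_relVib hl h0) (h.unifPos_vibEq hl)).trans ((h.smallC1_relVib_sub_eq hl).val_one.pow 2)
  simpa only [Real.deriv_log] using h1

theorem smallC1_log_vib_add : SmallC1 l U 1 (fun κ p => Real.log (relVibF P f κ p + P.R * P.T₀)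
    - Real.log (vibEqF P f κ p + P.R * P.T₀)) :=
  SmallC1.comp_sub (Φ := fun x => Real.log (x + P.R * P.T₀)) (contDiffOn_log_add (mul_pos P.R_pos P.T₀_pos)) (h.smallC1_relVib hl)
    (h.smallC1_vibEq hl) (h.unifPos_relVib hl h0) (h.unifPos_vibEq hl) (h.smallC1_relVib_sub_eq hl)

theorem log_vib_add_expansion : (fun q : ℝ × ST => Real.log (relVibF P f q.1 q.2 + P.R * P.T₀)
    - Real.log (vibEqF P f q.1 q.2 + P.R * P.T₀) - (vibEqF P f q.1 q.2 + P.R * P.T₀)⁻¹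
      * (relVibF P f q.1 q.2 - vibEqF P f q.1 q.2)) =O[l ×ˢ 𝓟 U] fun q => q.1 ^ 2 := by
  have h1 := (IsBigO.comp_sub_taylor (contDiffOn_log_add (mul_pos P.R_pos P.T₀_pos))
    (h.smallC1_relVib hl) (h.smallC1_vibEq hl) (h.unifPos_relVib hl h0)
    (h.unifPos_vibEq hl)).trans ((h.smallC1_relVib_sub_eq hl).val_one.pow 2)
  have e : ∀ x, deriv (fun x => Real.log (x + P.R * P.T₀)) x = (x + P.R * P.T₀)⁻¹ := fun x => by
    rw [deriv_comp_add_const (f := Real.log), Real.deriv_log]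
  simpa only [e] using h1

end SolFamily

/-! ### Fields with polynomial growth in the microscopic variables -/

/-- `√(1 + |v|² + ε + i)`. -/
noncomputable def growth (z : Phase) : ℝ := √(1 + ‖z.1‖ ^ 2 + z.2.1 + (z.2.2 : ℝ))

theorem growth_sq {z : Phase} (hz : 0 ≤ z.2.1) :
    growth z ^ 2 = 1 + ‖z.1‖ ^ 2 + z.2.1 + (z.2.2 : ℝ) :=
  Real.sq_sqrt (by positivity)

theorem one_le_growth {z : Phase} (hz : 0 ≤ z.2.1) : 1 ≤ growth z := by
  refine Real.one_le_sqrt.2 ?_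
  have : (0 : ℝ) ≤ ‖z.1‖ ^ 2 + z.2.1 + (z.2.2 : ℝ) := by positivity
  linarith

theorem norm_le_growth {z : Phase} (hz : 0 ≤ z.2.1) : ‖z.1‖ ≤ growth z := by
  refine Real.le_sqrt_of_sq_le ?_
  have : (0 : ℝ) ≤ z.2.1 + (z.2.2 : ℝ) := by positivity
  linarith

/-- `A = O(κ ^ k)` with growth of order `m` in the microscopic variables. -/
def PhO (l : Filter ℝ) (U : Set ST) (k m : ℕ) (A : ℝ → ST → Phase → ℝ) : Prop :=
  ∃ C, 0 ≤ C ∧ ∀ᶠ q in l ×ˢ 𝓟 U, ∀ z : Phase, 0 ≤ z.2.1 →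
    |A q.1 q.2 z| ≤ C * (|q.1| ^ k * growth z ^ m)

/-- `A` and its transport derivative are `O(κ ^ k)`, with growth in the microscopic variables. -/
structure PhC1 (l : Filter ℝ) (U : Set ST) (k m : ℕ) (A : ℝ → ST → Phase → ℝ) : Prop where
  diff : ∀ᶠ q in l ×ˢ 𝓟 U, ∀ z : Phase, 0 ≤ z.2.1 → DifferentiableAt ℝ (fun p => A q.1 p z) q.2
  val : PhO l U k m A
  der : PhO l U k (m + 1) (fun κ p z => fderiv ℝ (fun p => A κ p z) p (1, z.1))

section

variable {l : Filter ℝ} {U : Set ST} {k k' m m' : ℕ} {A B : ℝ → ST → Phase → ℝ} {a : ℝ → ST → ℝ}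

theorem PhO.add (hA : PhO l U k m A) (hB : PhO l U k m B) :
    PhO l U k m (fun κ p z => A κ p z + B κ p z) := by
  obtain ⟨C, hC, h1⟩ := hA
  obtain ⟨D, hD, h2⟩ := hB
  refine ⟨C + D, by positivity, ?_⟩
  filter_upwards [h1, h2] with q h1 h2 z hz
  rw [add_mul]
  exact (abs_add_le _ _).trans (add_le_add (h1 z hz) (h2 z hz))

theorem PhO.mul (hA : PhO l U k m A) (hB : PhO l U k' m' B) :
    PhO l U (k + k') (m + m') (fun κ p z => A κ p z * B κ p z) := by
  obtain ⟨C, hC, h1⟩ := hA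
  obtain ⟨D, hD, h2⟩ := hB
  refine ⟨C * D, by positivity, ?_⟩
  filter_upwards [h1, h2] with q h1 h2 z hz
  have := one_le_growth hz
  rw [abs_mul]
  calc _ ≤ (C * (|q.1| ^ k * growth z ^ m)) * (D * (|q.1| ^ k' * growth z ^ m')) :=
        mul_le_mul (h1 z hz) (h2 z hz) (abs_nonneg _) (by positivity)
    _ = _ := by rw [pow_add, pow_add]; ring

theorem PhO.mono (hm : m ≤ m') (hA : PhO l U k m A) : PhO l U k m' A := by
  obtain ⟨C, hC, h1⟩ := hA
  refine ⟨C, hC, h1.mono fun q h z hz => (h z hz).trans ?_⟩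
  have := pow_le_pow_right₀ (one_le_growth hz) hm
  gcongr

theorem PhO.of_field (ha : (fun q : ℝ × ST => a q.1 q.2) =O[l ×ˢ 𝓟 U] fun q => q.1 ^ k) :
    PhO l U k 0 (fun κ p _ => a κ p) := by
  obtain ⟨C, hC⟩ := ha.bound
  refine ⟨max C 0, le_max_right _ _, ?_⟩
  filter_upwards [hC] with q h z hz
  rw [Real.norm_eq_abs, norm_pow, Real.norm_eq_abs] at h
  rw [pow_zero, mul_one]
  exact h.trans (by gcongr; exact le_max_left _ _)

theorem PhO.congr (hA : PhO l U k m A)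
    (h : ∀ᶠ q in l ×ˢ 𝓟 U, ∀ z : Phase, 0 ≤ z.2.1 → A q.1 q.2 z = B q.1 q.2 z) :
    PhO l U k m B := by
  obtain ⟨C, hC, h1⟩ := hA
  refine ⟨C, hC, ?_⟩
  filter_upwards [h, h1] with q h h1 z hz
  rw [← h z hz]; exact h1 z hz

theorem PhO.const (r : ℝ) : PhO l U 0 0 (fun _ _ _ => r) :=
  PhO.of_field (by simpa using isBigO_const_const r (one_ne_zero (α := ℝ)) (l ×ˢ 𝓟 U))

theorem PhO.const_mul (r : ℝ) (hA : PhO l U k m A) : PhO l U k m (fun κ p z => r * A κ p z) := by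
  simpa using (PhO.const r).mul hA

theorem PhO.neg (hA : PhO l U k m A) : PhO l U k m (fun κ p z => - A κ p z) := by
  simpa using hA.const_mul (-1)

theorem PhO.sub (hA : PhO l U k m A) (hB : PhO l U k m B) :
    PhO l U k m (fun κ p z => A κ p z - B κ p z) := by
  simpa [sub_eq_add_neg] using hA.add hB.neg

theorem PhO.sum {ι : Type*} (s : Finset ι) {A : ι → ℝ → ST → Phase → ℝ}
    (h : ∀ i ∈ s, PhO l U k m (A i)) : PhO l U k m (fun κ p z => ∑ i ∈ s, A i κ p z) := by
  classical
  induction s using Finset.induction_on with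
  | empty => exact ⟨0, le_rfl, Eventually.of_forall fun q z _ => by simp⟩
  | insert i s hi ih =>
    simp only [Finset.sum_insert hi]
    exact (h i (Finset.mem_insert_self _ _)).add
      (ih fun j hj => h j (Finset.mem_insert_of_mem hj))

theorem PhO.field_mul (ha : (fun q : ℝ × ST => a q.1 q.2) =O[l ×ˢ 𝓟 U] fun q => q.1 ^ k)
    (hA : PhO l U 0 m A) : PhO l U k m (fun κ p z => a κ p * A κ p z) := by
  simpa using (PhO.of_field ha).mul hA

/-- The direction (1, v) costs one order of growth. -/
theorem PhO.dir (ha : (fun q : ℝ × ST => fderiv ℝ (a q.1) q.2) =O[l ×ˢ 𝓟 U] fun q => q.1 ^ k) :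
    PhO l U k 1 (fun κ p z => fderiv ℝ (a κ) p (1, z.1)) := by
  obtain ⟨C, hC⟩ := ha.bound
  refine ⟨2 * max C 0, by positivity, ?_⟩
  filter_upwards [hC] with q h z hz
  rw [norm_pow, Real.norm_eq_abs] at h
  have h1 := (fderiv ℝ (a q.1) q.2).le_opNorm (1, z.1)
  have h2 : ‖((1 : ℝ), z.1)‖ ≤ 2 * growth z := by
    refine (norm_dir_le z.1).trans ?_
    linarith [one_le_growth hz, norm_le_growth hz]
  have h3 := one_le_growth hz
  calc _ ≤ _ := h1
    _ ≤ (max C 0 * |q.1| ^ k) * (2 * growth z) := by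
      gcongr
      exact h.trans (by gcongr; exact le_max_left _ _)
    _ = _ := by ring

theorem PhC1.of_field (ha : SmallC1 l U k a) : PhC1 l U k 0 (fun κ p _ => a κ p) where
  diff := ha.diff.mono fun _ h _ _ => h
  val := PhO.of_field ha.val
  der := PhO.dir ha.der

theorem PhC1.of_phase {ψ : Phase → ℝ} (h : ∀ z : Phase, 0 ≤ z.2.1 → |ψ z| ≤ growth z ^ m) :
    PhC1 l U 0 m (fun _ _ z => ψ z) where
  diff := Eventually.of_forall fun _ _ _ => differentiableAt_const _
  val := ⟨1, zero_le_one, Eventually.of_forall fun q z hz => by simpa using h z hz⟩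
  der := ⟨0, le_rfl, Eventually.of_forall fun q z hz => by simp⟩

theorem PhC1.mono (hm : m ≤ m') (hA : PhC1 l U k m A) : PhC1 l U k m' A :=
  ⟨hA.diff, hA.val.mono hm, hA.der.mono (by omega)⟩

theorem PhC1.add (hA : PhC1 l U k m A) (hB : PhC1 l U k m B) :
    PhC1 l U k m (fun κ p z => A κ p z + B κ p z) where
  diff := by filter_upwards [hA.diff, hB.diff] with q h1 h2 z hz using (h1 z hz).add (h2 z hz)
  val := hA.val.add hB.val
  der := (hA.der.add hB.der).congr <| by
    filter_upwards [hA.diff, hB.diff] with q h1 h2 z hz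
    exact (fderiv_add_apply (h1 z hz) (h2 z hz) _).symm

theorem PhC1.mul (hA : PhC1 l U k m A) (hB : PhC1 l U k' m' B) :
    PhC1 l U (k + k') (m + m') (fun κ p z => A κ p z * B κ p z) where
  diff := by filter_upwards [hA.diff, hB.diff] with q h1 h2 z hz using (h1 z hz).mul (h2 z hz)
  val := hA.val.mul hB.val
  der := by
    have e2 := hA.der.mul hB.val
    rw [show m + 1 + m' = m + m' + 1 by omega] at e2
    refine ((hA.val.mul hB.der).add e2).congr ?_
    filter_upwards [hA.diff, hB.diff] with q h1 h2 z hz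
    rw [fderiv_mul_apply (h1 z hz) (h2 z hz)]
    ring

theorem PhC1.const_mul (r : ℝ) (hA : PhC1 l U k m A) :
    PhC1 l U k m (fun κ p z => r * A κ p z) := by
  simpa using (PhC1.of_field (SmallC1.const r)).mul hA

theorem PhC1.field_mul (ha : SmallC1 l U k a) (hA : PhC1 l U 0 m A) :
    PhC1 l U k m (fun κ p z => a κ p * A κ p z) := by
  simpa using (PhC1.of_field ha).mul hA

theorem PhC1.sum {ι : Type*} (s : Finset ι) {A : ι → ℝ → ST → Phase → ℝ}
    (h : ∀ i ∈ s, PhC1 l U k m (A i)) : PhC1 l U k m (fun κ p z => ∑ i ∈ s, A i κ p z) := by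
  classical
  induction s using Finset.induction_on with
  | empty =>
    exact ⟨Eventually.of_forall fun q z _ => by simp,
      ⟨0, le_rfl, Eventually.of_forall fun q z _ => by simp⟩,
      ⟨0, le_rfl, Eventually.of_forall fun q z _ => by simp⟩⟩
  | insert i s hi ih =>
    simp only [Finset.sum_insert hi]
    exact (h i (Finset.mem_insert_self _ _)).add
      (ih fun j hj => h j (Finset.mem_insert_of_mem hj))

theorem phC1_coord (i : Fin 3) : PhC1 l U 0 1 (fun _ _ z => z.1 i) :=
  PhC1.of_phase fun z hz => by
    rw [pow_one]; exact (abs_coord_le z.1 i).trans (norm_le_growth hz)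

/-- Growth is measured on the scale of velocities, so an energy counts twice. -/
theorem phC1_rot : PhC1 l U 0 2 (fun _ _ z => z.2.1) :=
  PhC1.of_phase fun z hz => by
    rw [growth_sq hz, abs_of_nonneg hz]
    have : (0 : ℝ) ≤ ‖z.1‖ ^ 2 + (z.2.2 : ℝ) := by positivity
    linarith

theorem phC1_vib : PhC1 l U 0 2 (fun _ _ z => (z.2.2 : ℝ)) :=
  PhC1.of_phase fun z hz => by
    rw [growth_sq hz, Nat.abs_cast]
    have : (0 : ℝ) ≤ ‖z.1‖ ^ 2 := by positivity
    linarith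

end

section Fields

variable (P : GasParams) (f : ℝ → ℝ → E3 → Phase → ℝ)

/-- Components of the peculiar velocity. -/
noncomputable def pecF (i : Fin 3) (κ : ℝ) (p : ST) (z : Phase) : ℝ := z.1 i - velF f i κ p

/-- Leading coefficient of `Π - R T_eq I`. -/
noncomputable def leadPi (i k : Fin 3) (κ : ℝ) (p : ST) : ℝ :=
  reqF P f κ p * (tauF P f κ p * (1 - P.Pr)
    * (fderiv ℝ (velF f i κ) p (dirX k) + fderiv ℝ (velF f k κ) p (dirX i))
    + if i = k then divF f κ p * (tauF P f κ p * (2 * P.Pr / 3 - P.R / cvF P f κ p)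
      - zF P f κ p) else 0)

/-- Leading coefficient of the relaxation rotational energy. -/
noncomputable def leadRot (κ : ℝ) (p : ST) : ℝ :=
  reqF P f κ p * divF f κ p
    * ((tauRotF P f κ p - tauF P f κ p) * P.R / cvF P f κ p - zF P f κ p)

/-- Leading coefficient of the relaxation vibrational energy. -/
noncomputable def leadVib (κ : ℝ) (p : ST) : ℝ :=
  cVibF P f κ p * eqF P f κ p * divF f κ p
    * ((tauVibF P f κ p - tauF P f κ p) * P.R / cvF P f κ p - zF P f κ p)

/-- The logarithm of the ratio of the Gaussian and the Maxwellian. -/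
noncomputable def logRatio (κ : ℝ) (p : ST) (z : Phase) : ℝ :=
  -1 / 2 * (Real.log (detF P f κ p) - Real.log (reqF P f κ p ^ 3))
    + -1 * (Real.log (relRotF P f κ p) - Real.log (reqF P f κ p))
    + -1 * (Real.log (relVibF P f κ p + P.R * P.T₀) - Real.log (vibEqF P f κ p + P.R * P.T₀))
    + -1 / 2 * ∑ i, ∑ j, (piInvF P f i j κ p - if i = j then (reqF P f κ p)⁻¹ else 0)
      * (pecF f i κ p z * pecF f j κ p z)
    + -1 * (((relRotF P f κ p)⁻¹ - (reqF P f κ p)⁻¹) * z.2.1)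
    + (Real.log (relVibF P f κ p) - Real.log (vibEqF P f κ p)) * (z.2.2 : ℝ)
    + -1 * ((Real.log (relVibF P f κ p + P.R * P.T₀) - Real.log (vibEqF P f κ p + P.R * P.T₀))
      * (z.2.2 : ℝ))

/-- The first-order coefficient of `logRatio`. -/
noncomputable def leadRatio (κ : ℝ) (p : ST) (z : Phase) : ℝ :=
  -1 / 2 * ((reqF P f κ p)⁻¹ * (leadPi P f 0 0 κ p + leadPi P f 1 1 κ p + leadPi P f 2 2 κ p))
    + -1 * ((reqF P f κ p)⁻¹ * leadRot P f κ p)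
    + -1 * ((vibEqF P f κ p + P.R * P.T₀)⁻¹ * leadVib P f κ p)
    + 1 / 2 * ∑ i, ∑ j, (reqF P f κ p)⁻¹ ^ 2 * leadPi P f i j κ p
      * (pecF f i κ p z * pecF f j κ p z)
    + (reqF P f κ p)⁻¹ ^ 2 * leadRot P f κ p * z.2.1
    + (vibEqF P f κ p)⁻¹ * leadVib P f κ p * (z.2.2 : ℝ)
    + -1 * ((vibEqF P f κ p + P.R * P.T₀)⁻¹ * leadVib P f κ p * (z.2.2 : ℝ))

end Fields

namespace SolFamily

variable {P : GasParams} {Kn₀ : ℝ} {U : Set ST} {g : Phase → ℝ} {f : ℝ → ℝ → E3 → Phase → ℝ}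
  (h : SolFamily P Kn₀ U g f) {l : Filter ℝ} (hl : ∀ᶠ κ in l, κ ∈ Ioo 0 Kn₀)

include h hl

theorem phC1_pec (i : Fin 3) : PhC1 l U 0 1 (pecF f i) := by
  have e := (phC1_coord (l := l) (U := U) i).add
    (((PhC1.of_field (h.smallC1_vel hl i)).mono zero_le_one).const_mul (-1))
  have e2 : (fun κ p (z : Phase) => z.1 i + -1 * velF f i κ p) = pecF f i := by
    funext κ p z; rw [pecF]; ring
  rwa [e2] at e

theorem phC1_pec_mul (i j : Fin 3) :
    PhC1 l U 0 2 (fun κ p z => pecF f i κ p z * pecF f j κ p z) :=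
  (h.phC1_pec hl i).mul (h.phC1_pec hl j)

variable (h0 : l ≤ 𝓝 0)

include h0

/-- Not only log(G/M) but also its transport derivative is O(κ), because the coefficients are small
with their derivatives. Hence D log G may be replaced by D log M to leading order. -/
theorem phC1_logRatio : PhC1 l U 1 2 (logRatio P f) := by
  have fld : ∀ {a : ℝ → ST → ℝ}, SmallC1 l U 1 a → PhC1 l U 1 2 (fun κ p _ => a κ p) :=
    fun ha => (PhC1.of_field ha).mono (by norm_num)
  exact (((((((fld (h.smallC1_log_det hl h0)).const_mul _).add
    ((fld (h.smallC1_log_rot hl h0)).const_mul _)).add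
    ((fld (h.smallC1_log_vib_add hl h0)).const_mul _)).add
    ((PhC1.sum _ fun i _ => PhC1.sum _ fun j _ => PhC1.field_mul (h.smallC1_piInv_sub hl h0 i j)
      (h.phC1_pec_mul hl i j)).const_mul _)).add
    ((PhC1.field_mul (h.smallC1_inv_rot hl h0) phC1_rot).const_mul _)).add
    (PhC1.field_mul (h.smallC1_log_vib hl h0) phC1_vib)).add
    ((PhC1.field_mul (h.smallC1_log_vib_add hl h0) phC1_vib).const_mul _)

theorem logRatio_expansion :
    PhO l U 2 2 (fun κ p z => logRatio P f κ p z - κ * leadRatio P f κ p z) := by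
  have fld : ∀ {B : ℝ × ST → ℝ}, B =O[l ×ˢ 𝓟 U] (fun q => q.1 ^ 2) →
      PhO l U 2 2 (fun κ p _ => B (κ, p)) := fun {B} hB =>
    (PhO.of_field (a := fun κ p => B (κ, p)) hB).mono (by norm_num)
  have fmul : ∀ {B : ℝ × ST → ℝ} {A : ℝ → ST → Phase → ℝ}, B =O[l ×ˢ 𝓟 U] (fun q => q.1 ^ 2) →
      PhO l U 0 2 A → PhO l U 2 2 (fun κ p z => B (κ, p) * A κ p z) := fun {B} _ hB hA =>
    PhO.field_mul (a := fun κ p => B (κ, p)) hB hA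
  have hθ := (h.smallC1_req hl).inv (h.unifPos_req hl)
  have hE := (h.smallC1_vibEq hl).inv (h.unifPos_vibEq hl)
  have hEr : SmallC1 l U 0 (fun κ p => (vibEqF P f κ p + P.R * P.T₀)⁻¹) := by
    refine ((h.smallC1_vibEq hl).add (SmallC1.const _)).inv ?_
    obtain ⟨m, hm, h1⟩ := h.unifPos_vibEq hl
    refine ⟨m, hm, h1.mono fun q hq => ?_⟩
    have := mul_pos P.R_pos P.T₀_pos
    linarith
  have bmul : ∀ {a : ℝ → ST → ℝ} {B : ℝ × ST → ℝ}, SmallC1 l U 0 a →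
      B =O[l ×ˢ 𝓟 U] (fun q => q.1 ^ 2) →
      (fun q : ℝ × ST => a q.1 q.2 * B q) =O[l ×ˢ 𝓟 U] (fun q => q.1 ^ 2) :=
    fun ha hb => by simpa using ha.bdd.mul hb
  have eS : ∀ i j, (fun q : ℝ × ST => devF P f i j q.1 q.2 - q.1 * leadPi P f i j q.1 q.2)
      =O[l ×ˢ 𝓟 U] (fun q => q.1 ^ 2) := fun i j => h.pi_expansion hl i j
  have eR : (fun q : ℝ × ST => relRotF P f q.1 q.2 - reqF P f q.1 q.2
      - q.1 * leadRot P f q.1 q.2) =O[l ×ˢ 𝓟 U] (fun q => q.1 ^ 2) := h.relRot_expansion hl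
  have eV : (fun q : ℝ × ST => relVibF P f q.1 q.2 - vibEqF P f q.1 q.2
      - q.1 * leadVib P f q.1 q.2) =O[l ×ˢ 𝓟 U] (fun q => q.1 ^ 2) := h.relVib_expansion hl
  -- Each of the following adds to the linearization of a coefficient the expansion of the deviation
  -- that occurs in it.
  have t1 := (h.log_det_expansion hl h0).add (bmul hθ (((eS 0 0).add (eS 1 1)).add (eS 2 2)))
  have t2 := (h.log_rot_expansion hl h0).add (bmul hθ eR)
  have t3 := (h.log_vib_add_expansion hl h0).add (bmul hEr eV)
  have t4 := fun i j => (h.piInv_expansion hl h0 i j).sub (bmul (hθ.mul hθ) (eS i j))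
  have t5 := (h.inv_rot_expansion hl h0).sub (bmul (hθ.mul hθ) eR)
  have t6 := (h.log_vib_expansion hl h0).add (bmul hE eV)
  refine ((((((((fld t1).const_mul (-1 / 2)).add ((fld t2).const_mul (-1))).add
    ((fld t3).const_mul (-1))).add
    ((PhO.sum Finset.univ fun i _ => PhO.sum Finset.univ fun j _ => fmul (t4 i j)
      (h.phC1_pec_mul hl i j).val).const_mul (-1 / 2))).add
    ((fmul t5 phC1_rot.val).const_mul (-1))).add
    (fmul t6 phC1_vib.val)).add
    ((fmul t3 phC1_vib.val).const_mul (-1))).congr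
    (Eventually.of_forall fun q z _ => ?_)
  simp only [logRatio, leadRatio, Fin.sum_univ_three]
  ring

end SolFamily

/-! ### Exponential form of the Gaussian and of the Maxwellian -/

section

variable (P : GasParams)

theorem exp_div_eq {T : ℝ} (hT : 0 < T) : Real.exp (P.T₀ / T) = 1 + P.R * P.T₀ / eVib P T := by
  have := exp_sub_one_pos P hT
  have := P.R_pos; have := P.T₀_pos
  rw [eVib, div_div_cancel₀ (by positivity)]
  ring

/-- The vibrational exponent as a function of the energy alone: relaxation energies can then be
inserted directly, without expanding the relaxation temperature. -/
theorem div_eq_log_sub {T : ℝ} (hT : 0 < T) :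
    P.T₀ / T = Real.log (eVib P T + P.R * P.T₀) - Real.log (eVib P T) := by
  have hE := eVib_pos P hT
  have := P.R_pos; have := P.T₀_pos
  rw [← Real.log_div (by positivity) hE.ne', add_div, div_self hE.ne', ← exp_div_eq P hT,
    Real.log_exp]

theorem vibDensity_eq_exp {T : ℝ} (hT : 0 < T) (i : ℕ) : vibDensity P T i
    = Real.exp (Real.log (P.R * P.T₀) - Real.log (eVib P T + P.R * P.T₀) - P.T₀ / T * i) := by
  have hE := eVib_pos P hT
  have := P.R_pos; have := P.T₀_pos
  have e : 1 - Real.exp (-P.T₀ / T) = P.R * P.T₀ / (eVib P T + P.R * P.T₀) := by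
    rw [neg_div, Real.exp_neg, exp_div_eq P hT]
    field_simp
    ring
  rw [vibDensity, e, Real.exp_sub _ (P.T₀ / T * i), Real.exp_sub, Real.exp_log (by positivity),
    Real.exp_log (by positivity), div_eq_mul_inv (_ / _), ← Real.exp_neg]
  congr 2
  ring

theorem rotDensity_eq_exp {T : ℝ} (hT : 0 < T) (ε : ℝ) : rotDensity P T ε
    = Real.exp (-Real.log (P.R * T) - (P.R * T)⁻¹ * ε) := by
  have := P.R_pos
  rw [rotDensity_eq, sub_eq_add_neg, Real.exp_add,
    Real.exp_neg (Real.log _), Real.exp_log (by positivity), one_div]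

theorem maxwellTr_eq_exp {φ : Phase → ℝ} (hρ : 0 < density φ) (hT : 0 < tempEq P φ) (v : E3) :
    maxwellTr P φ v = Real.exp (Real.log (density φ)
      - 3 / 2 * (Real.log (2 * Real.pi) + Real.log (P.R * tempEq P φ))
      - 1 / 2 * ((P.R * tempEq P φ)⁻¹ * ∑ i, (v - velocity φ) i * (v - velocity φ) i)) := by
  have := P.R_pos; have := Real.pi_pos
  rw [maxwellTr, mul_assoc (2 * Real.pi), Real.exp_sub, Real.exp_sub, Real.exp_log hρ, mul_comm (3 / 2 : ℝ),
    ← Real.log_mul (by positivity) (by positivity), ← Real.rpow_def_of_pos (by positivity),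
    EuclideanSpace.real_norm_sq_eq, div_eq_mul_inv _ (Real.exp (1 / 2 * _)), ← Real.exp_neg]
  congr 2
  · simp only [sq]; field_simp

theorem gaussTr_eq_exp {φ : Phase → ℝ} (hρ : 0 < density φ) (hd : 0 < (relTensor P φ).det)
    (v : E3) : gaussTr P φ v = Real.exp (Real.log (density φ)
      - 1 / 2 * (3 * Real.log (2 * Real.pi) + Real.log (relTensor P φ).det)
      - 1 / 2 * ∑ i, ∑ j, (relTensor P φ)⁻¹ i j * ((v - velocity φ) i * (v - velocity φ) j)) := by
  have := Real.pi_pos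
  have e : √((2 * Real.pi) • relTensor P φ).det
      = Real.exp (1 / 2 * (3 * Real.log (2 * Real.pi) + Real.log (relTensor P φ).det)) := by
    rw [Matrix.det_smul, Fintype.card_fin, Real.sqrt_eq_rpow, Real.rpow_def_of_pos (by positivity),
      Real.log_mul (by positivity) hd.ne', Real.log_pow]
    congr 1
    push_cast
    ring
  rw [gaussTr, e, Real.exp_sub, Real.exp_sub, Real.exp_log hρ, div_eq_mul_inv _ (Real.exp (1 / 2 *
    ∑ i, _)), ← Real.exp_neg]
  congr 2
  rw [neg_mul]
  congr 2
  exact Finset.sum_congr rfl fun i _ => Finset.sum_congr rfl fun j _ => by ring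

variable (f : ℝ → ℝ → E3 → Phase → ℝ)

/-- The logarithm of the Maxwellian. -/
noncomputable def logMax (κ : ℝ) (p : ST) (z : Phase) : ℝ :=
  Real.log (rhoF f κ p) + -5 / 2 * Real.log (reqF P f κ p)
    + -1 * Real.log (vibEqF P f κ p + P.R * P.T₀)
    + (Real.log (P.R * P.T₀) - 3 / 2 * Real.log (2 * Real.pi))
    + -1 / 2 * ((reqF P f κ p)⁻¹ * ∑ i, pecF f i κ p z * pecF f i κ p z)
    + -1 * ((reqF P f κ p)⁻¹ * z.2.1) + -P.T₀ * ((eqF P f κ p)⁻¹ * (z.2.2 : ℝ))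

end

namespace SolFamily

variable {P : GasParams} {Kn₀ : ℝ} {U : Set ST} {g : Phase → ℝ} {f : ℝ → ℝ → E3 → Phase → ℝ}
  (h : SolFamily P Kn₀ U g f)

section

variable {κ : ℝ} (hκ : κ ∈ Ioo 0 Kn₀) {p : ST} (hp : p ∈ U)

include h hκ hp

theorem maxwellian_eq_exp (z : Phase) :
    maxwellian P (f κ p.1 p.2) z = Real.exp (logMax P f κ p z) := by
  have hT : 0 < tempEq P (f κ p.1 p.2) := h.eqF_pos hκ hp
  rw [maxwellian, maxwellTr_eq_exp P (h.density_pos hκ hp) hT, rotDensity_eq_exp P hT,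
    vibDensity_eq_exp P hT, ← Real.exp_add, ← Real.exp_add]
  congr 1
  simp only [logMax, rhoF, reqF, vibEqF, eqF, pecF, velF, PiLp.sub_apply]
  ring

theorem gaussian_eq_exp (z : Phase) : gaussian P (f κ p.1 p.2) z
    = Real.exp (logMax P f κ p z + logRatio P f κ p z) := by
  have hs := h.sol κ hκ
  have hT : 0 < tempEq P (f κ p.1 p.2) := h.eqF_pos hκ hp
  have hrot := hs.relEnergyRot_pos _ _ hp
  have hvib := hs.relEnergyVib_pos _ _ hp
  have hθ : 0 < P.R * tempEq P (f κ p.1 p.2) := mul_pos P.R_pos hT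
  -- Both exponents are expressed through energies, so that their difference is the coefficient of i
  -- in `logRatio`.
  have e1 := div_eq_log_sub P (relTempVib_pos hvib)
  have e2 := div_eq_log_sub P hT
  rw [gaussian, gaussTr_eq_exp P (h.density_pos hκ hp) (hs.relTensor_posDef _ _ hp).det_pos,
    rotDensity_eq_exp P (relTempRot_pos hrot),
    vibDensity_eq_exp P (relTempVib_pos hvib), ← Real.exp_add, ← Real.exp_add]
  rw [eVib_relTempVib hvib] at e1 ⊢
  rw [mul_relTempRot, e1]
  have e3 : -P.T₀ * ((eqF P f κ p)⁻¹ * (z.2.2 : ℝ)) = -(P.T₀ / eqF P f κ p * z.2.2) := by ring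
  congr 1
  rw [logMax, logRatio, e3]
  simp only [eqF]
  rw [e2]
  simp only [sub_mul, ite_mul, zero_mul, Finset.sum_sub_distrib, Finset.sum_ite_eq,
    Finset.mem_univ, if_true, ← Finset.mul_sum]
  simp only [rhoF, reqF, vibEqF, eqF, pecF, velF, relRotF, relVibF, detF, piInvF, PiLp.sub_apply,
    Real.log_pow]
  push_cast
  ring

end

variable {l : Filter ℝ} (hl : ∀ᶠ κ in l, κ ∈ Ioo 0 Kn₀)

include h hl

theorem phC1_logMax : PhC1 l U 0 2 (logMax P f) := by
  have fld : ∀ {a : ℝ → ST → ℝ}, SmallC1 l U 0 a → PhC1 l U 0 2 (fun κ p _ => a κ p) :=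
    fun ha => (PhC1.of_field ha).mono (by norm_num)
  have c1 : ContDiffOn ℝ 1 Real.log (Ioi 0) := contDiffOn_log.of_le (by norm_num)
  have c2 : ContDiffOn ℝ 1 (fun x => Real.log (x + P.R * P.T₀)) (Ioi 0) :=
    (contDiffOn_log_add (mul_pos P.R_pos P.T₀_pos)).of_le (by norm_num)
  have hθ := (h.smallC1_req hl).inv (h.unifPos_req hl)
  have hT := (h.smallC1_eq hl).inv (h.unifPos_eq hl)
  exact ((((((fld ((h.smallC1_rho hl).comp c1 (h.unifPos_rho hl))).add
    ((fld ((h.smallC1_req hl).comp c1 (h.unifPos_req hl))).const_mul _)).add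
    ((fld ((h.smallC1_vibEq hl).comp c2 (h.unifPos_vibEq hl))).const_mul _)).add
    (fld (SmallC1.const _))).add
    ((PhC1.field_mul hθ (PhC1.sum _ fun i _ => h.phC1_pec_mul hl i i)).const_mul _)).add
    ((PhC1.field_mul hθ phC1_rot).const_mul _)).add
    ((PhC1.field_mul hT phC1_vib).const_mul _)

end SolFamily

/-! ### The transport derivative of the Maxwellian -/

theorem dir_eq (v : E3) : ((1, v) : ST) = dirT + ∑ j, v j • dirX j := by
  refine Prod.ext (by simp [dirT, dirX, Prod.fst_sum]) ?_
  ext i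
  simp [dirT, dirX, Prod.snd_sum, Finset.sum_apply, Pi.single_apply]

/-- Splitting v = u + (v - u) separates the convective derivative from the gradient along the
peculiar velocity. -/
theorem fderiv_dir (f : ℝ → ℝ → E3 → Phase → ℝ) (a : ℝ → ST → ℝ) (κ : ℝ) (p : ST) (z : Phase) :
    fderiv ℝ (a κ) p (1, z.1)
      = convF f a κ p + ∑ j, pecF f j κ p z * fderiv ℝ (a κ) p (dirX j) := by
  rw [dir_eq, map_add, map_sum]
  simp only [map_smul, smul_eq_mul, convF, pecF, sub_mul, Finset.sum_sub_distrib]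
  ring

theorem hasFDerivAt_inv_comp {a : ST → ℝ} {p : ST} {a' : ST →L[ℝ] ℝ} (ha : HasFDerivAt a a' p)
    (h0 : a p ≠ 0) : HasFDerivAt (fun p => (a p)⁻¹) (-((a p)⁻¹ ^ 2) • a') p := by
  have := (hasDerivAt_inv h0).comp_hasFDerivAt p ha
  rw [inv_pow]
  exact this

section Fields

variable (P : GasParams) (f : ℝ → ℝ → E3 → Phase → ℝ)

/-- The centred energy variable `|V|² / 2 - 3 / 2 + J - 1 + K - δ_v / 2`. -/
noncomputable def excess (κ : ℝ) (p : ST) (z : Phase) : ℝ :=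
  1 / 2 * ((reqF P f κ p)⁻¹ * ∑ i, pecF f i κ p z * pecF f i κ p z) - 3 / 2
    + ((reqF P f κ p)⁻¹ * z.2.1 - 1)
    + (P.T₀ * ((eqF P f κ p)⁻¹ * (z.2.2 : ℝ)) - (reqF P f κ p)⁻¹ * vibEqF P f κ p)

/-- The transport derivative of `log M`, to leading order. -/
noncomputable def leadFlow (κ : ℝ) (p : ST) (z : Phase) : ℝ :=
  - divF f κ p
    + ∑ i, pecF f i κ p z * ((eqF P f κ p)⁻¹ * fderiv ℝ (eqF P f κ) p (dirX i))
      * (excess P f κ p z - 1)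
    + (reqF P f κ p)⁻¹ * ∑ i, ∑ j, pecF f i κ p z * pecF f j κ p z
      * fderiv ℝ (velF f i κ) p (dirX j)
    - P.R * divF f κ p / cvF P f κ p * excess P f κ p z

end Fields

namespace SolFamily

variable {P : GasParams} {Kn₀ : ℝ} {U : Set ST} {g : Phase → ℝ} {f : ℝ → ℝ → E3 → Phase → ℝ}
  (h : SolFamily P Kn₀ U g f)

include h in
-- Each mode contributes to the temperature derivative its energy minus its equilibrium mean. For
-- vibrations this rests on `cVib_eq`: c_vib / (e_vib + R T₀) = e_vib / (R T²).
theorem fderiv_logMax {κ : ℝ} (hκ : κ ∈ Ioo 0 Kn₀) {p : ST} (hp : p ∈ U)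
    (hρ : DifferentiableAt ℝ (rhoF f κ) p) (hT : DifferentiableAt ℝ (eqF P f κ) p)
    (hu : ∀ i, DifferentiableAt ℝ (velF f i κ) p) (z : Phase) (w : ST) :
    fderiv ℝ (fun p => logMax P f κ p z) p w
      = (rhoF f κ p)⁻¹ * fderiv ℝ (rhoF f κ) p w
        + (reqF P f κ p)⁻¹ * ∑ i, pecF f i κ p z * fderiv ℝ (velF f i κ) p w
        + (eqF P f κ p)⁻¹ * fderiv ℝ (eqF P f κ) p w * excess P f κ p z := by
  have ρ0 : rhoF f κ p ≠ 0 := (h.density_pos hκ hp).ne'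
  have T0 : 0 < eqF P f κ p := h.eqF_pos hκ hp
  have R0 := P.R_pos
  have r0 := mul_pos P.R_pos P.T₀_pos
  have E0 : 0 < vibEqF P f κ p := eVib_pos P T0
  have θ0 : reqF P f κ p ≠ 0 := (mul_pos R0 T0).ne'
  have dθ : HasFDerivAt (reqF P f κ) (P.R • fderiv ℝ (eqF P f κ) p) p :=
    hT.hasFDerivAt.const_mul P.R
  have dE : HasFDerivAt (vibEqF P f κ) (cVib P (eqF P f κ p) • fderiv ℝ (eqF P f κ) p) p :=
    (hasDerivAt_eVib P T0).comp_hasFDerivAt p hT.hasFDerivAt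
  have dc : ∀ i, HasFDerivAt (fun p => pecF f i κ p z) (-fderiv ℝ (velF f i κ) p) p := fun i =>
    (hu i).hasFDerivAt.const_sub (z.1 i)
  have dsum : HasFDerivAt (fun p => ∑ i, pecF f i κ p z * pecF f i κ p z)
      (∑ i, (pecF f i κ p z • -fderiv ℝ (velF f i κ) p
        + pecF f i κ p z • -fderiv ℝ (velF f i κ) p)) p :=
    HasFDerivAt.fun_sum fun i _ => (dc i).fun_mul (dc i)
  have dtot := ((((((hρ.hasFDerivAt.log ρ0).fun_add ((dθ.log θ0).const_mul (-5 / 2))).fun_add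
    (((dE.add_const (P.R * P.T₀)).log (add_pos E0 r0).ne').const_mul (-1))).fun_add
    (hasFDerivAt_const (Real.log (P.R * P.T₀) - 3 / 2 * Real.log (2 * Real.pi)) p)).fun_add
    (((hasFDerivAt_inv_comp dθ θ0).fun_mul dsum).const_mul (-1 / 2))).fun_add
    (((hasFDerivAt_inv_comp dθ θ0).mul_const z.2.1).const_mul (-1))).fun_add
    (((hasFDerivAt_inv_comp hT.hasFDerivAt T0.ne').mul_const (z.2.2 : ℝ)).const_mul (-P.T₀))
  have e : fderiv ℝ (fun p => logMax P f κ p z) p w = _ := congrArg (fun L => L w) dtot.fderiv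
  rw [e]
  have hc : cVib P (eqF P f κ p)
      = vibEqF P f κ p * (vibEqF P f κ p + P.R * P.T₀) / (P.R * eqF P f κ p ^ 2) :=
    cVib_eq P T0
  have hθ : reqF P f κ p = P.R * eqF P f κ p := rfl
  have Er : vibEqF P f κ p + P.R * P.T₀ ≠ 0 := (add_pos E0 r0).ne'
  simp only [add_apply, smul_apply, smul_eq_mul,
    zero_apply, neg_apply,
    excess, Fin.sum_univ_three, hc, hθ]
  field_simp
  ring

variable {l : Filter ℝ} (hl : ∀ᶠ κ in l, κ ∈ Ioo 0 Kn₀)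

include h hl

theorem conv_rho : ∀ᶠ q in l ×ˢ 𝓟 U,
    convF f (rhoF f) q.1 q.2 = -(rhoF f q.1 q.2 * divF f q.1 q.2) := by
  have hu : ∀ᶠ q in l ×ˢ 𝓟 U, ∀ j, DifferentiableAt ℝ (velF f j q.1) q.2 :=
    eventually_all.2 fun j => (h.smallC1_vel hl j).diff
  filter_upwards [(h.smallC1_rho hl).diff, hu, eventually_mem hl] with q h1 h3 h4
  have e := h.continuity_eq h4.1 h4.2
  simp only [fderiv_mul_apply h1 (h3 _), Finset.sum_add_distrib, ← Finset.mul_sum] at e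
  rw [convF, divF]
  linear_combination e

theorem conv_vel_approx (i : Fin 3) : Approx l U (convF f (velF f i)) (fun κ p =>
    -(P.R * fderiv ℝ (eqF P f κ) p (dirX i)
      + (rhoF f κ p)⁻¹ * reqF P f κ p * fderiv ℝ (rhoF f κ) p (dirX i))) := by
  refine h.approx_div_rho hl ((h.momentum_approx hl i).congr (Eventually.of_forall fun _ => rfl) ?_)
  filter_upwards [(h.smallC1_rho hl).diff, (h.smallC1_eq hl).diff, (h.unifPos_rho hl).pos]
    with q h1 h2 h3
  have e : fderiv ℝ (reqF P f q.1) q.2 (dirX i) = P.R * fderiv ℝ (eqF P f q.1) q.2 (dirX i) := by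
    change fderiv ℝ (fun p => P.R * eqF P f q.1 p) q.2 _ = _
    rw [fderiv_const_mul h2]; rfl
  have h2' : DifferentiableAt ℝ (reqF P f q.1) q.2 := h2.const_mul P.R
  rw [fderiv_mul_apply h1 h2', e]
  field_simp

theorem phO_excess : PhO l U 0 2 (excess P f) := by
  have hθ := ((h.smallC1_req hl).inv (h.unifPos_req hl)).val
  have hT := ((h.smallC1_eq hl).inv (h.unifPos_eq hl)).val
  have hE := (((h.smallC1_req hl).inv (h.unifPos_req hl)).mul (h.smallC1_vibEq hl)).val
  have c : ∀ r, PhO l U 0 2 (fun _ _ _ => r) := fun r => (PhO.const r).mono (by norm_num)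
  exact (((((PhO.field_mul hθ (PhO.sum _ fun i _ => (h.phC1_pec_mul hl i i).val)).const_mul
    _).sub (c _)).add ((PhO.field_mul hθ phC1_rot.val).sub (c 1))).add
    (((PhO.field_mul hT phC1_vib.val).const_mul P.T₀).sub ((PhO.of_field hE).mono (by norm_num))))

/-- Euler's equations eliminate the convective derivatives of ρ, u and T_eq. The density gradient
then cancels against its share of the pressure gradient, whose temperature part turns W into W - 1,
where W is `excess`. -/
theorem flow_logMax_expansion : PhO l U 1 3
    (fun κ p z => fderiv ℝ (fun p => logMax P f κ p z) p (1, z.1) - leadFlow P f κ p z) := by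
  have hθ := (h.smallC1_req hl).inv (h.unifPos_req hl)
  have hT := (h.smallC1_eq hl).inv (h.unifPos_eq hl)
  have t1 := fun i => hθ.val.mul (h.conv_vel_approx hl i).sub
  have t2 := hT.val.mul (h.conv_eq_approx hl).sub
  simp only [pow_zero, one_mul] at t1 t2
  have fm : ∀ {B : ℝ × ST → ℝ} {A : ℝ → ST → Phase → ℝ} {m : ℕ}, B =O[l ×ˢ 𝓟 U] (fun q => q.1) →
      PhO l U 0 m A → PhO l U 1 m (fun κ p z => B (κ, p) * A κ p z) := fun {B} _ _ hB hA =>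
    PhO.field_mul (a := fun κ p => B (κ, p)) (by simpa using hB) hA
  have hd : ∀ᶠ q in l ×ˢ 𝓟 U, ∀ j, DifferentiableAt ℝ (velF f j q.1) q.2 :=
    eventually_all.2 fun j => (h.smallC1_vel hl j).diff
  refine (((PhO.sum Finset.univ fun i _ => fm (t1 i) (h.phC1_pec hl i).val).mono
    (by norm_num)).add ((fm t2 (h.phO_excess hl)).mono (by norm_num))).congr ?_
  filter_upwards [eventually_mem hl, (h.smallC1_rho hl).diff, (h.smallC1_eq hl).diff, hd,
    h.conv_rho hl, (h.unifPos_rho hl).pos, (h.unifPos_eq hl).pos] with q hq h1 h2 h3 h4 h5 h6 z hz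
  have R0 := P.R_pos
  rw [h.fderiv_logMax hq.1 hq.2 h1 h2 h3]
  simp only [fderiv_dir f, h4, leadFlow]
  have hθ : reqF P f q.1 q.2 = P.R * eqF P f q.1 q.2 := rfl
  generalize excess P f q.1 q.2 z = W
  simp only [Fin.sum_univ_three, hθ]
  field_simp
  ring

end SolFamily

/-! ### Identification of the first-order correction -/

theorem partialX_eq {F : ST → ℝ} {p : ST} (hF : DifferentiableAt ℝ F p) (j : Fin 3) :
    partialX j (fun y => F (p.1, y)) p.2 = fderiv ℝ F p (dirX j) := by
  have := (HasFDerivAt.comp (g := F) p.2 hF.hasFDerivAt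
    ((hasFDerivAt_const p.1 p.2).prodMk (hasFDerivAt_id (𝕜 := ℝ) p.2))).fderiv
  simp only [Function.comp_def, id] at this
  rw [partialX, this]
  simp [dirX]

theorem gam_sub_one {P : GasParams} {T : ℝ} (hT : 0 < T) : gam P T - 1 = P.R / cv P T := by
  have := cv_pos P hT
  rw [gam, cp]
  field_simp
  ring

namespace SolFamily

variable {P : GasParams} {Kn₀ : ℝ} {U : Set ST} {g : Phase → ℝ} {f : ℝ → ℝ → E3 → Phase → ℝ}
  (h : SolFamily P Kn₀ U g f) {κ : ℝ} (hκ : κ ∈ Ioo 0 Kn₀) {p : ST} (hp : p ∈ U)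

include h hκ hp

theorem tauF_pos : 0 < tauF P f κ p := by
  have hρ : 0 < rhoF f κ p := h.density_pos hκ hp
  have hT := h.eqF_pos hκ hp
  have := P.visc_pos _ hT
  have := P.R_pos; have := P.Pr_pos
  rw [tauF, tau]
  positivity

/-- Both viscosities carry the pressure: ζ = ρ R T z and μ = ρ R T Pr τ, with z = `zF`. -/
theorem volVisc_div_visc : volVisc P (rhoF f κ p) (eqF P f κ p) / P.visc (eqF P f κ p)
    = zF P f κ p / (tauF P f κ p * P.Pr) := by
  have hρ : 0 < rhoF f κ p := h.density_pos hκ hp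
  have hT := h.eqF_pos hκ hp
  have := P.visc_pos _ hT
  have := P.R_pos; have := P.Pr_pos
  have := cv_pos P hT
  rw [volVisc, zF, tauF, tau, cRot, rotDof, cvF, cVibF, tauRotF, tauVibF]
  field_simp

theorem correction_eq (hT : DifferentiableAt ℝ (eqF P f κ) p)
    (hu : ∀ i, DifferentiableAt ℝ (velF f i κ) p) (z : Phase) :
    correction P (f κ p.1) p.2 z
      = ∑ i, pecF f i κ p z * ((eqF P f κ p)⁻¹ * fderiv ℝ (eqF P f κ) p (dirX i))
          * (excess P f κ p z - 1)
        + P.Pr * ((reqF P f κ p)⁻¹ * ∑ i, ∑ j, pecF f i κ p z * pecF f j κ p z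
          * fderiv ℝ (velF f i κ) p (dirX j))
        - divF f κ p * (P.Pr * ((1 / 2 * ((reqF P f κ p)⁻¹ * ∑ i, pecF f i κ p z * pecF f i κ p z)
            - 3 / 2) * (2 / 3 - zF P f κ p / (tauF P f κ p * P.Pr)) + 1)
          + (tauRotF P f κ p / tauF P f κ p * (P.R / cvF P f κ p) - zF P f κ p / tauF P f κ p)
            * ((reqF P f κ p)⁻¹ * z.2.1 - 1)
          + (tauVibF P f κ p / tauF P f κ p * (P.R / cvF P f κ p) - zF P f κ p / tauF P f κ p)
            * (P.T₀ * ((eqF P f κ p)⁻¹ * (z.2.2 : ℝ)) - (reqF P f κ p)⁻¹ * vibEqF P f κ p)) := by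
  have T0 : 0 < eqF P f κ p := h.eqF_pos hκ hp
  have R0 := P.R_pos
  have Pr0 := P.Pr_pos
  have θ0 : 0 < reqF P f κ p := mul_pos R0 T0
  have τ0 := h.tauF_pos hκ hp
  have eT : ∀ j, partialX j (fun y => P.R * tempEq P (f κ p.1 y)) p.2
      = P.R * fderiv ℝ (eqF P f κ) p (dirX j) := fun j => by
    have := partialX_eq (F := fun p => P.R * eqF P f κ p) (hT.const_mul P.R) j
    rw [fderiv_const_mul hT] at this
    exact this
  have eu : ∀ i j, partialX j (fun y => velocity (f κ p.1 y) i) p.2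
      = fderiv ℝ (velF f i κ) p (dirX j) := fun i j => partialX_eq (hu i) j
  have hs : √(reqF P f κ p) * √(reqF P f κ p) = reqF P f κ p := Real.mul_self_sqrt θ0.le
  have hs0 : √(reqF P f κ p) ≠ 0 := (Real.sqrt_pos.2 θ0).ne'
  have eV : ∀ i, redV P (f κ p.1 p.2) z.1 i = (√(reqF P f κ p))⁻¹ * pecF f i κ p z := fun i => by
    simp [redV, reqF, pecF, velF]
  have eVV : ∀ i j, redV P (f κ p.1 p.2) z.1 i * redV P (f κ p.1 p.2) z.1 j
      = (reqF P f κ p)⁻¹ * (pecF f i κ p z * pecF f j κ p z) := fun i j => by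
    rw [eV, eV, ← hs, mul_inv, hs]; ring
  have eN : ‖redV P (f κ p.1 p.2) z.1‖ ^ 2
      = (reqF P f κ p)⁻¹ * ∑ i, pecF f i κ p z * pecF f i κ p z := by
    rw [EuclideanSpace.real_norm_sq_eq, Finset.mul_sum]
    exact Finset.sum_congr rfl fun i _ => by rw [sq, eVV]
  have eJ : redJ P (f κ p.1 p.2) z.2.1 = (reqF P f κ p)⁻¹ * z.2.1 := by
    rw [redJ, reqF, div_eq_inv_mul]
  have eK : redK P (f κ p.1 p.2) z.2.2 = P.T₀ * ((eqF P f κ p)⁻¹ * (z.2.2 : ℝ)) := by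
    rw [redK, eqF]; ring
  have eδ : vibDof P (tempEq P (f κ p.1 p.2)) / 2 = (reqF P f κ p)⁻¹ * vibEqF P f κ p := by
    rw [vibDof_eq P (show 0 < tempEq P (f κ p.1 p.2) from T0), div_eq_inv_mul]; rfl
  have eζ : volVisc P (density (f κ p.1 p.2)) (tempEq P (f κ p.1 p.2))
      / P.visc (tempEq P (f κ p.1 p.2)) = zF P f κ p / (tauF P f κ p * P.Pr) :=
    h.volVisc_div_visc hκ hp
  have eγ : gam P (tempEq P (f κ p.1 p.2)) - 1 = P.R / cvF P f κ p := gam_sub_one T0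
  have eτ : tau P (density (f κ p.1 p.2)) (tempEq P (f κ p.1 p.2)) = tauF P f κ p := rfl
  have eA : ∀ j, ACoef P (tempEq P (f κ p.1 p.2)) (redV P (f κ p.1 p.2) z.1)
      (redJ P (f κ p.1 p.2) z.2.1) (redK P (f κ p.1 p.2) z.2.2) j
      * (P.R * fderiv ℝ (eqF P f κ) p (dirX j) / √(P.R * tempEq P (f κ p.1 p.2)))
      = pecF f j κ p z * ((eqF P f κ p)⁻¹ * fderiv ℝ (eqF P f κ) p (dirX j))
          * (excess P f κ p z - 1) := fun j => by
    simp only [ACoef, ATr, ARot, AVib, PiLp.add_apply, PiLp.smul_apply, smul_eq_mul, eV, eN, eJ, eK,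
      eδ, rotDof, excess]
    have hs' : √(P.R * tempEq P (f κ p.1 p.2)) = √(reqF P f κ p) := rfl
    rw [hs']
    generalize (reqF P f κ p)⁻¹ * ∑ i, pecF f i κ p z * pecF f i κ p z = N
    generalize (reqF P f κ p)⁻¹ * z.2.1 = J
    generalize (reqF P f κ p)⁻¹ * vibEqF P f κ p = δ
    generalize √(reqF P f κ p) = s at hs hs0
    -- Of the two factors s = √(R T_eq) in the denominator, one comes from V and one from the scaled
    -- gradient; together they remove R from ∇(R T_eq).
    have e1 : P.R * (eqF P f κ p) = s * s := by rw [hs]; rfl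
    have e2 : P.R = s * s * (eqF P f κ p)⁻¹ := by rw [← e1]; field_simp
    rw [e2]
    field_simp
    ring
  rw [correction]
  simp only [eT, eu, eA]
  rw [add_sub_assoc]
  congr 1
  simp only [BCoef, BTr, BRot, BVib, Matrix.add_apply, Matrix.sub_apply, Matrix.smul_apply,
    Matrix.of_apply, smul_eq_mul, eVV, eN, eJ, eK, eδ, eζ, eγ, eτ, Fin.sum_univ_three, divF,
    Matrix.one_apply, rotDof, if_true,
    if_neg (show (0 : Fin 3) ≠ 1 by decide), if_neg (show (0 : Fin 3) ≠ 2 by decide),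
    if_neg (show (1 : Fin 3) ≠ 0 by decide), if_neg (show (1 : Fin 3) ≠ 2 by decide),
    if_neg (show (2 : Fin 3) ≠ 0 by decide), if_neg (show (2 : Fin 3) ≠ 1 by decide)]
  have eC : P.tauC (density (f κ p.1 p.2)) (tempEq P (f κ p.1 p.2)) / tauF P f κ p
      * P.Zrot (tempEq P (f κ p.1 p.2)) = tauRotF P f κ p / tauF P f κ p := by
    rw [tauRotF, eqF, rhoF]; ring
  have eD : P.tauC (density (f κ p.1 p.2)) (tempEq P (f κ p.1 p.2)) / tauF P f κ p
      * P.Zvib (tempEq P (f κ p.1 p.2)) = tauVibF P f κ p / tauF P f κ p := by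
    rw [tauVibF, eqF, rhoF]; ring
  have eP : zF P f κ p / (tauF P f κ p * P.Pr) * P.Pr = zF P f κ p / tauF P f κ p := by field_simp
  rw [eC, eD, eP]
  ring

/-- The first-order balance of the relaxation of the Gaussian and of the transport term. -/
theorem leadRatio_eq (hT : DifferentiableAt ℝ (eqF P f κ) p)
    (hu : ∀ i, DifferentiableAt ℝ (velF f i κ) p) (z : Phase) :
    leadRatio P f κ p z
      = tauF P f κ p * (leadFlow P f κ p z - correction P (f κ p.1) p.2 z) := by
  have T0 : 0 < eqF P f κ p := h.eqF_pos hκ hp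
  have R0 := P.R_pos
  have Pr0 := P.Pr_pos
  have τ0 := h.tauF_pos hκ hp
  have r0 := mul_pos P.R_pos P.T₀_pos
  have E0 : 0 < vibEqF P f κ p := eVib_pos P T0
  have Er : vibEqF P f κ p + P.R * P.T₀ ≠ 0 := (add_pos E0 r0).ne'
  have c0 : cvF P f κ p ≠ 0 := (cv_pos P T0).ne'
  have hc : cVibF P f κ p
      = vibEqF P f κ p * (vibEqF P f κ p + P.R * P.T₀) / (P.R * eqF P f κ p ^ 2) :=
    cVib_eq P T0
  have hθ : reqF P f κ p = P.R * eqF P f κ p := rfl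
  rw [h.correction_eq hκ hp hT hu]
  -- The balance holds for any value of z: it enters both sides only through -z div u times
  -- `excess`.
  generalize hz : zF P f κ p = y
  simp only [leadRatio, leadFlow, leadPi, leadRot, leadVib, hz, excess, hθ, hc, divF,
    Fin.sum_univ_three, if_true,
    if_neg (show (0 : Fin 3) ≠ 1 by decide), if_neg (show (0 : Fin 3) ≠ 2 by decide),
    if_neg (show (1 : Fin 3) ≠ 0 by decide), if_neg (show (1 : Fin 3) ≠ 2 by decide),
    if_neg (show (2 : Fin 3) ≠ 0 by decide), if_neg (show (2 : Fin 3) ≠ 1 by decide)]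
  field_simp
  ring

end SolFamily

/-! ### Estimate of the remainder -/

theorem abs_exp_sub_one_le (x : ℝ) : |Real.exp x - 1| ≤ |x| * Real.exp |x| := by
  have := Complex.norm_exp_sub_sum_le_norm_mul_exp (x : ℂ) 1
  simp only [Finset.sum_range_one, pow_zero, Nat.factorial_zero, Nat.cast_one, div_one, pow_one,
    Complex.norm_real, Real.norm_eq_abs] at this
  rwa [← Complex.ofReal_exp, ← Complex.ofReal_one, ← Complex.ofReal_sub, Complex.norm_real] at this

theorem abs_exp_sub_one_sub_le (x : ℝ) : |Real.exp x - 1 - x| ≤ |x| ^ 2 * Real.exp |x| := by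
  have := Complex.norm_exp_sub_sum_le_norm_mul_exp (x : ℂ) 2
  simp only [Finset.sum_range_succ, Finset.sum_range_zero, pow_zero, Nat.factorial_zero,
    Nat.cast_one, div_one, pow_one, Nat.factorial_one, zero_add,
    Complex.norm_real, Real.norm_eq_abs] at this
  rwa [← Complex.ofReal_exp, ← Complex.ofReal_one, ← Complex.ofReal_add, ← Complex.ofReal_sub,
    Complex.norm_real, ← sub_sub] at this

theorem differentiableAt_slice {F : ST → ℝ} {p : ST} (hF : DifferentiableAt ℝ F p) :
    DifferentiableAt ℝ (fun y => F (p.1, y)) p.2 :=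
  DifferentiableAt.comp (g := F) p.2 hF
    ((differentiableAt_const p.1).prodMk differentiableAt_id)

/-! ### Integrable envelopes and bounds on the remainder -/

/-- The exponential envelope. -/
noncomputable def envelope (c : ℝ) (z : Phase) : ℝ :=
  Real.exp (-(c * (1 + ‖z.1‖ ^ 2 + z.2.1 + (z.2.2 : ℝ))))

theorem integrable_envelope {c : ℝ} (hc : 0 < c) : Integrable (envelope c) phaseMeasure := by
  have h1 := integrable_exp_neg_norm_sq hc
  have h2 : Integrable (fun ε : ℝ => Real.exp (-c * ε)) (volume.restrict (Ici 0)) := by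
    have := integrableOn_exp_mul_Ioi (neg_lt_zero.2 hc) 0
    rwa [← integrableOn_Ici_iff_integrableOn_Ioi] at this
  have h3 : Integrable (fun i : ℕ => Real.exp (-c) ^ i) Measure.count := by
    rw [integrable_count_iff]
    exact (summable_geometric_of_lt_one (Real.exp_pos _).le
      (by rw [Real.exp_lt_one_iff]; linarith)).norm
  refine ((h1.mul_prod (h2.mul_prod h3)).const_mul (Real.exp (-c))).congr
    (Eventually.of_forall fun z => ?_)
  simp only [envelope, ← Real.exp_nat_mul, ← Real.exp_add]
  congr 1
  ring

theorem integrable_mul_envelope {c : ℝ} (hc : 0 < c) :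
    Integrable (fun z : Phase => (1 + ‖z.1‖ ^ 2 + z.2.1 + (z.2.2 : ℝ)) * envelope c z)
      phaseMeasure := by
  obtain ⟨C, -, hC⟩ := exists_pow_mul_exp_le 1 hc
  refine ((integrable_envelope (half_pos hc)).const_mul C).mono' ?_ ?_
  · unfold envelope
    have h1 : Measurable fun z : Phase => (z.2.2 : ℝ) :=
      measurable_from_nat.comp (measurable_snd.comp measurable_snd)
    fun_prop
  · filter_upwards [ae_nonneg_energy] with z hz
    have h0 : 0 ≤ 1 + ‖z.1‖ ^ 2 + z.2.1 + (z.2.2 : ℝ) := by positivity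
    rw [envelope, Real.norm_of_nonneg (mul_nonneg h0 (Real.exp_pos _).le)]
    simpa [envelope] using hC _ h0

/-- The remainder of the first-order expansion, in terms of bounds on its constituents. -/
theorem abs_remainder_le {κ s L Y X dL dY lead τ τ' F D corr w C₁ C₂ C₃ C₄ C₅ C₆ C₇ C₈ C₉ : ℝ}
    (hκ : 0 < κ) (hs : 1 ≤ s) (h₁ : |Y| ≤ C₁ * (κ * s ^ 2)) (h₂ : |Y - κ * X| ≤ C₂ * (κ ^ 2 * s ^ 2))
    (h₃ : |τ' - τ| ≤ C₃ * κ) (h₄ : |τ| ≤ C₄) (h₅ : |dL| ≤ C₅ * s ^ 3)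
    (h₆ : |dL - lead| ≤ C₆ * (κ * s ^ 3)) (h₇ : |dY| ≤ C₇ * (κ * s ^ 3)) (h₈ : |F| ≤ C₈ * w)
    (h₉ : |D| ≤ C₉ * w) (hC₂ : 0 ≤ C₂) (hC₃ : 0 ≤ C₃) (hC₅ : 0 ≤ C₅) (hC₆ : 0 ≤ C₆)
    (hC₇ : 0 ≤ C₇) (hF : F = Real.exp (L + Y) * (dL + dY) - κ * D)
    (hX : X = τ * (lead - corr)) :
    |Real.exp (L + Y) - κ * τ' * F - (Real.exp L - τ * κ * Real.exp L * corr)|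
      ≤ ((C₁ ^ 2 + C₂ + C₄ * (C₁ * C₅ + C₇ + C₆)) * (Real.exp (L + |Y|) * s ^ 5)
        + (C₃ * C₈ + C₄ * C₉) * w) * κ ^ 2 := by
  have hC₄ : 0 ≤ C₄ := (abs_nonneg _).trans h₄
  have hL := Real.exp_pos L
  have hE : Real.exp (L + |Y|) = Real.exp L * Real.exp |Y| := Real.exp_add _ _
  have hEY := Real.exp_pos |Y|
  have hE1 : Real.exp L ≤ Real.exp (L + |Y|) := Real.exp_le_exp.2 (by linarith [abs_nonneg Y])
  have hE2 : Real.exp (L + Y) ≤ Real.exp (L + |Y|) := Real.exp_le_exp.2 (by linarith [le_abs_self Y])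
  have p2 : s ^ 2 ≤ s ^ 5 := pow_le_pow_right₀ hs (by norm_num)
  have p3 : s ^ 3 ≤ s ^ 5 := pow_le_pow_right₀ hs (by norm_num)
  have p4 : s ^ 4 ≤ s ^ 5 := pow_le_pow_right₀ hs (by norm_num)
  -- Here L = log M, Y = log(G/M), X is the first-order coefficient of Y, τ' and τ are the
  -- relaxation times at T_tr and T_eq, F = Df, and D bounds the second-order part D(τ' Df). The
  -- terms of order κ cancel by X = τ (lead - corr), and each remaining summand is quadratic in κ.
  have e : Real.exp (L + Y) - κ * τ' * F - (Real.exp L - τ * κ * Real.exp L * corr)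
      = Real.exp L * (Real.exp Y - 1 - Y) + Real.exp L * (Y - κ * X) - κ * ((τ' - τ) * F)
        - κ * (τ * (Real.exp L * ((Real.exp Y - 1) * dL) + Real.exp (L + Y) * dY
          + Real.exp L * (dL - lead))) + κ ^ 2 * (τ * D) := by
    rw [hX]
    have hF' : κ * τ * F = κ * τ * (Real.exp (L + Y) * (dL + dY) - κ * D) := by rw [← hF]
    rw [Real.exp_add] at hF' ⊢
    linear_combination -hF'
  set G := Real.exp (L + |Y|) with hG
  have hG0 : 0 < G := Real.exp_pos _
  have b1 : |Real.exp L * (Real.exp Y - 1 - Y)| ≤ C₁ ^ 2 * (G * s ^ 5) * κ ^ 2 := by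
    rw [abs_mul, abs_of_pos hL]
    calc _ ≤ Real.exp L * (|Y| ^ 2 * Real.exp |Y|) :=
          mul_le_mul_of_nonneg_left (abs_exp_sub_one_sub_le Y) hL.le
      _ = G * |Y| ^ 2 := by rw [hE]; ring
      _ ≤ G * (C₁ * (κ * s ^ 2)) ^ 2 := by gcongr
      _ = C₁ ^ 2 * (G * s ^ 4) * κ ^ 2 := by ring
      _ ≤ _ := by gcongr
  have b2 : |Real.exp L * (Y - κ * X)| ≤ C₂ * (G * s ^ 5) * κ ^ 2 := by
    rw [abs_mul, abs_of_pos hL]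
    calc _ ≤ G * (C₂ * (κ ^ 2 * s ^ 2)) := by gcongr
      _ = C₂ * (G * s ^ 2) * κ ^ 2 := by ring
      _ ≤ _ := by gcongr
  have b3 : |κ * ((τ' - τ) * F)| ≤ C₃ * C₈ * w * κ ^ 2 := by
    rw [abs_mul, abs_mul, abs_of_pos hκ]
    calc _ ≤ κ * ((C₃ * κ) * (C₈ * w)) := by gcongr
      _ = _ := by ring
  have b4 : |Real.exp L * ((Real.exp Y - 1) * dL)| ≤ C₁ * C₅ * (G * s ^ 5) * κ := by
    rw [abs_mul, abs_mul, abs_of_pos hL]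
    calc _ ≤ Real.exp L * ((|Y| * Real.exp |Y|) * (C₅ * s ^ 3)) := by
          gcongr; exact abs_exp_sub_one_le Y
      _ = G * (|Y| * (C₅ * s ^ 3)) := by rw [hE]; ring
      _ ≤ G * ((C₁ * (κ * s ^ 2)) * (C₅ * s ^ 3)) := by gcongr
      _ = _ := by ring
  have b5 : |Real.exp (L + Y) * dY| ≤ C₇ * (G * s ^ 5) * κ := by
    rw [abs_mul, Real.abs_exp]
    calc _ ≤ G * (C₇ * (κ * s ^ 3)) := by gcongr
      _ = C₇ * (G * s ^ 3) * κ := by ring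
      _ ≤ _ := by gcongr
  have b6 : |Real.exp L * (dL - lead)| ≤ C₆ * (G * s ^ 5) * κ := by
    rw [abs_mul, Real.abs_exp]
    calc _ ≤ G * (C₆ * (κ * s ^ 3)) := by gcongr
      _ = C₆ * (G * s ^ 3) * κ := by ring
      _ ≤ _ := by gcongr
  have b7 : |κ * (τ * (Real.exp L * ((Real.exp Y - 1) * dL) + Real.exp (L + Y) * dY
      + Real.exp L * (dL - lead)))| ≤ C₄ * (C₁ * C₅ + C₇ + C₆) * (G * s ^ 5) * κ ^ 2 := by
    rw [abs_mul, abs_mul, abs_of_pos hκ]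
    calc _ ≤ κ * (C₄ * (C₁ * C₅ * (G * s ^ 5) * κ + C₇ * (G * s ^ 5) * κ
            + C₆ * (G * s ^ 5) * κ)) := by
          gcongr
          exact (abs_add_three _ _ _).trans (add_le_add (add_le_add b4 b5) b6)
      _ = _ := by ring
  have b8 : |κ ^ 2 * (τ * D)| ≤ C₄ * C₉ * w * κ ^ 2 := by
    rw [abs_mul, abs_mul, abs_of_pos (pow_pos hκ 2)]
    calc _ ≤ κ ^ 2 * (C₄ * (C₉ * w)) := by gcongr
      _ = _ := by ring
  rw [e]
  refine (abs_add_le _ _).trans ((add_le_add ((abs_sub _ _).trans (add_le_add ((abs_sub _ _).trans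
    (add_le_add ((abs_add_le _ _).trans (add_le_add b1 b2)) b3)) b7)) b8).trans (le_of_eq ?_))
  ring

namespace SolFamily

variable {P : GasParams} {Kn₀ : ℝ} {U : Set ST} {g : Phase → ℝ} {f : ℝ → ℝ → E3 → Phase → ℝ}
  (h : SolFamily P Kn₀ U g f) {l : Filter ℝ} (hl : ∀ᶠ κ in l, κ ∈ Ioo 0 Kn₀)

include h hl

/-- The temperature is bounded above and u is bounded, so |v - u|² ≥ |v|² / 2 - |u|² yields uniform
Gaussian decay in v and exponential decay in ε and i. -/
theorem logMax_le : ∃ c C : ℝ, 0 < c ∧ ∀ᶠ q in l ×ˢ 𝓟 U, ∀ z : Phase, 0 ≤ z.2.1 →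
    logMax P f q.1 q.2 z ≤ C - c * growth z ^ 2 := by
  have c1 : ContDiffOn ℝ 1 Real.log (Ioi 0) := contDiffOn_log.of_le (by norm_num)
  have c2 : ContDiffOn ℝ 1 (fun x => Real.log (x + P.R * P.T₀)) (Ioi 0) :=
    (contDiffOn_log_add (mul_pos P.R_pos P.T₀_pos)).of_le (by norm_num)
  have ci : ContDiffOn ℝ 1 (fun x : ℝ => x⁻¹) (Ioi 0) := contDiffOn_inv_Ioi.of_le (by norm_num)
  have s0 := ((((h.smallC1_rho hl).comp c1 (h.unifPos_rho hl)).add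
    (((h.smallC1_req hl).comp c1 (h.unifPos_req hl)).const_mul (-5 / 2))).add
    (((h.smallC1_vibEq hl).comp c2 (h.unifPos_vibEq hl)).const_mul (-1))).add
    (SmallC1.const (Real.log (P.R * P.T₀) - 3 / 2 * Real.log (2 * Real.pi)))
  obtain ⟨M0, h0⟩ := exists_upper_bound s0
  obtain ⟨M1, h1⟩ := exists_upper_bound (((h.smallC1_req hl).inv (h.unifPos_req hl)).mul
    (SmallC1.sum Finset.univ fun i _ => (h.smallC1_vel hl i).mul (h.smallC1_vel hl i)))
  obtain ⟨b, hb, h2⟩ := SmallC1.unifPos_comp ci (fun x hx => inv_pos.2 hx) (h.smallC1_req hl)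
    (h.unifPos_req hl)
  obtain ⟨b', hb', h3⟩ := SmallC1.unifPos_comp ci (fun x hx => inv_pos.2 hx) (h.smallC1_eq hl)
    (h.unifPos_eq hl)
  have hT := P.T₀_pos
  -- The 1/4 is the 1/2 of the Maxwellian exponent times the 1/2 lost in passing from |v - u|² to
  -- |v|².
  have hm : 0 < min (b / 4) (P.T₀ * b') := lt_min (by positivity) (by positivity)
  refine ⟨min (b / 4) (P.T₀ * b'), M0 + M1 / 2 + min (b / 4) (P.T₀ * b'), hm, ?_⟩
  filter_upwards [h0, h1, h2, h3] with q h0 h1 h2 h3 z hz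
  have k0 := (abs_le.1 h0).2
  have k1 := (abs_le.1 h1).2
  have hS : ‖z.1‖ ^ 2 / 2 - ∑ i, velF f i q.1 q.2 * velF f i q.1 q.2
      ≤ ∑ i, pecF f i q.1 q.2 z * pecF f i q.1 q.2 z := by
    rw [EuclideanSpace.real_norm_sq_eq, Finset.sum_div, ← Finset.sum_sub_distrib]
    refine Finset.sum_le_sum fun i _ => ?_
    rw [pecF]
    nlinarith [sq_nonneg (z.1 i - 2 * velF f i q.1 q.2)]
  have hθ : 0 < (reqF P f q.1 q.2)⁻¹ := hb.trans_le h2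
  have m1 := min_le_left (b / 4) (P.T₀ * b')
  have m2 := min_le_right (b / 4) (P.T₀ * b')
  generalize min (b / 4) (P.T₀ * b') = c at *
  have hi : (0 : ℝ) ≤ z.2.2 := Nat.cast_nonneg _
  have t1 := mul_le_mul_of_nonneg_left hS hθ.le
  have t2 : c * ‖z.1‖ ^ 2 ≤ (reqF P f q.1 q.2)⁻¹ / 4 * ‖z.1‖ ^ 2 :=
    mul_le_mul_of_nonneg_right (by linarith) (sq_nonneg _)
  have t3 : c * z.2.1 ≤ (reqF P f q.1 q.2)⁻¹ * z.2.1 :=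
    mul_le_mul_of_nonneg_right (by linarith) hz
  have t4 : c * (z.2.2 : ℝ) ≤ P.T₀ * (eqF P f q.1 q.2)⁻¹ * z.2.2 :=
    mul_le_mul_of_nonneg_right (m2.trans (mul_le_mul_of_nonneg_left h3 hT.le)) hi
  rw [growth_sq hz, logMax]
  linarith

/-- Since |log(G/M)| ≤ D κ growth², small κ costs half of the decay of M; half of what is left
absorbs the power of growth. The final rate does not depend on `m`. -/
theorem exp_le_envelope (h0 : l ≤ 𝓝 0) : ∃ c : ℝ, 0 < c ∧ ∀ m : ℕ, ∃ C : ℝ, 0 ≤ C ∧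
    ∀ᶠ q in l ×ˢ 𝓟 U, ∀ z : Phase, 0 ≤ z.2.1 →
      Real.exp (logMax P f q.1 q.2 z + |logRatio P f q.1 q.2 z|) * growth z ^ m
        ≤ C * envelope c z := by
  obtain ⟨c, C, hc, h1⟩ := h.logMax_le hl
  obtain ⟨D, hD, h2⟩ := (h.phC1_logRatio hl h0).val
  have h3 : ∀ᶠ κ in l, D * |κ| < c / 2 := by
    have : Tendsto (fun κ : ℝ => D * |κ|) (𝓝 0) (𝓝 (D * |0|)) :=
      (continuous_const.mul continuous_abs).tendsto 0
    refine (this.mono_left h0).eventually_lt_const ?_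
    simp; positivity
  refine ⟨c / 2 / 2, by positivity, fun m => ?_⟩
  obtain ⟨K, hK, h4⟩ := exists_pow_mul_exp_le m (half_pos hc)
  refine ⟨Real.exp C * K, by positivity, ?_⟩
  filter_upwards [h1, h2, h3.prod_inl (𝓟 U)] with q h1 h2 h3 z hz
  have s1 := one_le_growth hz
  have k1 := h1 z hz
  have k2 := h2 z hz
  have k3 := mul_le_mul_of_nonneg_right h3.le (sq_nonneg (growth z))
  have k4 : logMax P f q.1 q.2 z + |logRatio P f q.1 q.2 z| ≤ C + -(c / 2 * growth z ^ 2) := by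
    rw [pow_one] at k2
    linarith
  calc _ ≤ Real.exp (C + -(c / 2 * growth z ^ 2)) * (growth z ^ 2) ^ m := by
        gcongr
        nlinarith
    _ = Real.exp C * ((growth z ^ 2) ^ m * Real.exp (-(c / 2 * growth z ^ 2))) := by
        rw [Real.exp_add]; ring
    _ ≤ Real.exp C * (K * Real.exp (-(c / 2 / 2 * growth z ^ 2))) := by
        exact mul_le_mul_of_nonneg_left (h4 _ (sq_nonneg _)) (Real.exp_pos _).le
    _ = _ := by rw [envelope, growth_sq hz]; ring

omit hl in
-- The identity f = G - κ τ Df is differentiated along (1, v) with G = exp(log M + log(G/M)). It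
-- replaces Df by G times a logarithmic derivative at the price of κ D(τ Df), which second
-- derivatives of f control.
theorem flow_eq {κ : ℝ} (hκ : κ ∈ Ioo 0 Kn₀) {p : ST} (hp : p ∈ U) {z : Phase} (hz : 0 ≤ z.2.1)
    (hL : DifferentiableAt ℝ (fun p => logMax P f κ p z) p)
    (hY : DifferentiableAt ℝ (fun p => logRatio P f κ p z) p)
    (hτ : DifferentiableAt ℝ (tauFam P f κ) p) : flow f κ p z
      = Real.exp (logMax P f κ p z + logRatio P f κ p z)
        * (fderiv ℝ (fun p => logMax P f κ p z) p (1, z.1)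
          + fderiv ℝ (fun p => logRatio P f κ p z) p (1, z.1))
      - κ * (tauFam P f κ p * fderiv ℝ (fun p => flow f κ p z) p (1, z.1)
          + flow f κ p z * fderiv ℝ (tauFam P f κ) p (1, z.1)) := by
  have e : (fun p : ST => f κ p.1 p.2 z) =ᶠ[𝓝 p] fun p =>
      Real.exp (logMax P f κ p z + logRatio P f κ p z) - κ * (tauFam P f κ p * flow f κ p z) := by
    filter_upwards [h.isOpen.mem_nhds hp] with p' hp'
    rw [← h.gaussian_eq_exp hκ hp', h.gaussian_eq hκ hp' hz]
    ring
  have hfl := (h.hasFDerivAt_flow hκ hp hz).differentiableAt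
  have d := ((hL.hasFDerivAt.fun_add hY.hasFDerivAt).exp).fun_sub
    ((hτ.hasFDerivAt.fun_mul hfl.hasFDerivAt).const_mul κ)
  conv_lhs => rw [flow, e.fderiv_eq, d.fderiv]
  simp only [sub_apply, smul_apply, add_apply, smul_eq_mul]

theorem remainder_le (h0 : l ≤ 𝓝 0) : ∃ K₁ K₂ : ℝ, 0 ≤ K₁ ∧ 0 ≤ K₂ ∧
    ∀ᶠ q in l ×ˢ 𝓟 U, ∀ z : Phase, 0 ≤ z.2.1 →
      |f q.1 q.2.1 q.2.2 z - firstOrder P q.1 (f q.1 q.2.1) q.2.2 z|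
        ≤ (K₁ * (Real.exp (logMax P f q.1 q.2 z + |logRatio P f q.1 q.2 z|) * growth z ^ 5)
          + K₂ * ((1 + ‖z.1‖ ^ 2) * g z)) * q.1 ^ 2 := by
  have hY := h.phC1_logRatio hl h0
  have hL := h.phC1_logMax hl
  have hτ := h.smallC1_tau hl
  obtain ⟨C₁, hC₁, b₁⟩ := hY.val
  obtain ⟨C₂, hC₂, b₂⟩ := h.logRatio_expansion hl h0
  obtain ⟨C₃, b₃⟩ := (h.approx_tau hl).sub.bound
  obtain ⟨C₄, b₄⟩ := exists_upper_bound (h.smallC1_tauF hl)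
  obtain ⟨C₅, hC₅, b₅⟩ := hL.der
  obtain ⟨C₆, hC₆, b₆⟩ := h.flow_logMax_expansion hl
  obtain ⟨C₇, hC₇, b₇⟩ := hY.der
  obtain ⟨C₈, b₈⟩ := exists_upper_bound hτ
  obtain ⟨C₉, b₉⟩ := hτ.der.bound
  -- The factors 2 come from 1 + |v| and (1 + |v|)² being at most 2 (1 + |v|²); absolute values make
  -- the constants nonnegative.
  refine ⟨C₁ ^ 2 + C₂ + |C₄| * (C₁ * C₅ + C₇ + C₆), max C₃ 0 * 2 + |C₄| * (2 * |C₈| + 2 * |C₉|),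
    by positivity, by positivity, ?_⟩
  filter_upwards [b₁, b₂, b₃, b₄, b₅, b₆, b₇, b₈, b₉, eventually_mem hl, hY.diff, hL.diff, hτ.diff,
    (h.smallC1_eq hl).diff, eventually_all.2 fun j => (h.smallC1_vel hl j).diff]
    with q b₁ b₂ b₃ b₄ b₅ b₆ b₇ b₈ b₉ hq dY dL dτ dT du z hz
  obtain ⟨hκ, hp⟩ := hq
  have hκ0 : 0 < q.1 := hκ.1
  have hg := h.g_nonneg hκ hp hz
  have s1 := one_le_growth hz
  have w1 : (1 + ‖z.1‖) ≤ 2 * (1 + ‖z.1‖ ^ 2) := by nlinarith [sq_nonneg (‖z.1‖ - 1)]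
  have w2 := one_add_norm_sq_le z.1
  have bF : |flow f q.1 q.2 z| ≤ 2 * ((1 + ‖z.1‖ ^ 2) * g z) := by
    refine (h.abs_flow_le hκ hp hz).trans ?_
    rw [← mul_assoc]
    exact mul_le_mul_of_nonneg_right w1 hg
  simp only [Real.norm_eq_abs, pow_zero, abs_one, mul_one] at b₉
  have bτ : |fderiv ℝ (tauFam P f q.1) q.2 (1, z.1)| ≤ |C₉| * (1 + ‖z.1‖) :=
    ((fderiv ℝ (tauFam P f q.1) q.2).le_opNorm _).trans
      (mul_le_mul (b₉.trans (le_abs_self _)) (norm_dir_le _) (norm_nonneg _) (abs_nonneg _))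
  have bdF : |fderiv ℝ (fun p => flow f q.1 p z) q.2 (1, z.1)| ≤ (1 + ‖z.1‖) * g z * (1 + ‖z.1‖) :=
    ((fderiv ℝ (fun p => flow f q.1 p z) q.2).le_opNorm _).trans
      (mul_le_mul (h.norm_fderiv_flow_le hκ hp hz) (norm_dir_le _) (norm_nonneg _) (by positivity))
  have bD : |tauFam P f q.1 q.2 * fderiv ℝ (fun p => flow f q.1 p z) q.2 (1, z.1)
      + flow f q.1 q.2 z * fderiv ℝ (tauFam P f q.1) q.2 (1, z.1)|
      ≤ (2 * |C₈| + 2 * |C₉|) * ((1 + ‖z.1‖ ^ 2) * g z) := by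
    refine (abs_add_le _ _).trans ?_
    rw [abs_mul, abs_mul]
    calc _ ≤ |C₈| * ((1 + ‖z.1‖) * g z * (1 + ‖z.1‖))
          + (1 + ‖z.1‖) * g z * (|C₉| * (1 + ‖z.1‖)) := by
          refine add_le_add (mul_le_mul (b₈.trans (le_abs_self _)) bdF (abs_nonneg _)
            (abs_nonneg _)) (mul_le_mul (h.abs_flow_le hκ hp hz) bτ (abs_nonneg _) ?_)
          positivity
      _ = (|C₈| + |C₉|) * ((1 + ‖z.1‖) ^ 2 * g z) := by ring
      _ ≤ (|C₈| + |C₉|) * (2 * (1 + ‖z.1‖ ^ 2) * g z) := by gcongr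
      _ = _ := by ring
  have ef : f q.1 q.2.1 q.2.2 z = Real.exp (logMax P f q.1 q.2 z + logRatio P f q.1 q.2 z)
      - q.1 * tauFam P f q.1 q.2 * flow f q.1 q.2 z := by
    rw [← h.gaussian_eq_exp hκ hp, h.gaussian_eq hκ hp hz]; ring
  have eM : firstOrder P q.1 (f q.1 q.2.1) q.2.2 z = Real.exp (logMax P f q.1 q.2 z)
      - tauF P f q.1 q.2 * q.1 * Real.exp (logMax P f q.1 q.2 z)
        * correction P (f q.1 q.2.1) q.2.2 z := by
    rw [← h.maxwellian_eq_exp hκ hp]; rfl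
  rw [ef, eM]
  have a₁ := b₁ z hz
  have a₂ := b₂ z hz
  have a₅ := b₅ z hz
  have a₆ := b₆ z hz
  have a₇ := b₇ z hz
  simp only [abs_of_pos hκ0, pow_one, pow_zero, one_mul, Real.norm_eq_abs] at a₁ a₂ a₅ a₆ a₇ b₃
  exact abs_remainder_le hκ0 s1 a₁ a₂
    (b₃.trans (mul_le_mul_of_nonneg_right (le_max_left _ _) hκ0.le)) (b₄.trans (le_abs_self _))
    a₅ a₆ a₇ bF bD hC₂ (le_max_right _ _) hC₅ hC₆ hC₇
    (h.flow_eq hκ hp hz (dL z hz) (dY z hz) dτ) (h.leadRatio_eq hκ hp dT du z)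

omit hl in
theorem differentiableAt_velocity {κ : ℝ} (hκ : κ ∈ Ioo 0 Kn₀) {p : ST} (hp : p ∈ U) :
    DifferentiableAt ℝ (fun y => velocity (f κ p.1 y)) p.2 := by
  rw [differentiableAt_piLp]
  intro i
  -- The principal filter of the whole parameter interval gives differentiability for every κ, not
  -- only for small ones.
  have h1 := (h.smallC1_vel (mem_principal_self (Ioo 0 Kn₀)) i).diff
  rw [prod_principal_principal, eventually_principal] at h1
  exact differentiableAt_slice (h1 (κ, p) ⟨hκ, hp⟩)

omit hl in
theorem differentiableAt_tempEq {κ : ℝ} (hκ : κ ∈ Ioo 0 Kn₀) {p : ST} (hp : p ∈ U) :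
    DifferentiableAt ℝ (fun y => tempEq P (f κ p.1 y)) p.2 := by
  have h1 := (h.smallC1_eq (mem_principal_self (Ioo 0 Kn₀))).diff
  rw [prod_principal_principal, eventually_principal] at h1
  exact differentiableAt_slice (h1 (κ, p) ⟨hκ, hp⟩)

omit hl in
theorem exists_eTot_eq_energy {κ : ℝ} (hκ : κ ∈ Ioo 0 Kn₀) {p : ST} (hp : p ∈ U) :
    ∃ T, 0 < T ∧ eTot P T = energy P (f κ p.1 p.2) :=
  exists_eTot_eq P (h.enF_pos hκ hp)

theorem exists_remainder_bound (h0 : l ≤ 𝓝 0) : ∃ H : Phase → ℝ,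
    Integrable (fun z => (1 + ‖z.1‖ ^ 2 + z.2.1 + (z.2.2 : ℝ)) * H z) phaseMeasure ∧
    ∀ᶠ κ in l, ∀ p ∈ U, ∀ z : Phase, 0 ≤ z.2.1 →
      |f κ p.1 p.2 z - firstOrder P κ (f κ p.1) p.2 z| ≤ H z * κ ^ 2 := by
  obtain ⟨K₁, K₂, hK₁, hK₂, h1⟩ := h.remainder_le hl h0
  obtain ⟨c, hc, h2⟩ := h.exp_le_envelope hl h0
  obtain ⟨C, hC, h2⟩ := h2 5
  -- Multiplied by 1 + |v|² + ε + i, the second summand becomes the weight times g, integrable by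
  -- hypothesis.
  refine ⟨fun z => K₁ * (C * envelope c z) + K₂ * ((1 + ‖z.1‖ ^ 2) * g z), ?_, ?_⟩
  · refine (((integrable_mul_envelope hc).const_mul (K₁ * C)).add
      (h.g_int.const_mul K₂)).congr (Eventually.of_forall fun z => ?_)
    simp only [Pi.add_apply, weight]
    ring
  · have := h1.and h2
    rw [eventually_prod_principal_iff] at this
    filter_upwards [this] with κ hκ p hp z hz
    obtain ⟨h1, h2⟩ := hκ p hp
    refine (h1 z hz).trans (mul_le_mul_of_nonneg_right ?_ (sq_nonneg _))
    have := mul_le_mul_of_nonneg_left (h2 z hz) hK₁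
    linarith

end SolFamily

end ESBGK

/-! ### The Chapman–Enskog distribution -/

theorem mainTheorem5 (P : ESBGK.GasParams) (Kn₀ : ℝ) (hKn₀ : 0 < Kn₀)
    (U : Set (ℝ × ESBGK.E3)) (hU : IsOpen U)
    (f : ℝ → ℝ → ESBGK.E3 → ESBGK.Phase → ℝ)
    (hsol : ∀ Kn ∈ Set.Ioo 0 Kn₀, ESBGK.IsSolution P Kn U (f Kn))
    (hreg : ESBGK.UniformlyRegular P Kn₀ U f) :
    (∀ Kn ∈ Set.Ioo 0 Kn₀, ∀ t x, (t, x) ∈ U →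
      (∃ T, 0 < T ∧ ESBGK.eTot P T = ESBGK.energy P (f Kn t x)) ∧
      DifferentiableAt ℝ (fun y => ESBGK.velocity (f Kn t y)) x ∧
      DifferentiableAt ℝ (fun y => ESBGK.tempEq P (f Kn t y)) x) ∧
    ∃ h : ESBGK.Phase → ℝ,
      MeasureTheory.Integrable
        (fun z => (1 + ‖z.1‖ ^ 2 + z.2.1 + (z.2.2 : ℝ)) * h z) ESBGK.phaseMeasure ∧
      ∀ᶠ Kn in 𝓝[>] (0 : ℝ), ∀ t x, (t, x) ∈ U → ∀ z : ESBGK.Phase, 0 ≤ z.2.1 →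
        |f Kn t x z - ESBGK.firstOrder P Kn (f Kn t) x z| ≤ h z * Kn ^ 2 := by
  obtain ⟨g, hF⟩ := ESBGK.exists_solFamily hU hsol hreg
  refine ⟨fun Kn hKn t x hx => ⟨hF.exists_eTot_eq_energy (p := (t, x)) hKn hx,
    hF.differentiableAt_velocity (p := (t, x)) hKn hx,
    hF.differentiableAt_tempEq (p := (t, x)) hKn hx⟩, ?_⟩
  obtain ⟨H, hH, hb⟩ := hF.exists_remainder_bound (Ioo_mem_nhdsGT hKn₀) nhdsWithin_le_nhds
  exact ⟨H, hH, hb.mono fun κ hκ t x hx z hz => hκ (t, x) hx z hz⟩
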